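/- **Conventions.** A Riemann surface with boundary is a Hausdorff space with an atlas of charts in the closed upper half plane whose transition maps are holomorphic and smooth up to the boundary; $j$ denotes its complex structure. Let $(\Sigma,j)$ be a compact connected Riemann surface, possibly with boundary $\partial\Sigma$. A map $u\colon\Sigma\to (W,J)$ to an almost complex manifold is ($J$-)holomorphic if it is $C^1$ on $\Sigma$, smooth in the interior, and $J\circ Du=Du\circ j$. It is injective at $z_0\in\partial\Sigma$ if $u(z)=u(z_0)$ only for $z=z_0$. Put $\mathbb D=\{z\in\mathbb C: |z|\le 1\}$; "$\Sigma$ is a disk" means that there is a biholomorphism $\Sigma\to\mathbb D$. A function $f$ is $J$-plurisubharmonic at a point if $dd^Jf(v,Jv)>0$ for all tangent vectors $v\ne0$ there, where $d^Jf=-df\circ J$. Let $N_0=\{(z,\sqrt{1-|z|^2}): z\in\mathbb D\}\subset\mathbb C^2$, and for $s\in[0,1)$ let $u_s\colon\mathbb D\to\mathbb C^2$, $u_s(z)=(\sqrt{1-s^2}\,z,\,s)$, be the Bishop disk. Let $0<\delta<1$. **Dimension 4.** Let $U=\{(z_1,z_2)\in\mathbb C^2: \operatorname{Re} z_2>1-\delta,\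 \tfrac12(|z_1|^2+|z_2|^2)\le\tfrac12\}$, and let $u\colon\Sigma\to U$ be holomorphic with $u(\partial\Sigma)\subset N_0$. Then either $u$ is constant, or its image is one of the slices $L_{x_2}=U\cap(\mathbb C\times\{x_2\})$ with $x_2\in(1-\delta,1)$. If $u$ is injective at one of its boundary points, then $\Sigma$ is a disk, and there is $x_2\in(1-\delta,1)$ such that for every biholomorphism $\varphi\colon\Sigma\to\mathbb D$ there is a Möbius transformation $m$ of the unit disk with $u=u_{x_2}\circ m\circ\varphi$. **Higher dimensions.** Let $L$ be a closed manifold, $J_L$ a smooth almost complex structure on $T^*L$ for which the zero section is totally real, and $f_L\colon T^*L\to[0,\infty)$ a smooth function that vanishes exactly on the zero section and is $J_L$-plurisubharmonic on a neighborhood of it. On $\mathbb C^2\times T^*L$ let $J=i\oplus J_L$, $f=\tfrac12(|z_1|^2+|z_2|^2)+f_L$, let $N=N_0\times L$ ($L$ being the zero section), and $U=U_\delta=\{\operatorname{Re} z_2\ge1-\delta\}\cap\{f\le\tfrac12\}$. (a) If $U_{\delta_1}$ is compact for some $\delta_1\in(0,1)$, then $f$ is $J$-plurisubharmonic at every point of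 $U_\delta$ for all sufficiently small $\delta>0$. (b) Assume that $f$ is $J$-plurisubharmonic at every point of $U=U_\delta$. Let $u\colon\Sigma\to U$ be $J$-holomorphic with $u(\partial\Sigma)\subset N$. Then either $u$ is constant, or its image is one of the slices $L_{x_2,\mathbf q_0}=(\mathbb C\times\{x_2\}\times\{(\mathbf q_0,\mathbf 0)\})\cap U$ with $x_2\in[1-\delta,1)$ and $\mathbf q_0\in L$. If $u$ is injective at one of its boundary points, then $\Sigma$ is a disk, and there are $x_2\in[1-\delta,1)$ and $\mathbf q_0\in L$ such that for every biholomorphism $\varphi\colon\Sigma\to\mathbb D$ there is a Möbius transformation $m$ of the unit disk with $u=(u_{x_2}\circ m\circ\varphi;\ \mathbf q_0,\mathbf 0)$. -/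

import Mathlib

open Set Filter
open scoped Manifold ContDiff Topology Bundle

noncomputable section

/-! ### Compact Riemann surfaces with boundary

A Riemann surface with boundary is a Hausdorff space with an atlas of charts onto open subsets
of the closed upper half plane whose transition maps are holomorphic and smooth up to the boundary,
i.e. a `ChartedSpace ClosedHalfPlane S` with `IsManifold halfPlaneC ∞ S`. -/

/-- The closed upper half plane, the model space of Riemann surfaces with boundary. -/
abbrev ClosedHalfPlane : Type := {z : ℂ // 0 ≤ z.im}

/-- The inclusion of the closed half plane in `ℂ`, with the retraction `x + iy ↦ x + i max(y,0)`. -/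
def halfPlaneEquiv : PartialEquiv ClosedHalfPlane ℂ where
  toFun := Subtype.val
  invFun z := ⟨⟨z.re, max z.im 0⟩, le_max_right _ _⟩
  source := univ
  target := {z | 0 ≤ z.im}
  map_source' z _ := z.property
  map_target' _ _ := mem_univ _
  left_inv' z _ := by
    ext
    exact Complex.ext rfl (max_eq_left z.property)
  right_inv' z hz := Complex.ext rfl (max_eq_left hz)

lemma continuous_halfPlaneEquiv : Continuous halfPlaneEquiv := continuous_subtype_val

lemma continuous_halfPlaneEquiv_symm : Continuous halfPlaneEquiv.symm := by
  refine Continuous.subtype_mk ?_ _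
  have h : (fun z : ℂ => (⟨z.re, max z.im 0⟩ : ℂ))
      = fun z : ℂ => (z.re : ℂ) + ((max z.im 0 : ℝ) : ℂ) * Complex.I := by
    funext z
    apply Complex.ext <;> simp
  rw [h]
  fun_prop

lemma range_halfPlaneEquiv : range halfPlaneEquiv = {z : ℂ | 0 ≤ z.im} := Subtype.range_val

lemma convex_range_halfPlaneEquiv : Convex ℝ (range halfPlaneEquiv) := by
  rw [range_halfPlaneEquiv]
  exact convex_halfSpace_im_ge 0

lemma nonempty_interior_range_halfPlaneEquiv : (interior (range halfPlaneEquiv)).Nonempty := by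
  rw [range_halfPlaneEquiv]
  refine ⟨Complex.I, mem_interior.2 ⟨{z | 0 < z.im}, fun z (hz : 0 < z.im) => hz.le, ?_, ?_⟩⟩
  · exact isOpen_lt continuous_const Complex.continuous_im
  · simp

/-- The closed half plane as a model over `ℂ`. Maps that are `C^n` with respect to it are `C^n` up
to the boundary with complex linear derivative. -/
def halfPlaneC : ModelWithCorners ℂ ℂ ClosedHalfPlane where
  toPartialEquiv := halfPlaneEquiv
  source_eq := rfl
  convex_range' := by
    have h : IsRCLikeNormedField ℂ := inferInstance
    simp only [h, ↓reduceDIte]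
    exact convex_range_halfPlaneEquiv.convex_isRCLikeNormedField
  nonempty_interior' := nonempty_interior_range_halfPlaneEquiv
  continuous_toFun := continuous_halfPlaneEquiv
  continuous_invFun := continuous_halfPlaneEquiv_symm

/-- The closed half plane as a model over `ℝ`, for the underlying real surface. -/
def halfPlaneR : ModelWithCorners ℝ ℂ ClosedHalfPlane where
  toPartialEquiv := halfPlaneEquiv
  source_eq := rfl
  convex_range' := by
    simp only [instIsRCLikeNormedField, ↓reduceDIte]
    exact convex_range_halfPlaneEquiv.convex_isRCLikeNormedField
  nonempty_interior' := nonempty_interior_range_halfPlaneEquiv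
  continuous_toFun := continuous_halfPlaneEquiv
  continuous_invFun := continuous_halfPlaneEquiv_symm

/-- Multiplication by `i` on a complex vector space, as a real linear map. -/
def mulI (V : Type*) [NormedAddCommGroup V] [NormedSpace ℂ V] : V →L[ℝ] V :=
  Complex.I • ContinuousLinearMap.id ℝ V

section AlmostComplex

variable {E : Type*} [NormedAddCommGroup E] [NormedSpace ℝ E]
  {H : Type*} [TopologicalSpace H]
  {M : Type*} [TopologicalSpace M] [ChartedSpace H M]

/-- A field of endomorphisms of the tangent spaces. -/
abbrev EndField (I : ModelWithCorners ℝ E H) (M : Type*) [TopologicalSpace M] [ChartedSpace H M] :=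
  ∀ p : M, TangentSpace I p →L[ℝ] TangentSpace I p

/-- `J` is a smooth almost complex structure: a smooth section of `End(TM)` with `J² = -1`. -/
structure IsAlmostComplex (I : ModelWithCorners ℝ E H) [IsManifold I 1 M] (J : EndField I M) : Prop where
  sq_eq_neg : ∀ (p : M) (v : TangentSpace I p), J p (J p v) = -v
  smooth : ContMDiff I.tangent I.tangent ∞
    (fun v : TangentBundle I M => (⟨v.1, J v.1 v.2⟩ : TangentBundle I M))

/-- The complex structure `j` of a Riemann surface with boundary. The tangent space at `z` is
identified with `ℂ` by the (holomorphic) preferred chart at `z`. -/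
def surfaceJ (S : Type*) [TopologicalSpace S] [ChartedSpace ClosedHalfPlane S] :
    EndField halfPlaneR S :=
  fun _ => mulI ℂ

/-- The standard complex structure `i` on a complex vector space, viewed as a manifold. -/
def standardJ (V : Type*) [NormedAddCommGroup V] [NormedSpace ℂ V] : EndField 𝓘(ℝ, V) V :=
  fun _ => mulI V

/-- A `J`-holomorphic map from a Riemann surface with boundary to an almost complex manifold:
`C^1` up to the boundary, smooth in the interior, and `J ∘ Du = Du ∘ j` everywhere. -/
structure IsJHolomorphic {S : Type*} [TopologicalSpace S] [ChartedSpace ClosedHalfPlane S]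
    (I : ModelWithCorners ℝ E H) (J : EndField I M) (u : S → M) : Prop where
  contMDiff_one : ContMDiff halfPlaneR I 1 u
  smooth_interior : ∀ z ∈ halfPlaneR.interior S, ContMDiffAt halfPlaneR I ∞ u z
  comm : ∀ (z : S) (v : TangentSpace halfPlaneR z),
    mfderiv halfPlaneR I u z (surfaceJ S z v) = J (u z) (mfderiv halfPlaneR I u z v)

/-- The `1`-form `d^J f = - df ∘ J`. -/
def dJ (I : ModelWithCorners ℝ E H) (J : EndField I M) (f : M → ℝ) (p : M) :
    TangentSpace I p →L[ℝ] ℝ :=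
  -((show TangentSpace I p →L[ℝ] ℝ from mfderiv I 𝓘(ℝ, ℝ) f p).comp (J p))

/-- The `1`-form `α` written in the preferred chart at `p`. -/
def chartOneForm (I : ModelWithCorners ℝ E H) (α : ∀ p : M, TangentSpace I p →L[ℝ] ℝ) (p : M)
    (y : E) : E →L[ℝ] ℝ :=
  (α ((extChartAt I p).symm y)).comp
    (mfderivWithin 𝓘(ℝ, E) I (extChartAt I p).symm (range I) y)

/-- The exterior derivative of a `1`-form on a manifold: in the preferred chart at `p`,
`dα(v, w) = (D_v α)(w) - (D_w α)(v)`. (That chart identifies the tangent space at `p` with `E`.) -/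
def dOneForm (I : ModelWithCorners ℝ E H) (α : ∀ p : M, TangentSpace I p →L[ℝ] ℝ) (p : M)
    (v w : TangentSpace I p) : ℝ :=
  let D : E →L[ℝ] E →L[ℝ] ℝ := fderivWithin ℝ (chartOneForm I α p) (range I) (extChartAt I p p)
  D v w - D w v

/-- `f` is `J`-plurisubharmonic at `p`: `dd^J f (v, Jv) > 0` for all `v ≠ 0` tangent at `p`. -/
def IsPSHAt (I : ModelWithCorners ℝ E H) (J : EndField I M) (f : M → ℝ) (p : M) : Prop :=
  ∀ v : TangentSpace I p, v ≠ 0 → 0 < dOneForm I (dJ I J f) p v (J p v)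

end AlmostComplex

/-! ### The disk -/

/-- `φ` is a biholomorphism from `S` onto the closed unit disk. -/
structure IsDiskBiholomorphism {S : Type*} [TopologicalSpace S] [ChartedSpace ClosedHalfPlane S]
    (φ : S → ℂ) : Prop where
  holomorphic : IsJHolomorphic 𝓘(ℝ, ℂ) (standardJ ℂ) φ
  injective : Function.Injective φ
  range_eq : range φ = Metric.closedBall (0 : ℂ) 1
  immersion : ∀ z : S, Function.Injective (mfderiv halfPlaneR 𝓘(ℝ, ℂ) φ z)

/-- Möbius transformations of the unit disk. -/
def IsDiskMobius (m : ℂ → ℂ) : Prop :=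
  ∃ c a : ℂ, ‖c‖ = 1 ∧ ‖a‖ < 1 ∧ ∀ z, m z = c * (z - a) / (1 - (starRingEnd ℂ) a * z)

/-- The Bishop disk `u_s(z) = (√(1-s²) z, s)`. -/
def bishopDisk (s : ℝ) (z : ℂ) : ℂ × ℂ := ((Real.sqrt (1 - s ^ 2) : ℂ) * z, (s : ℂ))

/-! ### The four dimensional model -/

/-- `h(z₁,z₂) = (|z₁|² + |z₂|²)/2`. -/
def hFun (p : ℂ × ℂ) : ℝ := (‖p.1‖ ^ 2 + ‖p.2‖ ^ 2) / 2

/-- The disk `N₀ = {(z, √(1-|z|²)) : |z| ≤ 1}` in the unit sphere. -/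
def bishopN₀ : Set (ℂ × ℂ) :=
  (fun z : ℂ => (z, (Real.sqrt (1 - ‖z‖ ^ 2) : ℂ))) '' Metric.closedBall (0 : ℂ) 1

/-- The neighborhood `U` of `(0,1)` in the closed unit ball. -/
def modelU4 (δ : ℝ) : Set (ℂ × ℂ) := {p | 1 - δ < p.2.re ∧ hFun p ≤ 1 / 2}

/-- The slice `L_s = U ∩ (ℂ × {s})`. -/
def slice4 (δ s : ℝ) : Set (ℂ × ℂ) := {p ∈ modelU4 δ | p.2 = (s : ℂ)}

/-! ### The higher dimensional model -/

section HighDim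

variable (n : ℕ) (L : Type*) [TopologicalSpace L] [ChartedSpace (EuclideanSpace ℝ (Fin n)) L]
  [IsManifold 𝓘(ℝ, EuclideanSpace ℝ (Fin n)) ∞ L]

/-- The total space `T*L` of the cotangent bundle. -/
abbrev Cotangent :=
  Bundle.TotalSpace (EuclideanSpace ℝ (Fin n) →L[ℝ] ℝ)
    (fun q : L => TangentSpace 𝓘(ℝ, EuclideanSpace ℝ (Fin n)) q →L[ℝ] Bundle.Trivial L ℝ q)

/-- The model with corners of `T*L`. -/
abbrev cotangentModel :=
  (𝓘(ℝ, EuclideanSpace ℝ (Fin n))).prod 𝓘(ℝ, EuclideanSpace ℝ (Fin n) →L[ℝ] ℝ)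

/-- The model with corners of `ℂ² × T*L`. -/
abbrev totalModel := (𝓘(ℝ, ℂ × ℂ)).prod (cotangentModel n)

variable {n L}

/-- The zero section `L → T*L`. -/
def zeroSec (q : L) : Cotangent n L := ⟨q, 0⟩

/-- The zero section is totally real for `J`: `TL ∩ J(TL) = 0`. -/
def ZeroSecTotallyReal (J : EndField (cotangentModel n) (Cotangent n L)) : Prop :=
  ∀ (q : L) (v w : TangentSpace 𝓘(ℝ, EuclideanSpace ℝ (Fin n)) q),
    J (zeroSec q) (mfderiv 𝓘(ℝ, EuclideanSpace ℝ (Fin n)) (cotangentModel n) zeroSec q v)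
      = mfderiv 𝓘(ℝ, EuclideanSpace ℝ (Fin n)) (cotangentModel n) zeroSec q w →
    v = 0

/-- The data `(J_L, f_L)` of the model: an almost complex structure on `T*L` for which the zero
section is totally real, and a function `f_L : T*L → [0,∞)` that vanishes exactly on the zero
section and is `J_L`-plurisubharmonic near it. -/
structure IsCotangentData (J : EndField (cotangentModel n) (Cotangent n L))
    (fL : Cotangent n L → ℝ) : Prop where
  almostComplex : IsAlmostComplex (cotangentModel n) J
  totallyReal : ZeroSecTotallyReal J
  smooth : ContMDiff (cotangentModel n) 𝓘(ℝ, ℝ) ∞ fL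
  nonneg : ∀ x, 0 ≤ fL x
  zero_iff : ∀ x, fL x = 0 ↔ x ∈ range (zeroSec : L → Cotangent n L)
  psh_near : ∀ᶠ x in 𝓝ˢ (range (zeroSec : L → Cotangent n L)), IsPSHAt (cotangentModel n) J fL x

/-- The almost complex structure `i ⊕ J_L` on `ℂ² × T*L`. -/
def totalJ (J : EndField (cotangentModel n) (Cotangent n L)) :
    EndField (totalModel n) ((ℂ × ℂ) × Cotangent n L) :=
  fun p => (mulI (ℂ × ℂ)).prodMap (J p.2)

/-- `f(z₁,z₂,q,p) = (|z₁|² + |z₂|²)/2 + f_L(q,p)`. -/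
def totalF (fL : Cotangent n L → ℝ) (p : (ℂ × ℂ) × Cotangent n L) : ℝ := hFun p.1 + fL p.2

/-- `N = N₀ × (zero section)`. -/
def modelN : Set ((ℂ × ℂ) × Cotangent n L) := bishopN₀ ×ˢ range zeroSec

/-- The model neighborhood `U = {Re z₂ ≥ 1 - δ} ∩ {f ≤ 1/2}`. -/
def modelU (fL : Cotangent n L → ℝ) (δ : ℝ) : Set ((ℂ × ℂ) × Cotangent n L) :=
  {p | 1 - δ ≤ p.1.2.re ∧ totalF fL p ≤ 1 / 2}

/-- The slice `L_{s,q₀} = (ℂ × {s} × {q₀}) ∩ U`. -/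
def slice (fL : Cotangent n L → ℝ) (δ s : ℝ) (q₀ : L) : Set ((ℂ × ℂ) × Cotangent n L) :=
  {p ∈ modelU fL δ | p.1.2 = (s : ℂ) ∧ p.2 = zeroSec q₀}

end HighDim

end

/-! The second coordinate of the `ℂ²` component is holomorphic on the surface and real on the
boundary, because `bishopN₀` has real second coordinate. On a compact connected surface such a
function is constant (`IsChartHolomorphic.eq_of_im_boundary_eq_zero`, the maximum principle for the
modulus of an exponential). Once the second coordinate is a constant `s`, the first has modulus at
most `√(1 - s²)`, with equality on the boundary. After rescaling it becomes a map `g` to the closed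
disk that sends boundary to unit circle, and the curve is the Bishop disk `u_s` composed with `g`
(`exists_eq_bishopDisk`).

A nonconstant such `g` extends across the boundary by Schwarz reflection
(`IsProperToDisk.exists_local_extension`). It is therefore open relative to the disk, and
compactness makes it onto; this identifies the image as a full slice. If `g` takes a boundary value
only once, a degree-one argument applies. By Hopf's lemma `g` is locally injective at that boundary
point, so some nearby values in the open disk are simple. The simple values form an open and
relatively closed subset of the open disk, hence all of it
(`IsProperToDisk.ball_subset_simpleValues`), and `g` is a biholomorphism. Two biholomorphisms to the
disk differ by an automorphism, which the Schwarz lemma identifies as a Möbius transformation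
(`IsDiskBiholomorphism.exists_mobius`).

In higher dimensions the `T*L` component is `J_L`-holomorphic, and `f_L` along it is nonnegative,
zero on the boundary and subharmonic. The strong maximum principle makes `f_L` constant along the
component; strict plurisubharmonicity then kills the derivative (`IsJHolomorphic.eq_of_isPSHAt`).
The hypothesis concerns `f` rather than `f_L`, but `dd^J f` splits as a direct sum, so positivity
for `f_L` is read off from it (`isPSHAt_of_isPSHAt_sumF`). Part (a) uses the same splitting: `f_L`
is bounded below by a positive constant on the compact set outside a neighborhood of the zero
section, while it is at most `δ` on `U_δ`. -/

/-! ### Local properties of holomorphic functions of one variable -/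

/-- Local normal form: an analytic function that is not locally constant is the `m`-th power of a
local coordinate. -/
lemma AnalyticAt.exists_pow_normal_form {G : ℂ → ℂ} {x : ℂ} (hG : AnalyticAt ℂ G x)
    (hne : ¬ ∀ᶠ z in 𝓝 x, G z = G x) :
    ∃ (m : ℕ) (k : ℂ → ℂ), m ≠ 0 ∧ AnalyticAt ℂ k x ∧ k x = 0 ∧ deriv k x ≠ 0 ∧
      ∀ᶠ z in 𝓝 x, G z = G x + k z ^ m := by
  have h1 : AnalyticAt ℂ (fun z => G z - G x) x := hG.sub analyticAt_const
  obtain ⟨m, q, hq, hqx, hGq⟩ := h1.exists_eventuallyEq_pow_smul_nonzero_iff.2 (by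
    simpa [sub_eq_zero] using hne)
  have hm : m ≠ 0 := by
    rintro rfl
    have := hGq.self_of_nhds
    simp at this
    exact hqx this.symm
  obtain ⟨c, hc⟩ : ∃ c : ℂ, c ^ m = q x := IsAlgClosed.exists_pow_nat_eq _ (Nat.pos_of_ne_zero hm)
  have hc0 : c ≠ 0 := by
    rintro rfl
    rw [zero_pow hm] at hc
    exact hqx hc.symm
  have hquot : AnalyticAt ℂ (fun z => q z / q x) x := hq.div analyticAt_const hqx
  -- An `m`-th root of `q` near `x`: the quotient `q / q x` is `1` at `x`, where the principal
  -- logarithm is analytic, and `c` restores the constant `q x`.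
  set l : ℂ → ℂ := fun z => c * Complex.exp (Complex.log (q z / q x) / m) with hl
  have hlog : AnalyticAt ℂ (fun z => Complex.log (q z / q x)) x :=
    hquot.clog (by simp [hqx])
  have hla : AnalyticAt ℂ l x := analyticAt_const.mul (hlog.div_const.cexp)
  have hlx : l x = c := by simp [hl, hqx]
  have hka : AnalyticAt ℂ (fun z => (z - x) * l z) x :=
    (analyticAt_id.sub analyticAt_const).mul hla
  refine ⟨m, fun z => (z - x) * l z, hm, hka, by simp, ?_, ?_⟩
  · have : HasDerivAt (fun z => (z - x) * l z) (1 * l x + (x - x) * deriv l x) x :=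
      ((hasDerivAt_id x).sub_const x).mul hla.differentiableAt.hasDerivAt
    rw [this.deriv]
    simpa [hlx] using hc0
  · have hq0 : ∀ᶠ z in 𝓝 x, q z ≠ 0 := hq.continuousAt.eventually_ne hqx
    filter_upwards [hGq, hq0] with z hz hz0
    have : l z ^ m = q z := by
      rw [hl]
      simp only
      rw [mul_pow, hc, ← Complex.exp_nat_mul, mul_div_cancel₀ _ (by exact_mod_cast hm),
        Complex.exp_log (div_ne_zero hz0 hqx), mul_div_cancel₀ _ hqx]
    rw [mul_pow, this]
    simp only [smul_eq_mul] at hz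
    linear_combination hz

lemma AnalyticAt.exists_nhds_injOn {G : ℂ → ℂ} {x : ℂ} (hG : AnalyticAt ℂ G x)
    (hd : deriv G x ≠ 0) : ∃ O ∈ 𝓝 x, InjOn G O := by
  have h := hG.hasStrictDerivAt.hasStrictFDerivAt_equiv hd
  exact ⟨_, (h.toOpenPartialHomeomorph G).open_source.mem_nhds h.mem_toOpenPartialHomeomorph_source,
    (h.toOpenPartialHomeomorph G).injOn⟩

/-- The open mapping theorem at a point. -/
lemma AnalyticAt.image_mem_nhds {G : ℂ → ℂ} {x : ℂ} (hG : AnalyticAt ℂ G x)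
    (hne : ¬ ∀ᶠ z in 𝓝 x, G z = G x) {O : Set ℂ} (hO : O ∈ 𝓝 x) : G '' O ∈ 𝓝 (G x) :=
  hG.eventually_constant_or_nhds_le_map_nhds.resolve_left hne (image_mem_map hO)

/-- Near a critical point, an analytic function takes every nearby value at least twice. -/
lemma AnalyticAt.eventually_two_preimages {G : ℂ → ℂ} {x : ℂ} (hG : AnalyticAt ℂ G x)
    (hne : ¬ ∀ᶠ z in 𝓝 x, G z = G x) (hd : deriv G x = 0) {O : Set ℂ} (hO : O ∈ 𝓝 x) :
    ∀ᶠ w in 𝓝[≠] (G x), ∃ y₁ ∈ O, ∃ y₂ ∈ O, y₁ ≠ y₂ ∧ G y₁ = w ∧ G y₂ = w := by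
  obtain ⟨m, k, hm, hk, hkx, hkd, hkG⟩ := hG.exists_pow_normal_form hne
  have hm1 : m ≠ 1 := by
    rintro rfl
    have : deriv G x = deriv k x := by
      have h2 : G =ᶠ[𝓝 x] fun z => G x + k z := by
        filter_upwards [hkG] with z hz
        simpa using hz
      rw [h2.deriv_eq, deriv_const_add]
    exact hkd (this ▸ hd)
  have hkne : ¬ ∀ᶠ z in 𝓝 x, k z = k x := by
    intro h
    have h2 : k =ᶠ[𝓝 x] fun _ => k x := h
    apply hkd
    rw [h2.deriv_eq, deriv_const]
  have him : k '' (O ∩ {z | G z = G x + k z ^ m}) ∈ 𝓝 (0 : ℂ) := by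
    have := hk.image_mem_nhds hkne (inter_mem hO hkG)
    rwa [hkx] at this
  obtain ⟨r, hr, hball⟩ := Metric.mem_nhds_iff.1 him
  have hw : ∀ᶠ w in 𝓝[≠] (G x), ‖w - G x‖ < r ^ m := by
    apply eventually_nhdsWithin_of_eventually_nhds
    have : Metric.ball (G x) (r ^ m) ∈ 𝓝 (G x) := Metric.ball_mem_nhds _ (pow_pos hr m)
    filter_upwards [this] with w hw
    rwa [Metric.mem_ball, dist_eq_norm] at hw
  filter_upwards [hw, self_mem_nhdsWithin] with w hwr hwne
  obtain ⟨ε, hε⟩ : ∃ ε : ℂ, ε ^ m = w - G x :=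
    IsAlgClosed.exists_pow_nat_eq _ (Nat.pos_of_ne_zero hm)
  have hεr : ‖ε‖ < r := by
    rw [← hε, norm_pow] at hwr
    exact lt_of_pow_lt_pow_left₀ m hr.le hwr
  have hε0 : ε ≠ 0 := by
    rintro rfl
    rw [zero_pow hm] at hε
    exact hwne (sub_eq_zero.1 hε.symm)
  -- Since `m ≠ 1`, the numbers `ε` and `ζ * ε` are distinct `m`-th roots of `w - G x`. Both lie in
  -- the ball covered by the local coordinate `k`, and their preimages are the two points.
  have hζ := Complex.isPrimitiveRoot_exp m hm
  set ζ := Complex.exp (2 * Real.pi * Complex.I / m)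
  have hζ1 : ζ ≠ 1 := hζ.ne_one (by omega)
  have hζn : ‖ζ‖ = 1 := hζ.norm'_eq_one hm
  obtain ⟨y₁, hy₁, hk₁⟩ := hball (show ε ∈ Metric.ball 0 r by simpa using hεr)
  obtain ⟨y₂, hy₂, hk₂⟩ := hball (show ζ * ε ∈ Metric.ball 0 r by simpa [hζn] using hεr)
  refine ⟨y₁, hy₁.1, y₂, hy₂.1, ?_, ?_, ?_⟩
  · rintro rfl
    rw [hk₁] at hk₂
    exact hζ1 (mul_right_cancel₀ hε0 (by rw [one_mul]; exact hk₂.symm))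
  · rw [hy₁.2, hk₁, hε]; ring
  · rw [hy₂.2, hk₂, mul_pow, hζ.pow_eq_one, hε]; ring

/-- Hopf's lemma for a bounded analytic function at a point of the real axis where its modulus is
maximal in the upper half plane. -/
lemma AnalyticAt.deriv_ne_zero_of_norm_le_one {G : ℂ → ℂ} {x : ℂ} (hG : AnalyticAt ℂ G x)
    (hne : ¬ ∀ᶠ z in 𝓝 x, G z = G x) (hx : x.im = 0) (hGx : ‖G x‖ = 1)
    (hle : ∀ᶠ z in 𝓝 x, 0 ≤ z.im → ‖G z‖ ≤ 1) : deriv G x ≠ 0 := by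
  intro hd
  have h1 : AnalyticAt ℂ (fun z => G z - G x) x := hG.sub analyticAt_const
  obtain ⟨m, q, hq, hqx, hGq⟩ := h1.exists_eventuallyEq_pow_smul_nonzero_iff.2 (by
    simpa [sub_eq_zero] using hne)
  have hm : 2 ≤ m := by
    by_contra hlt
    have : m = 0 ∨ m = 1 := by omega
    rcases this with rfl | rfl
    · have := hGq.self_of_nhds
      simp at this
      exact hqx this.symm
    · have h2 : G =ᶠ[𝓝 x] fun z => G x + (z - x) * q z := by
        filter_upwards [hGq] with z hz
        simp only [pow_one, smul_eq_mul] at hz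
        linear_combination hz
      have h3 : HasDerivAt (fun z => G x + (z - x) * q z) (1 * q x + (x - x) * deriv q x) x :=
        (((hasDerivAt_id x).sub_const x).mul hq.differentiableAt.hasDerivAt).const_add _
      rw [h2.deriv_eq, h3.deriv] at hd
      simp at hd
      exact hqx hd
  set a := (starRingEnd ℂ) (G x) * q x with ha
  have ha0 : a ≠ 0 := mul_ne_zero (by
    rw [Ne, map_eq_zero]
    intro h
    simp [h] at hGx) hqx
  -- The bound on the modulus gives `Re (conj (G x) * (G (x + t e) - G x)) ≤ 0`; divide by `t ^ m`
  -- and let `t` tend to `0` along the ray of direction `e`.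
  have key : ∀ e : ℂ, 0 ≤ e.im → (e ^ m * a).re ≤ 0 := by
    intro e he
    have hlim : Tendsto (fun t : ℝ => x + t * e) (𝓝[>] 0) (𝓝 x) := by
      have : Continuous fun t : ℝ => x + t * e := by fun_prop
      have h := this.tendsto 0
      simp only [Complex.ofReal_zero, zero_mul, add_zero] at h
      exact h.mono_left nhdsWithin_le_nhds
    have h4 : Tendsto (fun t : ℝ => (e ^ m * ((starRingEnd ℂ) (G x) * q (x + t * e))).re) (𝓝[>] 0)
        (𝓝 (e ^ m * a).re) := by
      apply (Complex.continuous_re.tendsto _).comp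
      exact tendsto_const_nhds.mul (tendsto_const_nhds.mul (hq.continuousAt.tendsto.comp hlim))
    refine le_of_tendsto h4 ?_
    filter_upwards [hlim.eventually hGq, hlim.eventually hle, self_mem_nhdsWithin] with t h5 h6 ht
    have ht : (0 : ℝ) < t := ht
    have h7 : ‖G (x + t * e)‖ ≤ 1 := h6 (by simp [hx]; positivity)
    have h8 : ((starRingEnd ℂ) (G x) * (G (x + t * e) - G x)).re ≤ 0 := by
      have h9 : (starRingEnd ℂ) (G x) * G x = 1 := by
        rw [mul_comm, Complex.mul_conj, Complex.normSq_eq_norm_sq, hGx]; simp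
      rw [mul_sub, h9, Complex.sub_re, Complex.one_re, sub_nonpos]
      refine (Complex.re_le_norm _).trans ?_
      rw [norm_mul, RCLike.norm_conj, hGx, one_mul]
      exact h7
    rw [h5] at h8
    have h10 : (starRingEnd ℂ) (G x) * ((x + t * e - x) ^ m • q (x + t * e))
        = ((t ^ m : ℝ) : ℂ) * (e ^ m * ((starRingEnd ℂ) (G x) * q (x + t * e))) := by
      simp only [smul_eq_mul, add_sub_cancel_left, mul_pow]
      push_cast
      ring
    rw [h10, Complex.re_ofReal_mul] at h8
    exact nonpos_of_mul_nonpos_right h8 (pow_pos ht m)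
  have hmR : (2 : ℝ) ≤ m := by exact_mod_cast hm
  have hmpos : (0 : ℝ) < m := by linarith
  have hexp : ∀ θ : ℝ, 0 ≤ θ → θ ≤ Real.pi →
      (Complex.exp ((m * θ : ℝ) * Complex.I) * a).re ≤ 0 := by
    intro θ h0 h1
    have := key (Complex.exp (θ * Complex.I)) (by
      rw [Complex.exp_ofReal_mul_I_im]; exact Real.sin_nonneg_of_nonneg_of_le_pi h0 h1)
    rwa [← Complex.exp_nat_mul, show (m : ℂ) * (θ * Complex.I) = ((m * θ : ℝ) : ℂ) * Complex.I by
      push_cast; ring] at this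
  -- Because `m ≥ 2`, the `m`-th powers of the upper half circle cover the whole circle. The four
  -- axis directions then force `a = 0`.
  have hall : ∀ φ : ℝ, 0 ≤ φ → φ ≤ 2 * Real.pi →
      (Complex.exp (φ * Complex.I) * a).re ≤ 0 := by
    intro φ h0 h1
    have := hexp (φ / m) (by positivity) (by
      rw [div_le_iff₀ hmpos]; nlinarith [Real.pi_pos])
    rwa [mul_div_cancel₀ _ hmpos.ne'] at this
  have e0 := hall 0 le_rfl (by positivity)
  have e1 := hall (Real.pi / 2) (by positivity) (by linarith [Real.pi_pos])
  have e2 := hall Real.pi (by positivity) (by linarith [Real.pi_pos])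
  have e3 := hall (Real.pi + Real.pi / 2) (by positivity) (by linarith [Real.pi_pos])
  have h32 : Complex.exp (((Real.pi + Real.pi / 2 : ℝ) : ℂ) * Complex.I) = -Complex.I := by
    push_cast
    rw [add_mul, Complex.exp_add, Complex.exp_pi_mul_I, Complex.exp_pi_div_two_mul_I]
    ring
  rw [h32] at e3
  rw [show ((Real.pi / 2 : ℝ) : ℂ) = (Real.pi : ℂ) / 2 by push_cast; rfl,
    Complex.exp_pi_div_two_mul_I] at e1
  rw [Complex.exp_pi_mul_I] at e2
  simp at e0 e1 e2 e3
  exact ha0 (Complex.ext (by simp; linarith) (by simp; linarith))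

-- Conjugation commutes with difference quotients. The version within a set is needed on the real
-- axis, where the function is differentiable only from one side.
open ComplexConjugate in
lemma HasDerivWithinAt.conj_comp_conj {f : ℂ → ℂ} {a y : ℂ} {s : Set ℂ}
    (hf : HasDerivWithinAt f a s (conj y)) :
    HasDerivWithinAt (fun z => conj (f (conj z))) (conj a) {z | conj z ∈ s} y := by
  rw [hasDerivWithinAt_iff_tendsto_slope] at hf ⊢
  have h1 : Tendsto (fun z : ℂ => conj z) (𝓝[{z | conj z ∈ s} \ {y}] y)
      (𝓝[s \ {conj y}] (conj y)) := by
    refine tendsto_nhdsWithin_iff.2 ⟨(Complex.continuous_conj.tendsto y).mono_left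
      nhdsWithin_le_nhds, ?_⟩
    filter_upwards [self_mem_nhdsWithin] with z hz
    exact ⟨hz.1, fun h => hz.2 ((starRingEnd ℂ).injective h)⟩
  have h2 := (Complex.continuous_conj.tendsto a).comp (hf.comp h1)
  refine h2.congr fun z => ?_
  simp [slope_def_field]

open ComplexConjugate in
/-- Schwarz reflection in the circle for functions that are complex differentiable up to the real
axis. -/
lemma exists_analyticAt_reflection {f : ℂ → ℂ} {x : ℂ} {r : ℝ} (hr : 0 < r) (hx : x.im = 0)
    (hf : ∀ y ∈ Metric.ball x r, 0 ≤ y.im → DifferentiableWithinAt ℂ f {z | 0 ≤ z.im} y)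
    (hb : ∀ y ∈ Metric.ball x r, y.im = 0 → ‖f y‖ = 1)
    (hle : ∀ y ∈ Metric.ball x r, 0 ≤ y.im → ‖f y‖ ≤ 1) :
    ∃ G : ℂ → ℂ, AnalyticAt ℂ G x ∧ (∀ᶠ y in 𝓝 x, 0 ≤ y.im → f y = G y) ∧
      ∀ᶠ y in 𝓝 x, y.im < 0 → 1 ≤ ‖G y‖ := by
  have hfx : f x ≠ 0 := by
    have := hb x (Metric.mem_ball_self hr) hx
    intro h
    simp [h] at this
  have hcont : ∀ᶠ y in 𝓝[{z | 0 ≤ z.im}] x, f y ≠ 0 :=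
    (hf x (Metric.mem_ball_self hr) hx.ge).continuousWithinAt.eventually_ne hfx
  rw [eventually_nhdsWithin_iff] at hcont
  obtain ⟨ρ, hρ, hρf⟩ := Metric.eventually_nhds_iff_ball.1 (hcont.and (Metric.ball_mem_nhds x hr))
  have hconj : ∀ y ∈ Metric.ball x ρ, conj y ∈ Metric.ball x ρ := by
    intro y hy
    have : conj x = x := Complex.conj_eq_iff_im.2 hx
    rw [Metric.mem_ball, dist_eq_norm] at hy ⊢
    rwa [← this, ← map_sub, RCLike.norm_conj]
  -- The radius `ρ` was chosen so that `f` has no zero on the half ball, so the reflected branch has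
  -- no poles.
  set G : ℂ → ℂ := fun z => if 0 ≤ z.im then f z else (conj (f (conj z)))⁻¹ with hG
  have hunit : ∀ w : ℂ, ‖w‖ = 1 → (conj w)⁻¹ = w := by
    intro w hw
    refine inv_eq_of_mul_eq_one_right ?_
    rw [mul_comm, Complex.mul_conj, Complex.normSq_eq_norm_sq, hw]; simp
  have hdiff : DifferentiableOn ℂ G (Metric.ball x ρ) := by
    intro y hy
    apply DifferentiableAt.differentiableWithinAt
    rcases lt_trichotomy y.im 0 with him | him | him
    · have h1 : DifferentiableAt ℂ f (conj y) :=
        (hf _ (hρf _ (hconj y hy)).2 (by simpa using him.le)).differentiableAt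
          ((isOpen_lt continuous_const Complex.continuous_im).mem_nhds
            (show 0 < (conj y).im by simpa using him) |> mem_of_superset <|
              fun z (hz : 0 < z.im) => hz.le)
      have h2 : DifferentiableAt ℂ (fun z => (conj (f (conj z)))⁻¹) y := by
        have := h1.conj_conj
        simp only [Complex.conj_conj] at this
        refine DifferentiableAt.inv this ?_
        simpa using (hρf _ (hconj y hy)).1 (by simpa using him.le)
      refine h2.congr_of_eventuallyEq ?_
      filter_upwards [(isOpen_lt Complex.continuous_im continuous_const).mem_nhds him] with z hz
      exact if_neg (not_le.2 hz)
    · have h1 : HasDerivWithinAt f (derivWithin f {z | 0 ≤ z.im} y) {z | 0 ≤ z.im} y :=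
        (hf y (hρf y hy).2 him.ge).hasDerivWithinAt
      set a := derivWithin f {z | 0 ≤ z.im} y
      have hyc : conj y = y := Complex.conj_eq_iff_im.2 him
      have hfy : ‖f y‖ = 1 := hb y (hρf y hy).2 him
      have hfy0 : f y ≠ 0 := by
        intro h
        simp [h] at hfy
      have h2 : HasDerivWithinAt (fun z => conj (f (conj z))) (conj a)
          {z | conj z ∈ {z : ℂ | 0 ≤ z.im}} y :=
        HasDerivWithinAt.conj_comp_conj (by rwa [hyc])
      have h3 := h2.inv (by simpa [hyc] using hfy0)
      have hff : conj (f y) * f y = 1 := by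
        rw [mul_comm, Complex.mul_conj, Complex.normSq_eq_norm_sq, hfy]; simp
      -- This is the derivative of `|f|² = 1` along the real axis. It makes the derivative of the
      -- reflected branch agree with that of `f` at `y`.
      have hrel : conj (f y) * a + f y * conj a = 0 := by
        have h4 : HasDerivAt (fun t : ℝ => y + (t : ℂ)) 1 0 :=
          (Complex.ofRealCLM.hasDerivAt (x := 0)).const_add y
        have h5 : HasDerivAt (fun t : ℝ => f (y + (t : ℂ))) a 0 := by
          have := HasDerivWithinAt.scomp_hasDerivAt_of_eq (y := y) (0 : ℝ) h1 h4
            (fun t => by simp [him]) (by simp)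
          rw [one_smul] at this
          exact this
        have h6 : HasDerivAt (fun t : ℝ => f (y + (t : ℂ)) * conj (f (y + (t : ℂ))))
            (a * conj (f y) + f y * conj a) 0 := by
          have := h5.mul h5.star
          simp only [Complex.ofReal_zero, add_zero] at this
          exact this
        have h7 : (fun t : ℝ => f (y + (t : ℂ)) * conj (f (y + (t : ℂ)))) =ᶠ[𝓝 0] fun _ => 1 := by
          have hc : Continuous fun t : ℝ => y + (t : ℂ) := by fun_prop
          have : ∀ᶠ t : ℝ in 𝓝 0, y + (t : ℂ) ∈ Metric.ball x ρ :=
            hc.continuousAt.preimage_mem_nhds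
              (Metric.isOpen_ball.mem_nhds (by simpa using hy))
          filter_upwards [this] with t ht
          have := hb _ (hρf _ ht).2 (by simp [him])
          rw [Complex.mul_conj, Complex.normSq_eq_norm_sq, this]; simp
        have h8 := h6.unique ((hasDerivAt_const (0 : ℝ) (1 : ℂ)).congr_of_eventuallyEq h7)
        linear_combination h8
      have hval : -conj a / (conj (f (conj y))) ^ 2 = a := by
        rw [hyc, div_eq_iff (pow_ne_zero 2 (by simpa using hfy0))]
        linear_combination conj a * hff - conj (f y) * hrel
      have h9 : HasDerivWithinAt G a {z | 0 ≤ z.im} y :=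
        h1.congr (fun z hz => if_pos hz) (if_pos him.ge)
      have h10 : HasDerivWithinAt G a ({z | conj z ∈ {z : ℂ | 0 ≤ z.im}} ∩ Metric.ball x ρ) y := by
        rw [← hval]
        refine (h3.mono inter_subset_left).congr ?_ ?_
        · intro z hz
          have hz1 : z.im ≤ 0 := by simpa using hz.1
          rcases hz1.lt_or_eq with h | h
          · exact if_neg (not_le.2 h)
          · simp only [hG, h, le_refl, if_true]
            change f z = (conj (f (conj z)))⁻¹
            rw [Complex.conj_eq_iff_im.2 h]
            exact (hunit _ (hb z (hρf z hz.2).2 h)).symm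
        · simp only [hG, him, le_refl, if_true]
          change f y = (conj (f (conj y)))⁻¹
          rw [hyc]
          exact (hunit _ hfy).symm
      -- The derivatives from the two sides coincide and the two half balls cover a neighborhood of
      -- `y`, so `G` is complex differentiable there. Differentiability on the whole ball then gives
      -- analyticity.
      have h11 := h9.union h10
      refine (h11.hasDerivAt ?_).differentiableAt
      filter_upwards [Metric.isOpen_ball.mem_nhds hy] with z hz
      rcases le_total 0 z.im with h | h
      · exact Or.inl h
      · exact Or.inr ⟨by simpa using h, hz⟩
    · have hH : {z : ℂ | 0 < z.im} ∈ 𝓝 y :=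
        (isOpen_lt continuous_const Complex.continuous_im).mem_nhds him
      have h1 : DifferentiableAt ℂ f y := (hf y (hρf y hy).2 him.le).differentiableAt
        (mem_of_superset hH fun z (hz : 0 < z.im) => hz.le)
      refine h1.congr_of_eventuallyEq ?_
      filter_upwards [hH] with z hz
      exact if_pos (le_of_lt hz)
  refine ⟨G, hdiff.analyticAt (Metric.ball_mem_nhds x hρ), ?_, ?_⟩
  · exact Eventually.of_forall fun y hy => (if_pos hy).symm
  · filter_upwards [Metric.ball_mem_nhds x hρ] with y hy him
    simp only [hG, not_le.2 him, if_false]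
    rw [norm_inv, RCLike.norm_conj]
    refine (one_le_inv₀ ?_).2 (hle _ (hρf _ (hconj y hy)).2 (by simpa using him.le))
    exact norm_pos_iff.2 ((hρf _ (hconj y hy)).1 (by simpa using him.le))

/-! ### Automorphisms of the unit disk -/

open ComplexConjugate in
lemma one_sub_conj_mul_ne_zero {a z : ℂ} (ha : ‖a‖ < 1) (hz : ‖z‖ ≤ 1) : 1 - conj a * z ≠ 0 := by
  intro h
  have h1 : conj a * z = 1 := (sub_eq_zero.1 h).symm
  have : ‖conj a * z‖ < 1 := by
    rw [norm_mul, RCLike.norm_conj]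
    nlinarith [norm_nonneg a, norm_nonneg z]
  rw [h1] at this
  simp at this

-- Rests on `|1 - conj a * z|² - |z - a|² = (1 - |a|²)(1 - |z|²)`.
open ComplexConjugate in
lemma norm_mobius_lt_one {a z : ℂ} (ha : ‖a‖ < 1) (hz : ‖z‖ < 1) :
    ‖(z - a) / (1 - conj a * z)‖ < 1 := by
  have h0 := one_sub_conj_mul_ne_zero ha hz.le
  rw [norm_div, div_lt_one (norm_pos_iff.2 h0)]
  refine lt_of_pow_lt_pow_left₀ 2 (norm_nonneg _) ?_
  have h1 : ‖a‖ ^ 2 < 1 := by nlinarith [norm_nonneg a]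
  have h2 : ‖z‖ ^ 2 < 1 := by nlinarith [norm_nonneg z]
  rw [← Complex.normSq_eq_norm_sq, Complex.normSq_apply] at h1 h2 ⊢
  rw [← Complex.normSq_eq_norm_sq, Complex.normSq_apply]
  simp
  nlinarith

open ComplexConjugate in
lemma mobius_neg_comp_mobius {a z : ℂ} (ha : ‖a‖ < 1) (hz : ‖z‖ < 1) :
    ((z - a) / (1 - conj a * z) + a) / (1 + conj a * ((z - a) / (1 - conj a * z))) = z := by
  have h0 := one_sub_conj_mul_ne_zero ha hz.le
  have h1 := one_sub_conj_mul_ne_zero ha ha.le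
  have h2 : 1 + conj a * ((z - a) / (1 - conj a * z))
      = (1 - conj a * a) / (1 - conj a * z) := by
    field_simp; ring
  rw [h2, div_eq_iff (div_ne_zero h1 h0), ← mul_left_inj' h0, add_mul, div_mul_cancel₀ _ h0,
    mul_assoc, div_mul_cancel₀ _ h0]
  ring

open ComplexConjugate in
/-- A holomorphic automorphism of the open unit disk is a Möbius transformation. -/
lemma exists_mobius_of_inverse_selfmaps {F G : ℂ → ℂ}
    (hF : DifferentiableOn ℂ F (Metric.ball 0 1)) (hG : DifferentiableOn ℂ G (Metric.ball 0 1))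
    (hFm : MapsTo F (Metric.ball 0 1) (Metric.ball 0 1))
    (hGm : MapsTo G (Metric.ball 0 1) (Metric.ball 0 1))
    (hGF : ∀ z ∈ Metric.ball (0 : ℂ) 1, G (F z) = z)
    (hFG : ∀ z ∈ Metric.ball (0 : ℂ) 1, F (G z) = z) :
    ∃ c a : ℂ, ‖c‖ = 1 ∧ ‖a‖ < 1 ∧
      ∀ z ∈ Metric.ball (0 : ℂ) 1, F z = c * (z - a) / (1 - conj a * z) := by
  -- This is the zero of `F`. Precomposing with the Möbius map `T`, which sends `0` to `a`, gives a
  -- self-map of the disk fixing `0`, to which the Schwarz lemma applies; likewise for the inverse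
  -- `T' ∘ G`.
  set a := G 0 with ha_def
  have h00 : (0 : ℂ) ∈ Metric.ball (0 : ℂ) 1 := by simp
  have ha : ‖a‖ < 1 := by simpa using hGm h00
  set T : ℂ → ℂ := fun z => (z + a) / (1 + conj a * z) with hT
  set T' : ℂ → ℂ := fun z => (z - a) / (1 - conj a * z) with hT'
  have hna : ‖-a‖ < 1 := by simpa using ha
  have hT_eq : ∀ z, T z = (z - (-a)) / (1 - conj (-a) * z) := by
    intro z; simp [hT]
  have hTm : MapsTo T (Metric.ball 0 1) (Metric.ball 0 1) := by
    intro z hz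
    rw [mem_ball_zero_iff] at hz ⊢
    rw [hT_eq]
    exact norm_mobius_lt_one hna hz
  have hTm' : MapsTo T' (Metric.ball 0 1) (Metric.ball 0 1) := by
    intro z hz
    rw [mem_ball_zero_iff] at hz ⊢
    exact norm_mobius_lt_one ha hz
  have hTd : DifferentiableOn ℂ T (Metric.ball 0 1) := by
    intro z hz
    rw [mem_ball_zero_iff] at hz
    refine DifferentiableAt.differentiableWithinAt ?_
    refine DifferentiableAt.div (by fun_prop) (by fun_prop) ?_
    simpa using one_sub_conj_mul_ne_zero hna hz.le
  have hTd' : DifferentiableOn ℂ T' (Metric.ball 0 1) := by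
    intro z hz
    rw [mem_ball_zero_iff] at hz
    refine DifferentiableAt.differentiableWithinAt ?_
    exact DifferentiableAt.div (by fun_prop) (by fun_prop) (one_sub_conj_mul_ne_zero ha hz.le)
  have hTT' : ∀ z ∈ Metric.ball (0 : ℂ) 1, T (T' z) = z := fun z hz =>
    mobius_neg_comp_mobius ha (by simpa using hz)
  have hT'T : ∀ z ∈ Metric.ball (0 : ℂ) 1, T' (T z) = z := fun z hz => by
    have := mobius_neg_comp_mobius hna (z := z) (by simpa using hz)
    simpa [hT, hT', sub_eq_add_neg] using this
  have hT0 : T 0 = a := by simp [hT]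
  have hF1 : ∀ z ∈ Metric.ball (0 : ℂ) 1, ‖F (T z)‖ ≤ ‖z‖ := by
    intro z hz
    refine Complex.norm_le_norm_of_mapsTo_ball (R := 1) (f := F ∘ T) (hF.comp hTd hTm)
      ((hFm.comp hTm).mono_right Metric.ball_subset_closedBall) ?_ (by simpa using hz)
    simp [hT0, ha_def, hFG 0 h00]
  have hG1 : ∀ z ∈ Metric.ball (0 : ℂ) 1, ‖T' (G z)‖ ≤ ‖z‖ := by
    intro z hz
    refine Complex.norm_le_norm_of_mapsTo_ball (R := 1) (f := T' ∘ G) (hTd'.comp hG hGm)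
      ((hTm'.comp hGm).mono_right Metric.ball_subset_closedBall) ?_ (by simpa using hz)
    simp [hT', ← ha_def]
  -- The Schwarz inequalities for `F ∘ T` and for its inverse give equality at one nonzero point,
  -- here `1 / 2`. The equality case of the Schwarz lemma makes `F ∘ T` linear.
  have hn : ‖F (T (1 / 2))‖ = ‖(1 / 2 : ℂ)‖ := by
    have hh : (1 / 2 : ℂ) ∈ Metric.ball (0 : ℂ) 1 := by simp; norm_num
    refine le_antisymm (hF1 _ hh) ?_
    have := hG1 (F (T (1 / 2))) (hFm (hTm hh))
    rwa [hGF _ (hTm hh), hT'T _ hh] at this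
  have hFT0 : (F ∘ T) 0 = 0 := by simp [hT0, ha_def, hFG 0 h00]
  obtain ⟨C, hC, hCe⟩ := Complex.affine_of_mapsTo_ball_of_exists_norm_dslope_eq_div'
    (f := F ∘ T) (c := 0) (R₁ := 1) (R₂ := 1) (hF.comp hTd hTm)
    (by rw [hFT0]; exact (hFm.comp hTm).mono_right Metric.ball_subset_closedBall)
    ⟨1 / 2, by simp; norm_num, by
      rw [dslope_of_ne _ (by norm_num), slope_def_field, hFT0, norm_div, sub_zero, sub_zero,
        Function.comp_apply, hn]
      simp⟩
  refine ⟨C, a, by simpa using hC, ha, fun z hz => ?_⟩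
  have := hCe (hTm' hz)
  simp only [Function.comp_apply, hTT' z hz] at this
  rw [this, ← Function.comp_apply (f := F), hFT0]
  simp [hT']
  ring

/-! ### The strong maximum principle for subharmonic functions -/

/-- If `c` were positive, the second derivative test would make `0` a local minimum as well; `s`
would be locally constant and `c` would vanish. -/
lemma deriv_nonpos_of_isLocalMax {s s' : ℝ → ℝ} {c : ℝ}
    (hs : ∀ᶠ t in 𝓝 0, HasDerivAt s (s' t) t) (hs' : HasDerivAt s' c 0) (hmax : IsLocalMax s 0) :
    c ≤ 0 := by
  by_contra! hc
  have h1 : deriv s =ᶠ[𝓝 0] s' := by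
    filter_upwards [hs] with t ht
    exact ht.deriv
  have h2 : deriv (deriv s) 0 = c := by rw [h1.deriv_eq, hs'.deriv]
  have hmin : IsLocalMin s 0 := isLocalMin_of_deriv_deriv_pos (by rwa [h2])
    hmax.deriv_eq_zero hs.self_of_nhds.continuousAt
  have h3 : s =ᶠ[𝓝 0] fun _ => s 0 := by
    filter_upwards [hmax, hmin] with t h4 h5
    exact le_antisymm h4 h5
  have h4 : deriv s =ᶠ[𝓝 0] fun _ => 0 := by
    filter_upwards [h3.deriv] with t ht
    rw [ht, deriv_const]
  rw [h4.deriv_eq, deriv_const] at h2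
  exact hc.ne h2

/-- The Laplacian of a function on `ℂ`. -/
noncomputable def planeLaplacian (g : ℂ → ℝ) (x : ℂ) : ℝ :=
  fderiv ℝ (fderiv ℝ g) x 1 1 + fderiv ℝ (fderiv ℝ g) x Complex.I Complex.I

lemma hasDerivAt_line (x v : ℂ) (t : ℝ) : HasDerivAt (fun t : ℝ => x + t * v) v t := by
  have := ((Complex.ofRealCLM.hasDerivAt (x := t)).mul_const v).const_add x
  simpa using this

lemma ContDiffAt.eventually_hasDerivAt_line {g : ℂ → ℝ} {x : ℂ} (hg : ContDiffAt ℝ 2 g x) (v : ℂ) :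
    ∀ᶠ t : ℝ in 𝓝 0, HasDerivAt (fun t : ℝ => g (x + t * v)) (fderiv ℝ g (x + t * v) v) t := by
  have hc : Tendsto (fun t : ℝ => x + t * v) (𝓝 0) (𝓝 x) := by
    have : Continuous fun t : ℝ => x + t * v := by fun_prop
    simpa using this.tendsto 0
  filter_upwards [hc.eventually (hg.eventually (by simp))] with t ht
  exact (ht.differentiableAt (by simp)).hasFDerivAt.comp_hasDerivAt t (hasDerivAt_line x v t)

lemma ContDiffAt.hasDerivAt_fderiv_line {g : ℂ → ℝ} {x : ℂ} (hg : ContDiffAt ℝ 2 g x) (v : ℂ) :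
    HasDerivAt (fun t : ℝ => fderiv ℝ g (x + t * v) v) (fderiv ℝ (fderiv ℝ g) x v v) 0 := by
  have h1 : HasFDerivAt (fderiv ℝ g) (fderiv ℝ (fderiv ℝ g) x) x :=
    ((hg.fderiv_right (m := 1) (by norm_num)).differentiableAt (by simp)).hasFDerivAt
  have h2 : HasDerivAt (fun t : ℝ => fderiv ℝ g (x + t * v)) (fderiv ℝ (fderiv ℝ g) x v) 0 :=
    h1.comp_hasDerivAt_of_eq (0 : ℝ) (hasDerivAt_line x v 0) (by simp)
  exact (ContinuousLinearMap.apply ℝ ℝ v).hasFDerivAt.comp_hasDerivAt 0 h2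

lemma hasDerivAt_inv_quadratic {a b : ℝ} {t : ℝ} (h : (a + t) ^ 2 + b ^ 2 ≠ 0) :
    HasDerivAt (fun t => ((a + t) ^ 2 + b ^ 2)⁻¹)
      (-(2 * (a + t)) / ((a + t) ^ 2 + b ^ 2) ^ 2) t := by
  have h1 : HasDerivAt (fun t => (a + t) ^ 2 + b ^ 2) (2 * (a + t)) t := by
    have := (((hasDerivAt_id t).const_add a).pow 2).add_const (b ^ 2)
    simpa using this
  exact h1.inv h

/-- Adding the same expression with `a` and `b` exchanged gives `4 / (a² + b²)²`, the positive
Laplacian of the barrier. -/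
lemma hasDerivAt_deriv_inv_quadratic {a b : ℝ} (h : a ^ 2 + b ^ 2 ≠ 0) :
    HasDerivAt (fun t => -(2 * (a + t)) / ((a + t) ^ 2 + b ^ 2) ^ 2)
      ((6 * a ^ 2 - 2 * b ^ 2) / (a ^ 2 + b ^ 2) ^ 3) 0 := by
  have h1 : HasDerivAt (fun t => (a + t) ^ 2 + b ^ 2) (2 * a) 0 := by
    have := (((hasDerivAt_id (0 : ℝ)).const_add a).pow 2).add_const (b ^ 2)
    simpa using this
  have h2 : HasDerivAt (fun t => -(2 * (a + t))) (-(2 * 1)) 0 :=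
    (((hasDerivAt_id (0 : ℝ)).const_add a).const_mul 2).neg
  have h3 := h2.div (h1.pow 2) (by simpa using h)
  refine h3.congr_deriv ?_
  simp only [add_zero, Pi.pow_apply]
  field_simp
  ring

/-- The barrier function in the proof of the strong maximum principle. -/
noncomputable def barrier (p x : ℂ) : ℝ := (Complex.normSq (x - p))⁻¹

/-- A function with nonnegative Laplacian plus a multiple of the barrier has no local maximum. -/
lemma not_isLocalMax_add_barrier {g : ℂ → ℝ} {x p : ℂ} (hg : ContDiffAt ℝ 2 g x)
    (hΔ : 0 ≤ planeLaplacian g x) (hxp : x ≠ p) {ε : ℝ} (hε : 0 < ε) :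
    ¬ IsLocalMax (fun y => g y + ε * barrier p y) x := by
  intro hmax
  set a := (x - p).re with ha
  set b := (x - p).im with hb
  have hN : 0 < a ^ 2 + b ^ 2 := by
    have := Complex.normSq_pos.2 (sub_ne_zero.2 hxp)
    rw [Complex.normSq_apply] at this
    nlinarith
  have hline : ∀ v : ℂ, IsLocalMax (fun t : ℝ => g (x + t * v) + ε * barrier p (x + t * v)) 0 := by
    intro v
    have hc : Tendsto (fun t : ℝ => x + t * v) (𝓝 0) (𝓝 x) := by
      have : Continuous fun t : ℝ => x + t * v := by fun_prop
      simpa using this.tendsto 0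
    have := hc.eventually hmax
    filter_upwards [this] with t ht
    simpa using ht
  have hne : ∀ᶠ t : ℝ in 𝓝 0, (a + t) ^ 2 + b ^ 2 ≠ 0 := by
    have : ContinuousAt (fun t : ℝ => (a + t) ^ 2 + b ^ 2) 0 := by fun_prop
    exact this.eventually_ne (by simpa using hN.ne')
  have hne' : ∀ᶠ t : ℝ in 𝓝 0, (b + t) ^ 2 + a ^ 2 ≠ 0 := by
    have : ContinuousAt (fun t : ℝ => (b + t) ^ 2 + a ^ 2) 0 := by fun_prop
    exact this.eventually_ne (by simpa [add_comm] using hN.ne')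
  have hb1 : ∀ t : ℝ, barrier p (x + t * 1) = ((a + t) ^ 2 + b ^ 2)⁻¹ := by
    intro t
    rw [barrier, Complex.normSq_apply]
    congr 1
    simp [ha, hb]
    ring
  have hbI : ∀ t : ℝ, barrier p (x + t * Complex.I) = ((b + t) ^ 2 + a ^ 2)⁻¹ := by
    intro t
    rw [barrier, Complex.normSq_apply]
    congr 1
    simp [ha, hb]
    ring
  have k1 := deriv_nonpos_of_isLocalMax (s := fun t : ℝ => g (x + t * 1) + ε * barrier p (x + t * 1))
    (by
      filter_upwards [hg.eventually_hasDerivAt_line 1, hne] with t h1 h2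
      simp only [hb1]
      exact h1.add ((hasDerivAt_inv_quadratic h2).const_mul ε))
    ((hg.hasDerivAt_fderiv_line 1).add ((hasDerivAt_deriv_inv_quadratic hN.ne').const_mul ε))
    (hline 1)
  have k2 := deriv_nonpos_of_isLocalMax
    (s := fun t : ℝ => g (x + t * Complex.I) + ε * barrier p (x + t * Complex.I))
    (by
      filter_upwards [hg.eventually_hasDerivAt_line Complex.I, hne'] with t h1 h2
      simp only [hbI]
      exact h1.add ((hasDerivAt_inv_quadratic h2).const_mul ε))
    ((hg.hasDerivAt_fderiv_line Complex.I).add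
      ((hasDerivAt_deriv_inv_quadratic (by rw [add_comm]; exact hN.ne')).const_mul ε))
    (hline Complex.I)
  have h3 : (6 * a ^ 2 - 2 * b ^ 2) / (a ^ 2 + b ^ 2) ^ 3
      + (6 * b ^ 2 - 2 * a ^ 2) / (b ^ 2 + a ^ 2) ^ 3 = 4 / (a ^ 2 + b ^ 2) ^ 2 := by
    rw [add_comm (b ^ 2)]
    field_simp
    ring
  have h4 : 0 < ε * (4 / (a ^ 2 + b ^ 2) ^ 2) := by positivity
  rw [← h3, mul_add] at h4
  unfold planeLaplacian at hΔ
  linarith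

/-- The strong maximum principle for `C²` functions with nonnegative Laplacian. -/
lemma eventually_eq_of_planeLaplacian_nonneg {g : ℂ → ℝ} {c : ℂ} {R M : ℝ} (hR : 0 < R)
    (hg : ∀ y ∈ Metric.ball c R, ContDiffAt ℝ 2 g y)
    (hΔ : ∀ y ∈ Metric.ball c R, 0 ≤ planeLaplacian g y)
    (hle : ∀ y ∈ Metric.ball c R, g y ≤ M) (hc : g c = M) : ∀ᶠ y in 𝓝 c, g y = M := by
  have hcont : ContinuousOn g (Metric.ball c R) := fun y hy =>
    (hg y hy).continuousAt.continuousWithinAt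
  filter_upwards [Metric.ball_mem_nhds c (show 0 < R / 4 by positivity)] with p hp
  by_contra hpM
  have hsub : Metric.closedBall c (R / 2) ⊆ Metric.ball c R :=
    Metric.closedBall_subset_ball (by linarith)
  have hK : IsCompact (Metric.closedBall c (R / 2) ∩ g ⁻¹' {M}) :=
    (isCompact_closedBall c (R / 2)).of_isClosed_subset
      ((hcont.mono hsub).preimage_isClosed_of_isClosed Metric.isClosed_closedBall
        isClosed_singleton) inter_subset_left
  -- Hopf's argument: `y₀` is a point nearest to `p` with value `M`, so `g < M` on the open disk
  -- about `p` that reaches to `y₀`.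
  obtain ⟨y₀, ⟨hy₀, hy₀M⟩, hmin⟩ := hK.exists_isMinOn
    ⟨c, Metric.mem_closedBall_self (by positivity), hc⟩
    (f := fun y => dist y p) (by fun_prop)
  have hy₀M : g y₀ = M := hy₀M
  set r := dist y₀ p with hr
  have hrc : r ≤ dist c p := hmin ⟨Metric.mem_closedBall_self (by positivity), hc⟩
  rw [Metric.mem_ball] at hp
  have hrR : r < R / 4 := by rw [dist_comm] at hp; linarith
  have hr0 : 0 < r := dist_pos.2 (by rintro rfl; exact hpM hy₀M)
  have hin : ∀ x, dist x p < r → g x < M := by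
    intro x hx
    have hxc : x ∈ Metric.closedBall c (R / 2) := by
      rw [Metric.mem_closedBall]
      linarith [dist_triangle x p c]
    refine (hle x (hsub hxc)).lt_of_ne fun h => ?_
    have : r ≤ dist x p := hmin ⟨hxc, h⟩
    linarith
  have hy₀c : dist y₀ c < R / 2 := by linarith [dist_triangle y₀ p c]
  -- The closed disk of half the radius about the midpoint is internally tangent at `y₀`, so `y₀` is
  -- its only point where `g` can equal `M`.
  set p' := (p + y₀) / 2 with hp'
  have hdp' : dist y₀ p' = r / 2 := by
    rw [hr, dist_eq_norm, dist_eq_norm, show y₀ - p' = (y₀ - p) / 2 by rw [hp']; ring, norm_div]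
    simp
  have hin' : ∀ x, dist x p' ≤ r / 2 → x ≠ y₀ → g x < M := by
    intro x hx hxy
    refine hin x ?_
    rw [dist_eq_norm] at hx ⊢
    have e1 : r ^ 2 = Complex.normSq (y₀ - p) := by
      rw [hr, dist_eq_norm, Complex.normSq_eq_norm_sq]
    have e2 : Complex.normSq (x - p') ≤ r ^ 2 / 4 := by
      rw [Complex.normSq_eq_norm_sq]
      nlinarith [norm_nonneg (x - p')]
    have e3 : 0 < Complex.normSq (x - y₀) := Complex.normSq_pos.2 (sub_ne_zero.2 hxy)
    refine lt_of_pow_lt_pow_left₀ 2 hr0.le ?_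
    rw [← Complex.normSq_eq_norm_sq, e1]
    rw [e1] at e2
    rw [show x - p' = (x - y₀) + (y₀ - p) / 2 by rw [hp']; ring] at e2
    rw [show x - p = (x - y₀) + (y₀ - p) by ring]
    generalize x - y₀ = d at *
    generalize y₀ - p = e at *
    simp only [Complex.normSq_apply, Complex.add_re, Complex.add_im, Complex.div_ofNat_re,
      Complex.div_ofNat_im] at *
    nlinarith
  -- Small enough that the ball about `y₀` stays at distance at least `ρ` from `p'`, the singularity
  -- of the barrier.
  set ρ := r / 4 with hρ
  have hρ0 : 0 < ρ := by positivity
  have hballsub : Metric.closedBall y₀ ρ ⊆ Metric.ball c R := by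
    intro x hx
    rw [Metric.mem_closedBall] at hx
    rw [Metric.mem_ball]
    linarith [dist_triangle x y₀ c]
  have hfar : ∀ x ∈ Metric.closedBall y₀ ρ, ρ ≤ dist x p' := by
    intro x hx
    rw [Metric.mem_closedBall] at hx
    have := dist_triangle y₀ x p'
    rw [dist_comm y₀ x] at this
    linarith
  obtain ⟨η, hη, hηS⟩ : ∃ η > 0, ∀ x ∈ Metric.sphere y₀ ρ ∩ Metric.closedBall p' (r / 2),
      g x ≤ M - η := by
    rcases (Metric.sphere y₀ ρ ∩ Metric.closedBall p' (r / 2)).eq_empty_or_nonempty with he | hne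
    · exact ⟨1, one_pos, by simp [he]⟩
    · obtain ⟨x₁, hx₁, hmax⟩ := ((isCompact_sphere y₀ ρ).inter_right
        Metric.isClosed_closedBall).exists_isMaxOn hne
        (hcont.mono fun x hx => hballsub (Metric.sphere_subset_closedBall hx.1))
      have : g x₁ < M := hin' x₁ hx₁.2 (by
        rintro rfl
        have := hx₁.1
        simp at this
        linarith)
      exact ⟨M - g x₁, by linarith, fun x hx => by have := hmax hx; simp at this; linarith⟩
  have hbar : ∀ x ∈ Metric.closedBall y₀ ρ, barrier p' x ≤ (ρ ^ 2)⁻¹ := by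
    intro x hx
    rw [barrier, Complex.normSq_eq_norm_sq, ← dist_eq_norm]
    exact inv_anti₀ (by positivity) (by have := hfar x hx; gcongr)
  -- With this choice the barrier term is at most `η / 2` on the small ball, less than the drop `η`
  -- of `g` on the part of the sphere inside the tangent disk.
  set ε := η * ρ ^ 2 / 2 with hε
  have hε0 : 0 < ε := by positivity
  have hεη : ε * (ρ ^ 2)⁻¹ = η / 2 := by
    rw [hε]; field_simp
  have hcb : ContinuousOn (fun y => g y + ε * barrier p' y) (Metric.closedBall y₀ ρ) := by
    refine (hcont.mono hballsub).add (continuousOn_const.mul ?_)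
    refine ContinuousOn.inv₀ (by fun_prop) fun x hx => ?_
    have := hfar x hx
    rw [Ne, Complex.normSq_eq_zero, sub_eq_zero]
    rintro rfl
    simp at this
    linarith
  obtain ⟨x₀, hx₀, hx₀max⟩ := (isCompact_closedBall y₀ ρ).exists_isMaxOn
    ⟨y₀, Metric.mem_closedBall_self hρ0.le⟩ hcb
  have hby₀ : barrier p' y₀ = ((r / 2) ^ 2)⁻¹ := by
    rw [barrier, Complex.normSq_eq_norm_sq, ← dist_eq_norm, hdp']
  have hx₀val : M + ε * ((r / 2) ^ 2)⁻¹ ≤ g x₀ + ε * barrier p' x₀ := by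
    have := hx₀max (Metric.mem_closedBall_self hρ0.le : y₀ ∈ Metric.closedBall y₀ ρ)
    simpa [hy₀M, hby₀] using this
  -- A maximum on the sphere is impossible: inside the tangent disk `g` has dropped by `η`, and
  -- outside it the barrier is smaller than at `y₀`. The maximum is thus interior, against
  -- `not_isLocalMax_add_barrier`.
  have hint : x₀ ∈ Metric.ball y₀ ρ := by
    by_contra hnot
    have hsph : x₀ ∈ Metric.sphere y₀ ρ := by
      rw [Metric.mem_sphere]
      exact le_antisymm hx₀ (not_lt.1 hnot)
    have hpos : 0 < ε * ((r / 2) ^ 2)⁻¹ := by positivity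
    rcases le_or_gt (dist x₀ p') (r / 2) with h | h
    · have h1 := hηS x₀ ⟨hsph, h⟩
      have h2 : ε * barrier p' x₀ ≤ η / 2 := by
        rw [← hεη]
        exact mul_le_mul_of_nonneg_left (hbar x₀ hx₀) hε0.le
      linarith
    · have h1 := hle x₀ (hballsub hx₀)
      have h2 : barrier p' x₀ < ((r / 2) ^ 2)⁻¹ := by
        rw [barrier, Complex.normSq_eq_norm_sq, ← dist_eq_norm]
        exact inv_strictAnti₀ (by positivity) (by gcongr)
      nlinarith [mul_lt_mul_of_pos_left h2 hε0]
  refine not_isLocalMax_add_barrier (hg x₀ (hballsub hx₀)) (hΔ x₀ (hballsub hx₀)) (p := p') ?_ hε0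
    (hx₀max.isLocalMax (mem_of_superset (Metric.isOpen_ball.mem_nhds hint)
      Metric.ball_subset_closedBall))
  have := hfar x₀ hx₀
  rintro rfl
  simp at this
  linarith

/-! ### Charts of a Riemann surface with boundary -/

lemma range_halfPlaneR : range halfPlaneR = {z : ℂ | 0 ≤ z.im} := range_halfPlaneEquiv

lemma interior_halfPlane : interior {z : ℂ | 0 ≤ z.im} = {z : ℂ | 0 < z.im} :=
  Complex.interior_setOfPred_le_im 0

/-- A real linear map of `ℂ` that commutes with multiplication by `i` is complex linear. -/
lemma restrictScalars_toSpanSingleton_eq {L : ℂ →L[ℝ] ℂ} (hL : L Complex.I = Complex.I * L 1) :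
    (ContinuousLinearMap.toSpanSingleton ℂ (L 1)).restrictScalars ℝ = L := by
  ext v
  have hv : v = v.re • (1 : ℂ) + v.im • Complex.I := by simp
  calc v * L 1 = v.re • L 1 + v.im • L Complex.I := by
        rw [hL]
        conv_lhs => rw [hv]
        simp only [Complex.real_smul]
        ring
    _ = L v := by rw [← map_smul, ← map_smul, ← map_add, ← hv]

section Surface

variable {S : Type*} [TopologicalSpace S] [ChartedSpace ClosedHalfPlane S]

/-- The real surface underlying a Riemann surface with boundary is smooth. -/
lemma isManifold_halfPlaneR [IsManifold halfPlaneC ∞ S] : IsManifold halfPlaneR ∞ S := by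
  refine isManifold_of_contDiffOn halfPlaneR ∞ S fun e e' he he' => ?_
  have h := (HasGroupoid.compatible (G := contDiffGroupoid ∞ halfPlaneC) he he')
  exact (h.1.restrict_scalars ℝ)

lemma mem_target_extChartAt_im {z : S} {y : ℂ} (hy : y ∈ (extChartAt halfPlaneR z).target) :
    0 ≤ y.im := by
  have := extChartAt_target_subset_range (I := halfPlaneR) z hy
  rwa [range_halfPlaneR] at this

lemma extChartAt_im_nonneg (z : S) : 0 ≤ (extChartAt halfPlaneR z z).im :=
  mem_target_extChartAt_im (mem_extChartAt_target z)

/-- Turns local statements on the surface into statements about full neighborhoods in `ℂ` with the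
side condition `0 ≤ y.im`, so that they combine with analytic extensions across the real axis. -/
lemma eventually_nhds_iff_extChartAt (z : S) {P : S → Prop} :
    (∀ᶠ p in 𝓝 z, P p) ↔ ∀ᶠ y in 𝓝 (extChartAt halfPlaneR z z),
      0 ≤ y.im → P ((extChartAt halfPlaneR z).symm y) := by
  rw [← map_extChartAt_symm_nhdsWithin_range (I := halfPlaneR) z, eventually_map,
    range_halfPlaneR, eventually_nhdsWithin_iff]
  rfl

lemma eventually_mem_target_extChartAt (z : S) : ∀ᶠ y in 𝓝 (extChartAt halfPlaneR z z),
    0 ≤ y.im → y ∈ (extChartAt halfPlaneR z).target := by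
  have := extChartAt_target_mem_nhdsWithin (I := halfPlaneR) z
  rw [range_halfPlaneR] at this
  exact eventually_nhdsWithin_iff.1 this

lemma mem_interior_of_notMem_boundary {z : S} (h : z ∉ halfPlaneR.boundary S) :
    z ∈ halfPlaneR.interior S := by
  rw [← ModelWithCorners.compl_boundary]
  exact h

section Smooth

variable [IsManifold halfPlaneC ∞ S]

/-- Interior points are defined by their own preferred chart. That the chart at `z` detects them too
depends on the smoothness of the transition maps. -/
lemma mem_interior_iff_extChartAt {z : S} {y : ℂ} (hy : y ∈ (extChartAt halfPlaneR z).target) :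
    (extChartAt halfPlaneR z).symm y ∈ halfPlaneR.interior S ↔ 0 < y.im := by
  have := isManifold_halfPlaneR (S := S)
  have hs : (extChartAt halfPlaneR z).symm y ∈ (chartAt ClosedHalfPlane z).source := by
    have := (extChartAt halfPlaneR z).map_target hy
    rwa [extChartAt_source] at this
  have h1 := halfPlaneR.isInteriorPoint_iff_of_mem_atlas (n := ∞) (by simp)
    (chart_mem_atlas ClosedHalfPlane z) hs
  have h2 : ((chartAt ClosedHalfPlane z).extend halfPlaneR) ((extChartAt halfPlaneR z).symm y) = y :=
    (extChartAt halfPlaneR z).right_inv hy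
  rw [h2] at h1
  change halfPlaneR.IsInteriorPoint _ ↔ _
  rw [h1]
  constructor
  · intro h
    have h3 := interior_mono (extChartAt_target_subset_range (I := halfPlaneR) z) h
    rwa [range_halfPlaneR, interior_halfPlane] at h3
  · intro h
    have h4 := (chartAt ClosedHalfPlane z).mem_interior_extend_target (I := halfPlaneR)
      ((chartAt ClosedHalfPlane z).map_source hs) (by
        have : halfPlaneR ((chartAt ClosedHalfPlane z) ((extChartAt halfPlaneR z).symm y)) = y := h2
        rw [this, range_halfPlaneR, interior_halfPlane]
        exact h)
    have : halfPlaneR ((chartAt ClosedHalfPlane z) ((extChartAt halfPlaneR z).symm y)) = y := h2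
    rwa [this] at h4

lemma mem_boundary_iff_extChartAt {z : S} {y : ℂ} (hy : y ∈ (extChartAt halfPlaneR z).target) :
    (extChartAt halfPlaneR z).symm y ∈ halfPlaneR.boundary S ↔ y.im = 0 := by
  rw [← ModelWithCorners.compl_interior, mem_compl_iff, mem_interior_iff_extChartAt hy, not_lt]
  exact ⟨fun h => le_antisymm h (mem_target_extChartAt_im hy), fun h => h.le⟩

lemma mem_interior_iff_im_pos (z : S) :
    z ∈ halfPlaneR.interior S ↔ 0 < (extChartAt halfPlaneR z z).im := by
  have := mem_interior_iff_extChartAt (mem_extChartAt_target (I := halfPlaneR) z)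
  rwa [extChartAt_to_inv] at this

lemma mem_boundary_iff_im_eq_zero (z : S) :
    z ∈ halfPlaneR.boundary S ↔ (extChartAt halfPlaneR z z).im = 0 := by
  have := mem_boundary_iff_extChartAt (mem_extChartAt_target (I := halfPlaneR) z)
  rwa [extChartAt_to_inv] at this

end Smooth

/-- A continuous function that is complex differentiable, up to the boundary, in the preferred
charts. -/
structure IsChartHolomorphic (w : S → ℂ) : Prop where
  continuous : Continuous w
  differentiable : ∀ z : S, ∀ y ∈ (extChartAt halfPlaneR z).target,
    DifferentiableWithinAt ℂ (w ∘ (extChartAt halfPlaneR z).symm) {z | 0 ≤ z.im} y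

lemma IsChartHolomorphic.comp {w : S → ℂ} (hw : IsChartHolomorphic w) {F : ℂ → ℂ}
    (hF : Differentiable ℂ F) : IsChartHolomorphic (fun z => F (w z)) where
  continuous := hF.continuous.comp hw.continuous
  differentiable z y hy := hF.differentiableAt.comp_differentiableWithinAt y (hw.differentiable z y hy)

/-- At each `p` the equation makes the real derivative in the preferred chart at `p` complex linear.
Since the transition maps are holomorphic, differentiability then passes from the chart at `p` to
every chart around `p`. -/
lemma IsJHolomorphic.isChartHolomorphic [IsManifold halfPlaneC ∞ S] {w : S → ℂ}
    (hw : IsJHolomorphic 𝓘(ℝ, ℂ) (standardJ ℂ) w) : IsChartHolomorphic w := by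
  have := isManifold_halfPlaneR (S := S)
  refine ⟨hw.contMDiff_one.continuous, ?_⟩
  have hmd : ∀ p : S, MDifferentiableAt halfPlaneC 𝓘(ℂ, ℂ) w p := by
    intro p
    have h1 : MDifferentiableAt halfPlaneR 𝓘(ℝ, ℂ) w p := hw.contMDiff_one.mdifferentiableAt one_ne_zero
    have h2 := h1.hasMFDerivAt.2
    let L : ℂ →L[ℝ] ℂ := mfderiv halfPlaneR 𝓘(ℝ, ℂ) w p
    have hL : L Complex.I = Complex.I * L 1 := by
      have h : L (Complex.I • (1 : ℂ)) = Complex.I • L 1 := hw.comm p (1 : ℂ)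
      simpa using h
    have h3 : HasFDerivWithinAt (writtenInExtChartAt halfPlaneR 𝓘(ℝ, ℂ) p w)
        (ContinuousLinearMap.toSpanSingleton ℂ (L 1)) (range halfPlaneR)
        (extChartAt halfPlaneR p p) :=
      HasFDerivWithinAt.of_restrictScalars ℝ h2 (restrictScalars_toSpanSingleton_eq hL)
    exact (mdifferentiableAt_iff _ _).2 ⟨h1.continuousAt, h3.differentiableWithinAt⟩
  intro z y hy
  have h1 : MDifferentiableWithinAt 𝓘(ℂ, ℂ) halfPlaneC (extChartAt halfPlaneC z).symm
      (range halfPlaneC) y := mdifferentiableWithinAt_extChartAt_symm hy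
  have h2 := (hmd ((extChartAt halfPlaneC z).symm y)).comp_mdifferentiableWithinAt y h1
  have h3 := h2.differentiableWithinAt
  exact range_halfPlaneR ▸ h3

end Surface

lemma forall_eq_of_eventually_eq {S : Type*} [TopologicalSpace S] [PreconnectedSpace S]
    {X : Type*} {u : S → X}
    (h : ∀ z, ∀ᶠ p in 𝓝 z, u p = u z) (z z' : S) : u z = u z' :=
  ((IsLocallyConstant.iff_eventually_eq u).2 h).apply_eq_of_preconnectedSpace z z'

section Surface

variable {S : Type*} [TopologicalSpace S] [ChartedSpace ClosedHalfPlane S]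

/-! ### Maximum principle and constancy criteria -/

lemma mem_closure_ball_inter_upperHalf {x y : ℂ} {r : ℝ} (hy : y ∈ Metric.ball x r)
    (him : 0 ≤ y.im) : y ∈ closure (Metric.ball x r ∩ {z : ℂ | 0 < z.im}) := by
  have hc : Tendsto (fun t : ℝ => y + t * Complex.I) (𝓝[>] 0) (𝓝 y) := by
    have : Continuous fun t : ℝ => y + t * Complex.I := by fun_prop
    have h := this.tendsto 0
    simp only [Complex.ofReal_zero, zero_mul, add_zero] at h
    exact h.mono_left nhdsWithin_le_nhds
  refine mem_closure_of_tendsto hc ?_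
  filter_upwards [hc.eventually (Metric.isOpen_ball.mem_nhds hy), self_mem_nhdsWithin] with t h1 h2
  refine ⟨h1, ?_⟩
  have h2 : 0 < t := h2
  simp
  linarith

/-- A continuous function on a half ball that is constant on its interior is constant. -/
lemma eq_of_eqOn_ball_inter_upperHalf {X : Type*} [TopologicalSpace X] [T2Space X] {f : ℂ → X}
    {x : ℂ} {r : ℝ} {c : X}
    (hf : ∀ y ∈ Metric.ball x r, 0 ≤ y.im → ContinuousWithinAt f {z | 0 ≤ z.im} y)
    (hc : ∀ y ∈ Metric.ball x r, 0 < y.im → f y = c) {y : ℂ} (hy : y ∈ Metric.ball x r)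
    (him : 0 ≤ y.im) : f y = c := by
  have h1 : ContinuousWithinAt f (Metric.ball x r ∩ {z : ℂ | 0 < z.im}) y :=
    (hf y hy him).mono fun z hz => (show 0 < z.im from hz.2).le
  have : (𝓝[Metric.ball x r ∩ {z : ℂ | 0 < z.im}] y).NeBot :=
    mem_closure_iff_nhdsWithin_neBot.1 (mem_closure_ball_inter_upperHalf hy him)
  refine tendsto_nhds_unique h1 ?_
  refine Tendsto.congr' ?_ tendsto_const_nhds
  filter_upwards [self_mem_nhdsWithin] with z hz
  exact (hc z hz.1 hz.2).symm

lemma continuousWithinAt_comp_extChartAt_symm {X : Type*} [TopologicalSpace X] {w : S → X}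
    (hw : Continuous w) {z : S} {y : ℂ} (hy : y ∈ (extChartAt halfPlaneR z).target) :
    ContinuousWithinAt (w ∘ (extChartAt halfPlaneR z).symm) {z | 0 ≤ z.im} y := by
  have h := continuousOn_extChartAt_symm (I := halfPlaneR) z y hy
  have h2 : ContinuousWithinAt (extChartAt halfPlaneR z).symm (range halfPlaneR) y :=
    h.mono_of_mem_nhdsWithin (extChartAt_target_mem_nhdsWithin_of_mem hy)
  rw [range_halfPlaneR] at h2
  exact hw.continuousAt.comp_continuousWithinAt h2

/-- A small ball around a chart point such that the half ball lies in the chart. -/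
lemma exists_ball_target (z : S) : ∃ r > 0, ∀ y ∈ Metric.ball (extChartAt halfPlaneR z z) r,
    0 ≤ y.im → y ∈ (extChartAt halfPlaneR z).target :=
  Metric.eventually_nhds_iff_ball.1 (eventually_mem_target_extChartAt z)

lemma IsChartHolomorphic.differentiableOn {w : S → ℂ} (hw : IsChartHolomorphic w) {z : S} {r : ℝ}
    (hr : ∀ y ∈ Metric.ball (extChartAt halfPlaneR z z) r,
      0 ≤ y.im → y ∈ (extChartAt halfPlaneR z).target) :
    DifferentiableOn ℂ (w ∘ (extChartAt halfPlaneR z).symm)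
      (Metric.ball (extChartAt halfPlaneR z z) r ∩ {y | 0 < y.im}) := fun y hy =>
  (hw.differentiable z y (hr y hy.1 (le_of_lt hy.2))).mono fun v h => (show 0 < v.im from h.2).le

lemma isOpen_ball_inter_upperHalf (x : ℂ) (r : ℝ) :
    IsOpen (Metric.ball x r ∩ {y : ℂ | 0 < y.im}) :=
  Metric.isOpen_ball.inter (isOpen_lt continuous_const Complex.continuous_im)

/-- A holomorphic function with constant imaginary part is constant. -/
lemma IsChartHolomorphic.eq_of_im_eq [PreconnectedSpace S] {w : S → ℂ}
    (hw : IsChartHolomorphic w) {c : ℝ} (hc : ∀ z, (w z).im = c) (z z' : S) : w z = w z' := by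
  refine forall_eq_of_eventually_eq (fun z => ?_) z z'
  obtain ⟨r, hr, hrt⟩ := exists_ball_target z
  set x := extChartAt halfPlaneR z z with hx
  set f := w ∘ (extChartAt halfPlaneR z).symm with hf
  have hU := isOpen_ball_inter_upperHalf x r
  have han : AnalyticOnNhd ℂ f (Metric.ball x r ∩ {y : ℂ | 0 < y.im}) :=
    (hw.differentiableOn hrt).analyticOnNhd hU
  have hne : (Metric.ball x r ∩ {y : ℂ | 0 < y.im}).Nonempty :=
    closure_nonempty_iff.1 ⟨x, mem_closure_ball_inter_upperHalf (Metric.mem_ball_self hr)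
      (extChartAt_im_nonneg z)⟩
  have hconv : Convex ℝ (Metric.ball x r ∩ {y : ℂ | 0 < y.im}) :=
    (convex_ball x r).inter (convex_halfSpace_im_gt 0)
  obtain ⟨d, hd⟩ := han.eq_const_of_im_eq_const (c₀ := c) (fun y _ => hc _) hU ⟨hne, hconv.isPreconnected⟩
  have hall : ∀ y ∈ Metric.ball x r, 0 ≤ y.im → f y = d := fun y hy him =>
    eq_of_eqOn_ball_inter_upperHalf
      (fun y hy him => continuousWithinAt_comp_extChartAt_symm hw.continuous (hrt y hy him))
      (fun y hy him => hd y ⟨hy, him⟩) hy him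
  have hz : w z = d := by
    have := hall x (Metric.mem_ball_self hr) (extChartAt_im_nonneg z)
    rwa [hf, Function.comp_apply, hx, extChartAt_to_inv] at this
  rw [eventually_nhds_iff_extChartAt]
  filter_upwards [Metric.ball_mem_nhds x hr] with y hy him
  rw [hz]
  exact hall y hy him

/-- The maximum principle: the modulus of a nonconstant holomorphic function is not maximal only
in the interior. -/
lemma IsChartHolomorphic.eq_of_norm_max [PreconnectedSpace S] [IsManifold halfPlaneC ∞ S]
    {w : S → ℂ} (hw : IsChartHolomorphic w) {z₀ : S} (hmax : ∀ z, ‖w z‖ ≤ ‖w z₀‖)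
    (hbd : ∀ z ∈ halfPlaneR.boundary S, ‖w z‖ < ‖w z₀‖) (z : S) : w z = w z₀ := by
  have hclosed : IsClosed {z | w z = w z₀} := isClosed_eq hw.continuous continuous_const
  have hopen : IsOpen {z | w z = w z₀} := by
    rw [isOpen_iff_mem_nhds]
    intro z hz
    have hz : w z = w z₀ := hz
    have hzint : z ∈ halfPlaneR.interior S :=
      mem_interior_of_notMem_boundary fun h => (hbd z h).ne (by rw [hz])
    have him := (mem_interior_iff_im_pos z).1 hzint
    obtain ⟨r, hr, hrt⟩ := exists_ball_target z
    set x := extChartAt halfPlaneR z z with hx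
    set f := w ∘ (extChartAt halfPlaneR z).symm with hf
    have hfx : f x = w z₀ := by
      rw [hf, Function.comp_apply, hx, extChartAt_to_inv, hz]
    have hU := isOpen_ball_inter_upperHalf x r
    have hxU : x ∈ Metric.ball x r ∩ {y : ℂ | 0 < y.im} := ⟨Metric.mem_ball_self hr, him⟩
    have hdiff : ∀ᶠ y in 𝓝 x, DifferentiableAt ℂ f y := by
      filter_upwards [hU.mem_nhds hxU] with y hy
      exact (hw.differentiableOn hrt y hy).differentiableAt (hU.mem_nhds hy)
    have := Complex.eventually_eq_of_isLocalMax_norm hdiff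
      (Eventually.of_forall fun y => by
        simp only [Function.comp_apply, hfx]
        exact hmax _)
    rw [hfx] at this
    change ∀ᶠ p in 𝓝 z, w p = w z₀
    rw [eventually_nhds_iff_extChartAt]
    filter_upwards [this] with y hy _
    exact hy
  have := IsClopen.eq_univ ⟨hclosed, hopen⟩ ⟨z₀, rfl⟩
  exact (this ▸ mem_univ z : z ∈ {z | w z = w z₀})

/-- A holomorphic function on a compact connected surface with real boundary values is constant. -/
lemma IsChartHolomorphic.eq_of_im_boundary_eq_zero [CompactSpace S] [ConnectedSpace S]
    [IsManifold halfPlaneC ∞ S] {w : S → ℂ} (hw : IsChartHolomorphic w)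
    (hb : ∀ z ∈ halfPlaneR.boundary S, (w z).im = 0) (z z' : S) : w z = w z' := by
  -- `exp (-i v)` has modulus `exp (Im v)`. If the maximum of `Im v` is positive it is not attained
  -- on the boundary, and the maximum principle makes `Im v` constant. The claim is used for both
  -- `w` and `-w`.
  have key : ∀ v : S → ℂ, IsChartHolomorphic v → (∀ z ∈ halfPlaneR.boundary S, (v z).im = 0) →
      (∀ z, (v z).im ≤ 0) ∨ ∃ c : ℝ, ∀ z, (v z).im = c := by
    intro v hv hvb
    obtain ⟨z₀, -, hz₀⟩ := isCompact_univ.exists_isMaxOn (univ_nonempty (α := S))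
      (Complex.continuous_im.comp hv.continuous).continuousOn
    have hz₀ : ∀ z, (v z).im ≤ (v z₀).im := fun z => hz₀ (mem_univ z)
    rcases le_or_gt (v z₀).im 0 with h | h
    · exact Or.inl fun z => (hz₀ z).trans h
    · right
      have hn : ∀ z, ‖Complex.exp (-Complex.I * v z)‖ = Real.exp (v z).im := by
        intro z
        rw [Complex.norm_exp]
        simp
      have he : IsChartHolomorphic fun z => Complex.exp (-Complex.I * v z) :=
        hv.comp (F := fun y => Complex.exp (-Complex.I * y)) (by fun_prop)
      refine ⟨(v z₀).im, fun z => ?_⟩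
      have := he.eq_of_norm_max (z₀ := z₀)
        (fun z => by rw [hn, hn]; exact Real.exp_le_exp.2 (hz₀ z))
        (fun z hz => by rw [hn, hn, hvb z hz]; exact Real.exp_lt_exp.2 h) z
      have := congrArg norm this
      simp only [hn] at this
      exact Real.exp_injective this
  rcases key w hw hb with h1 | ⟨c, hc⟩
  · have hneg : IsChartHolomorphic fun z => -w z := hw.comp (F := fun y => -y) (by fun_prop)
    rcases key _ hneg (fun z hz => by simp [hb z hz]) with h2 | ⟨c, hc⟩
    · refine hw.eq_of_im_eq (c := 0) (fun z => le_antisymm (h1 z) ?_) z z'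
      simpa using h2 z
    · exact hw.eq_of_im_eq (c := -c) (fun z => by have := hc z; simp at this; linarith) z z'
  · exact hw.eq_of_im_eq hc z z'

/-! ### Holomorphic functions with unimodular boundary values -/

/-- A nonconstant holomorphic function to the closed unit disk that maps the boundary to the unit
circle. -/
structure IsProperToDisk (g : S → ℂ) : Prop where
  holomorphic : IsChartHolomorphic g
  norm_le : ∀ z, ‖g z‖ ≤ 1
  norm_boundary : ∀ z ∈ halfPlaneR.boundary S, ‖g z‖ = 1
  nonconst : ¬ ∃ c, ∀ z, g z = c

lemma extension_apply_self {g : S → ℂ} {z : S} {G : ℂ → ℂ}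
    (hGg : ∀ᶠ y in 𝓝 (extChartAt halfPlaneR z z), 0 ≤ y.im →
        g ((extChartAt halfPlaneR z).symm y) = G y) :
    G (extChartAt halfPlaneR z z) = g z := by
  rw [← hGg.self_of_nhds (extChartAt_im_nonneg z), extChartAt_to_inv]

lemma IsProperToDisk.neBot_nhdsWithin_ball {g : S → ℂ} (hg : IsProperToDisk g) (z : S) :
    (𝓝[Metric.ball 0 1] (g z)).NeBot := by
  rw [← mem_closure_iff_nhdsWithin_neBot, closure_ball _ one_ne_zero, mem_closedBall_zero_iff]
  exact hg.norm_le z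

variable [IsManifold halfPlaneC ∞ S] {g : S → ℂ}

/-- At interior points the chart expression itself serves, and the last clause is vacuous nearby. At
boundary points the extension is Schwarz reflection in the unit circle, which sends the lower side
outside the open disk. -/
lemma IsProperToDisk.exists_local_extension (hg : IsProperToDisk g) (z : S) :
    ∃ G : ℂ → ℂ, AnalyticAt ℂ G (extChartAt halfPlaneR z z) ∧
      (∀ᶠ y in 𝓝 (extChartAt halfPlaneR z z), 0 ≤ y.im →
        g ((extChartAt halfPlaneR z).symm y) = G y) ∧
      ∀ᶠ y in 𝓝 (extChartAt halfPlaneR z z), y.im < 0 → 1 ≤ ‖G y‖ := by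
  obtain ⟨r, hr, hrt⟩ := exists_ball_target z
  rcases (extChartAt_im_nonneg z).lt_or_eq with him | him
  · refine ⟨g ∘ (extChartAt halfPlaneR z).symm, ?_, Eventually.of_forall fun y _ => rfl, ?_⟩
    · exact (hg.holomorphic.differentiableOn hrt).analyticAt
        ((isOpen_ball_inter_upperHalf _ r).mem_nhds ⟨Metric.mem_ball_self hr, him⟩)
    · filter_upwards [(isOpen_lt continuous_const Complex.continuous_im).mem_nhds him] with y hy hy'
      exact absurd hy' (not_lt.2 (le_of_lt hy))
  · exact exists_analyticAt_reflection (f := g ∘ (extChartAt halfPlaneR z).symm) hr him.symm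
      (fun y hy h => hg.holomorphic.differentiable z y (hrt y hy h))
      (fun y hy h => hg.norm_boundary _ ((mem_boundary_iff_extChartAt (hrt y hy h.ge)).2 h))
      (fun y _ _ => hg.norm_le _)

/-- Unique continuation. -/
lemma IsProperToDisk.not_eventually_eq [PreconnectedSpace S] (hg : IsProperToDisk g) (z : S)
    (c : ℂ) : ¬ ∀ᶠ p in 𝓝 z, g p = c := by
  intro h
  apply hg.nonconst
  refine ⟨c, fun p => ?_⟩
  set T : Set S := {z | ∀ᶠ p in 𝓝 z, g p = c} with hT
  have hopen : IsOpen T := isOpen_setOfPred_eventually_nhds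
  have hclosed : IsClosed T := by
    rw [← closure_subset_iff_isClosed]
    intro q hq
    by_contra hqT
    obtain ⟨G, hG, hGg, -⟩ := hg.exists_local_extension q
    set x := extChartAt halfPlaneR q q
    have hfreq : ∃ᶠ p in 𝓝 q, p ∈ T := mem_closure_iff_frequently.1 hq
    -- The identity theorem is applied to the extension `G`, which is analytic in a full
    -- neighborhood even when `q` is a boundary point.
    have hf2 : ∃ᶠ y in 𝓝[≠] x, G y = c := by
      intro hnot
      rw [eventually_nhdsWithin_iff] at hnot
      apply hfreq
      rw [eventually_nhds_iff_extChartAt]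
      filter_upwards [hnot, hGg] with y h1 h2 him hyT
      by_cases hyx : y = x
      · rw [hyx] at hyT
        rw [extChartAt_to_inv] at hyT
        exact hqT hyT
      · exact h1 hyx ((h2 him).symm.trans hyT.self_of_nhds)
    have hev := (hG.frequently_eq_iff_eventually_eq analyticAt_const).1 hf2
    apply hqT
    change ∀ᶠ p in 𝓝 q, g p = c
    rw [eventually_nhds_iff_extChartAt]
    filter_upwards [hev, hGg] with y h1 h2 him
    rw [h2 him, h1]
  have huniv := IsClopen.eq_univ ⟨hclosed, hopen⟩ ⟨z, h⟩
  exact (huniv ▸ mem_univ p : p ∈ T).self_of_nhds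

lemma IsProperToDisk.extension_not_const [PreconnectedSpace S] (hg : IsProperToDisk g) {z : S}
    {G : ℂ → ℂ} (hGg : ∀ᶠ y in 𝓝 (extChartAt halfPlaneR z z), 0 ≤ y.im →
        g ((extChartAt halfPlaneR z).symm y) = G y) :
    ¬ ∀ᶠ y in 𝓝 (extChartAt halfPlaneR z z), G y = G (extChartAt halfPlaneR z z) := by
  intro h
  apply hg.not_eventually_eq z (G (extChartAt halfPlaneR z z))
  rw [eventually_nhds_iff_extChartAt]
  filter_upwards [h, hGg] with y h1 h2 him
  rw [h2 him, h1]

/-- Neighborhoods of points of the surface are mapped to relative neighborhoods in the disk. -/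
lemma IsProperToDisk.eventually_mem_image [PreconnectedSpace S] (hg : IsProperToDisk g) (z : S)
    {O : Set S} (hO : O ∈ 𝓝 z) : ∀ᶠ w in 𝓝[Metric.ball 0 1] (g z), w ∈ g '' O := by
  obtain ⟨G, hG, hGg, hGn⟩ := hg.exists_local_extension z
  have hO' := (eventually_nhds_iff_extChartAt z (P := (· ∈ O))).1 hO
  have him := hG.image_mem_nhds (hg.extension_not_const hGg) (inter_mem hO' (inter_mem hGg hGn))
  rw [extension_apply_self hGg] at him
  rw [eventually_nhdsWithin_iff]
  filter_upwards [him] with w ⟨y, ⟨h1, h2, h3⟩, hyw⟩ hw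
  -- On the lower side `|G| ≥ 1`, so a preimage of a value in the open disk is a genuine point of
  -- the surface.
  have hy : 0 ≤ y.im := by
    by_contra! hlt
    have := h3 hlt
    rw [hyw] at this
    rw [mem_ball_zero_iff] at hw
    linarith
  exact ⟨_, h1 hy, by rw [h2 hy, hyw]⟩

/-- The range is closed by compactness. A point of it in the open disk is an interior point, since
`g` is open relative to the disk. Connectedness of the open disk finishes, and its closure is the
closed disk. -/
lemma IsProperToDisk.range_eq [CompactSpace S] [ConnectedSpace S] (hg : IsProperToDisk g) :
    range g = Metric.closedBall 0 1 := by
  have hclosed : IsClosed (range g) := (isCompact_range hg.holomorphic.continuous).isClosed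
  refine Subset.antisymm ?_ ?_
  · rintro _ ⟨z, rfl⟩
    simpa using hg.norm_le z
  have hsub : Metric.ball (0 : ℂ) 1 ⊆ range g := by
    refine IsPreconnected.subset_of_closure_inter_subset
      (convex_ball (0 : ℂ) 1).isPreconnected (u := interior (range g)) isOpen_interior ?_ ?_ |>.trans
        interior_subset
    · obtain ⟨z⟩ := (inferInstance : Nonempty S)
      have := hg.neBot_nhdsWithin_ball z
      obtain ⟨w, hw, hwb⟩ := ((hg.eventually_mem_image z univ_mem).and self_mem_nhdsWithin).exists
      obtain ⟨p, -, rfl⟩ := hw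
      refine ⟨g p, hwb, mem_interior_iff_mem_nhds.2 ?_⟩
      have h2 := hg.eventually_mem_image p univ_mem
      rw [Metric.isOpen_ball.nhdsWithin_eq hwb] at h2
      filter_upwards [h2] with v hv
      exact image_subset_range _ _ hv
    · rintro w ⟨hw, hwb⟩
      have : w ∈ range g := closure_minimal interior_subset hclosed hw
      obtain ⟨p, rfl⟩ := this
      refine mem_interior_iff_mem_nhds.2 ?_
      have h2 := hg.eventually_mem_image p univ_mem
      rw [Metric.isOpen_ball.nhdsWithin_eq hwb] at h2
      filter_upwards [h2] with v hv
      exact image_subset_range _ _ hv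
  rw [← closure_ball _ one_ne_zero]
  exact closure_minimal hsub hclosed

end Surface

lemma exists_nhds_injOn_of_deriv_ne_zero {S : Type*} [TopologicalSpace S]
    [ChartedSpace ClosedHalfPlane S] {g : S → ℂ} {z : S} {G : ℂ → ℂ}
    (hG : AnalyticAt ℂ G (extChartAt halfPlaneR z z))
    (hGg : ∀ᶠ y in 𝓝 (extChartAt halfPlaneR z z), 0 ≤ y.im →
        g ((extChartAt halfPlaneR z).symm y) = G y)
    (hd : deriv G (extChartAt halfPlaneR z z) ≠ 0) : ∃ O ∈ 𝓝 z, InjOn g O := by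
  obtain ⟨N, hN, hinj⟩ := hG.exists_nhds_injOn hd
  set e := extChartAt halfPlaneR z with he
  refine ⟨{p | p ∈ e.source ∧ e p ∈ N ∧ g p = G (e p)}, ?_, ?_⟩
  · change ∀ᶠ p in 𝓝 z, _
    rw [eventually_nhds_iff_extChartAt]
    filter_upwards [hN, hGg, eventually_mem_target_extChartAt z] with y h1 h2 h3 him
    have hr : e (e.symm y) = y := e.right_inv (h3 him)
    refine ⟨e.map_target (h3 him), ?_, ?_⟩
    · rwa [← he, hr]
    · rw [← he, hr]; exact h2 him
  · rintro p ⟨hp, hpN, hpg⟩ q ⟨hq, hqN, hqg⟩ hpq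
    exact e.injOn hp hq (hinj hpN hqN (by rw [← hpg, ← hqg, hpq]))

section Surface

variable {S : Type*} [TopologicalSpace S] [ChartedSpace ClosedHalfPlane S]
  [IsManifold halfPlaneC ∞ S] {g : S → ℂ}

/-! ### The degree argument -/

/-- Hopf's lemma: the derivative does not vanish at boundary points. -/
lemma IsProperToDisk.deriv_ne_zero_of_mem_boundary [PreconnectedSpace S] (hg : IsProperToDisk g)
    {z : S} (hz : z ∈ halfPlaneR.boundary S) {G : ℂ → ℂ}
    (hG : AnalyticAt ℂ G (extChartAt halfPlaneR z z))
    (hGg : ∀ᶠ y in 𝓝 (extChartAt halfPlaneR z z), 0 ≤ y.im →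
        g ((extChartAt halfPlaneR z).symm y) = G y) :
    deriv G (extChartAt halfPlaneR z z) ≠ 0 := by
  refine hG.deriv_ne_zero_of_norm_le_one (hg.extension_not_const hGg)
    ((mem_boundary_iff_im_eq_zero z).1 hz) ?_ ?_
  · rw [extension_apply_self hGg]
    exact hg.norm_boundary z hz
  · filter_upwards [hGg] with y hy him
    rw [← hy him]
    exact hg.norm_le _

/-- At a critical point, every nearby value is taken twice. -/
lemma IsProperToDisk.eventually_two_preimages [PreconnectedSpace S] (hg : IsProperToDisk g)
    {z : S} {G : ℂ → ℂ} (hG : AnalyticAt ℂ G (extChartAt halfPlaneR z z))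
    (hGg : ∀ᶠ y in 𝓝 (extChartAt halfPlaneR z z), 0 ≤ y.im →
        g ((extChartAt halfPlaneR z).symm y) = G y)
    (hd : deriv G (extChartAt halfPlaneR z z) = 0) :
    ∀ᶠ w in 𝓝[≠] (g z), ∃ p q, p ≠ q ∧ g p = w ∧ g q = w := by
  -- Hopf's lemma excludes critical points on the boundary, so both nearby preimages under the
  -- extension lie in the chart.
  have hint : z ∈ halfPlaneR.interior S := mem_interior_of_notMem_boundary fun hz =>
    hg.deriv_ne_zero_of_mem_boundary hz hG hGg hd
  have him := (mem_interior_iff_im_pos z).1 hint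
  set e := extChartAt halfPlaneR z with he
  have hH : ∀ᶠ y in 𝓝 (e z), 0 < y.im :=
    (isOpen_lt continuous_const Complex.continuous_im).mem_nhds him
  have h := hG.eventually_two_preimages (hg.extension_not_const hGg) hd
    (inter_mem hH (inter_mem hGg (eventually_mem_target_extChartAt z)))
  rw [extension_apply_self hGg] at h
  filter_upwards [h] with w ⟨y₁, ⟨h1, h2, h3⟩, y₂, ⟨h1', h2', h3'⟩, hne, hw1, hw2⟩
  have h1 : 0 < y₁.im := h1
  have h1' : 0 < y₂.im := h1'
  refine ⟨e.symm y₁, e.symm y₂, fun heq => hne ?_, ?_, ?_⟩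
  · exact e.symm.injOn (h3 h1.le) (h3' h1'.le) heq
  · rw [h2 h1.le, hw1]
  · rw [h2' h1'.le, hw2]

/-- Points of the open disk with one preimage, near which the function is injective. -/
def simpleValues (g : S → ℂ) : Set ℂ :=
  {w | w ∈ Metric.ball 0 1 ∧ ∃ z, (∀ p, g p = w ↔ p = z) ∧ ∃ O ∈ 𝓝 z, InjOn g O}

/-- `g` is a closed map, so every preimage of a value close to `g z` lies in `O`, where there is at
most one; relative openness provides one. The point `z` may lie on the boundary. -/
lemma IsProperToDisk.eventually_unique_preimage [CompactSpace S] [ConnectedSpace S]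
    (hg : IsProperToDisk g) {z : S} (hz : ∀ p, g p = g z → p = z) {O : Set S} (hO : O ∈ 𝓝 z)
    (hinj : InjOn g O) : ∀ᶠ w in 𝓝[Metric.ball 0 1] (g z), w ∈ simpleValues g := by
  have hOi : interior O ∈ 𝓝 z := interior_mem_nhds.2 hO
  have hcl : IsClosedMap g := hg.holomorphic.continuous.isClosedMap
  have hnear : ∀ᶠ w in 𝓝 (g z), ∀ p, g p = w → p ∈ interior O := by
    have hc : IsClosed (g '' (interior O)ᶜ) := hcl _ isOpen_interior.isClosed_compl
    have : (g '' (interior O)ᶜ)ᶜ ∈ 𝓝 (g z) := hc.isOpen_compl.mem_nhds (by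
      rintro ⟨p, hp, hpz⟩
      rw [hz p hpz] at hp
      exact hp (mem_of_mem_nhds hOi))
    filter_upwards [this] with w hw p hp
    by_contra hpO
    exact hw ⟨p, hpO, hp⟩
  filter_upwards [hnear.filter_mono nhdsWithin_le_nhds, hg.eventually_mem_image z hOi,
    self_mem_nhdsWithin] with w h1 ⟨p, hp, hpw⟩ h3
  refine ⟨h3, p, fun q => ⟨fun hq => ?_, fun hq => hq ▸ hpw⟩, O,
    mem_of_superset (isOpen_interior.mem_nhds hp) interior_subset, hinj⟩
  exact hinj (interior_subset (h1 q hq)) (interior_subset hp) (hq.trans hpw.symm)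

/-- Distinct points with the same value prevent nearby values from being simple. -/
lemma IsProperToDisk.eventually_notMem_simpleValues [T2Space S] [PreconnectedSpace S]
    (hg : IsProperToDisk g)
    {z z' : S} (hne : z ≠ z') (heq : g z = g z') :
    ∀ᶠ w in 𝓝[Metric.ball 0 1] (g z), w ∉ simpleValues g := by
  obtain ⟨O, O', hO, hO', hz, hz', hd⟩ := t2_separation hne
  have h' := hg.eventually_mem_image z' (hO'.mem_nhds hz')
  rw [← heq] at h'
  filter_upwards [hg.eventually_mem_image z (hO.mem_nhds hz), h']
    with w ⟨p, hp, hpw⟩ ⟨q, hq, hqw⟩ ⟨_, s, hs, _⟩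
  have hpq : p = q := ((hs p).1 hpw).trans ((hs q).1 hqw).symm
  exact disjoint_left.1 hd hp (hpq ▸ hq)

/-- This is the degree argument without a degree. Simple values are open, and they exist near `g z₀`
by Hopf's lemma. A limit of simple values inside the disk has only one preimage, since two would
have disjoint neighborhoods both covering the nearby values. -/
lemma IsProperToDisk.ball_subset_simpleValues [T2Space S] [CompactSpace S] [ConnectedSpace S]
    (hg : IsProperToDisk g) {z₀ : S} (hz₀ : z₀ ∈ halfPlaneR.boundary S)
    (hinj : ∀ p, g p = g z₀ → p = z₀) : Metric.ball 0 1 ⊆ simpleValues g := by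
  have hopen : IsOpen (simpleValues g) := by
    rw [isOpen_iff_mem_nhds]
    rintro w ⟨hw, z, hz, O, hO, hOi⟩
    have hzw : g z = w := (hz z).2 rfl
    have := hg.eventually_unique_preimage (z := z)
      (fun p hp => (hz p).1 (hp.trans hzw)) hO hOi
    rwa [hzw, Metric.isOpen_ball.nhdsWithin_eq hw] at this
  refine IsPreconnected.subset_of_closure_inter_subset (convex_ball (0 : ℂ) 1).isPreconnected
    hopen ?_ ?_
  · obtain ⟨G, hG, hGg, -⟩ := hg.exists_local_extension z₀
    obtain ⟨O, hO, hOi⟩ := exists_nhds_injOn_of_deriv_ne_zero hG hGg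
      (hg.deriv_ne_zero_of_mem_boundary hz₀ hG hGg)
    have := hg.neBot_nhdsWithin_ball z₀
    obtain ⟨w, hw⟩ := (hg.eventually_unique_preimage hinj hO hOi).exists
    exact ⟨w, hw.1, hw⟩
  · rintro w ⟨hwc, hw⟩
    have hfreq : ∃ᶠ v in 𝓝 w, v ∈ simpleValues g := mem_closure_iff_frequently.1 hwc
    obtain ⟨z, rfl⟩ : w ∈ range g := by
      rw [hg.range_eq]
      exact Metric.ball_subset_closedBall hw
    have huniq : ∀ p, g p = g z → p = z := by
      intro p hp
      by_contra hne
      have := hg.eventually_notMem_simpleValues (Ne.symm hne) hp.symm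
      rw [Metric.isOpen_ball.nhdsWithin_eq hw] at this
      exact hfreq this
    obtain ⟨G, hG, hGg, -⟩ := hg.exists_local_extension z
    -- At a critical point all other nearby values would be taken twice, which would exclude an
    -- accumulation of simple values at `g z` unless `g z` itself were simple.
    by_cases hd : deriv G (extChartAt halfPlaneR z z) = 0
    · have h2 := hg.eventually_two_preimages hG hGg hd
      rw [eventually_nhdsWithin_iff] at h2
      by_contra hnot
      refine hfreq ?_
      filter_upwards [h2] with v hv hvs
      have hne : v ≠ g z := by rintro rfl; exact hnot hvs
      obtain ⟨p, q, hpq, hp, hq⟩ := hv hne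
      obtain ⟨-, s, hs, -⟩ := hvs
      exact hpq (((hs p).1 hp).trans ((hs q).1 hq).symm)
    · exact ⟨hw, z, fun p => ⟨huniq p, fun h => by rw [h]⟩,
        exists_nhds_injOn_of_deriv_ne_zero hG hGg hd⟩

/-- A proper holomorphic map to the disk that is injective at a boundary point is injective. -/
lemma IsProperToDisk.injective [T2Space S] [CompactSpace S] [ConnectedSpace S]
    (hg : IsProperToDisk g) {z₀ : S} (hz₀ : z₀ ∈ halfPlaneR.boundary S)
    (hinj : ∀ p, g p = g z₀ → p = z₀) : Function.Injective g := by
  intro z z' heq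
  by_contra hne
  have := hg.neBot_nhdsWithin_ball z
  obtain ⟨w, hw, hwb⟩ :=
    ((hg.eventually_notMem_simpleValues hne heq).and self_mem_nhdsWithin).exists
  exact hw (hg.ball_subset_simpleValues hz₀ hinj hwb)

lemma IsProperToDisk.deriv_ne_zero_of_injective [PreconnectedSpace S] (hg : IsProperToDisk g)
    (hinj : Function.Injective g) {z : S} {G : ℂ → ℂ}
    (hG : AnalyticAt ℂ G (extChartAt halfPlaneR z z))
    (hGg : ∀ᶠ y in 𝓝 (extChartAt halfPlaneR z z), 0 ≤ y.im →
        g ((extChartAt halfPlaneR z).symm y) = G y) :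
    deriv G (extChartAt halfPlaneR z z) ≠ 0 := by
  intro hd
  obtain ⟨w, p, q, hpq, hp, hq⟩ := (hg.eventually_two_preimages hG hGg hd).exists
  exact hpq (hinj (hp.trans hq.symm))

lemma IsProperToDisk.mfderiv_injective [PreconnectedSpace S] (hg : IsProperToDisk g)
    (hinj : Function.Injective g) (z : S) :
    Function.Injective (mfderiv halfPlaneR 𝓘(ℝ, ℂ) g z) := by
  obtain ⟨G, hG, hGg, -⟩ := hg.exists_local_extension z
  have hd := hg.deriv_ne_zero_of_injective hinj hG hGg
  set x := extChartAt halfPlaneR z z with hx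
  have h1 : HasFDerivWithinAt (writtenInExtChartAt halfPlaneR 𝓘(ℝ, ℂ) z g)
      ((ContinuousLinearMap.toSpanSingleton ℂ (deriv G x)).restrictScalars ℝ)
      (range halfPlaneR) x := by
    have h2 := (hG.differentiableAt.hasDerivAt.hasFDerivAt.restrictScalars ℝ).hasFDerivWithinAt
      (s := range halfPlaneR)
    refine h2.congr_of_eventuallyEq ?_ ?_
    · rw [range_halfPlaneR]
      exact eventually_nhdsWithin_iff.2 hGg
    · exact hGg.self_of_nhds (extChartAt_im_nonneg z)
  have h3 : HasMFDerivAt halfPlaneR 𝓘(ℝ, ℂ) g z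
      ((ContinuousLinearMap.toSpanSingleton ℂ (deriv G x)).restrictScalars ℝ) :=
    ⟨hg.holomorphic.continuous.continuousAt, h1⟩
  rw [h3.mfderiv]
  intro (a : ℂ) (b : ℂ) hab
  have hab : a * deriv G x = b * deriv G x := hab
  exact mul_right_cancel₀ (M₀ := ℂ) hd hab

/-- A proper holomorphic map to the disk that is injective at a boundary point is a
biholomorphism. -/
lemma IsProperToDisk.isDiskBiholomorphism [T2Space S] [CompactSpace S] [ConnectedSpace S]
    (hg : IsProperToDisk g) (hJ : IsJHolomorphic 𝓘(ℝ, ℂ) (standardJ ℂ) g) {z₀ : S}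
    (hz₀ : z₀ ∈ halfPlaneR.boundary S)
    (hinj : ∀ p, g p = g z₀ → p = z₀) : IsDiskBiholomorphism g where
  holomorphic := hJ
  injective := hg.injective hz₀ hinj
  range_eq := hg.range_eq
  immersion := hg.mfderiv_injective (hg.injective hz₀ hinj)

end Surface

lemma IsDiskBiholomorphism.norm_le {S : Type*} [TopologicalSpace S]
    [ChartedSpace ClosedHalfPlane S] {φ : S → ℂ} (hφ : IsDiskBiholomorphism φ) (z : S) :
    ‖φ z‖ ≤ 1 := by
  have : φ z ∈ range φ := mem_range_self z
  rw [hφ.range_eq] at this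
  simpa using this

section Surface

variable {S : Type*} [TopologicalSpace S] [ChartedSpace ClosedHalfPlane S]
  [IsManifold halfPlaneC ∞ S]

/-! ### Biholomorphisms to the disk -/

lemma IsDiskBiholomorphism.exists_hasDerivWithinAt {φ : S → ℂ} (hφ : IsDiskBiholomorphism φ)
    (z : S) : ∃ a ≠ 0, HasDerivWithinAt (φ ∘ (extChartAt halfPlaneR z).symm) a {z | 0 ≤ z.im}
      (extChartAt halfPlaneR z z) := by
  have h1 := (hφ.holomorphic.isChartHolomorphic.differentiable z _
    (mem_extChartAt_target z)).hasDerivWithinAt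
  refine ⟨_, ?_, h1⟩
  set a := derivWithin (φ ∘ (extChartAt halfPlaneR z).symm) {z | 0 ≤ z.im}
    (extChartAt halfPlaneR z z)
  intro ha
  have h2 := (h1.hasFDerivWithinAt.restrictScalars ℝ)
  let D : ℂ →L[ℝ] ℂ := mfderiv halfPlaneR 𝓘(ℝ, ℂ) φ z
  have h3 : HasFDerivWithinAt (φ ∘ (extChartAt halfPlaneR z).symm) D (range halfPlaneR)
      (extChartAt halfPlaneR z z) :=
    (hφ.holomorphic.contMDiff_one.mdifferentiableAt one_ne_zero (x := z)).hasMFDerivAt.2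
  have huniq : UniqueDiffWithinAt ℝ (range halfPlaneR) (extChartAt halfPlaneR z z) :=
    halfPlaneR.uniqueDiffOn _ (mem_range_self _)
  rw [← range_halfPlaneR] at h2
  have h4 := huniq.eq h3 h2
  have h5 : D 1 = D 0 := by
    rw [h4]
    change (1 : ℂ) * a = (0 : ℂ) * a
    rw [ha, mul_zero, mul_zero]
  exact one_ne_zero (α := ℂ) (hφ.immersion z h5)

/-- A biholomorphism to the disk maps the boundary to the unit circle. -/
lemma IsDiskBiholomorphism.norm_eq_one_of_mem_boundary [CompactSpace S] {φ : S → ℂ}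
    (hφ : IsDiskBiholomorphism φ) {z : S} (hz : z ∈ halfPlaneR.boundary S) : ‖φ z‖ = 1 := by
  by_contra hne
  have hlt : ‖φ z‖ < 1 := (hφ.norm_le z).lt_of_ne hne
  obtain ⟨a, ha, hda⟩ := hφ.exists_hasDerivWithinAt z
  set e := extChartAt halfPlaneR z with he
  have him : (e z).im = 0 := (mem_boundary_iff_im_eq_zero z).1 hz
  -- If `φ z` were in the open disk, these points would be in the image for small `t > 0`. Their
  -- preimages converge to `z`, as `φ` is an embedding, and in the chart they would equal `e z - i
  -- t` to first order, below the real axis. The contradiction is read off from the imaginary part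
  -- of `t / (e (q t) - e z)`.
  have hp : Tendsto (fun t : ℝ => φ z - t * (a * Complex.I)) (𝓝[>] 0) (𝓝 (φ z)) := by
    have : Continuous fun t : ℝ => φ z - t * (a * Complex.I) := by fun_prop
    have h := this.tendsto 0
    simp only [Complex.ofReal_zero, zero_mul, sub_zero] at h
    exact h.mono_left nhdsWithin_le_nhds
  have hrange : ∀ᶠ t : ℝ in 𝓝[>] 0, ∃ p, φ p = φ z - t * (a * Complex.I) := by
    filter_upwards [hp.eventually (Metric.isOpen_ball.mem_nhds
      (show φ z ∈ Metric.ball 0 1 by simpa using hlt))] with t ht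
    have := Metric.ball_subset_closedBall ht
    rwa [← hφ.range_eq] at this
  have : Nonempty S := ⟨z⟩
  obtain ⟨q, hq⟩ : ∃ q : ℝ → S, ∀ᶠ t : ℝ in 𝓝[>] 0, φ (q t) = φ z - t * (a * Complex.I) :=
    hrange.choice
  have hemb : Topology.IsClosedEmbedding φ :=
    hφ.holomorphic.contMDiff_one.continuous.isClosedEmbedding hφ.injective
  have hqz : Tendsto q (𝓝[>] 0) (𝓝 z) := by
    rw [hemb.isInducing.tendsto_nhds_iff]
    refine hp.congr' ?_
    filter_upwards [hq] with t ht
    exact ht.symm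
  have hey : Tendsto (fun t => e (q t)) (𝓝[>] 0) (𝓝 (e z)) :=
    (continuousAt_extChartAt (I := halfPlaneR) z).tendsto.comp hqz
  have hsrc : ∀ᶠ t : ℝ in 𝓝[>] 0, q t ∈ e.source :=
    hqz.eventually (extChartAt_source_mem_nhds (I := halfPlaneR) z)
  have hne : ∀ᶠ t : ℝ in 𝓝[>] 0, e (q t) ∈ {z : ℂ | 0 ≤ z.im} \ {e z} := by
    filter_upwards [hsrc, hq, self_mem_nhdsWithin] with t h1 h2 h3
    have h3 : (0 : ℝ) < t := h3
    refine ⟨mem_target_extChartAt_im (e.map_source h1), fun h => ?_⟩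
    have : q t = z := e.injOn h1 (mem_extChartAt_source z) h
    rw [this] at h2
    have h4 : (t : ℂ) * (a * Complex.I) = 0 := by linear_combination h2
    simp [h3.ne', ha] at h4
  have hsl := (hasDerivWithinAt_iff_tendsto_slope.1 hda).comp
    (tendsto_nhdsWithin_iff.2 ⟨hey, hne⟩)
  have hlim : Tendsto (fun t : ℝ => ((t : ℂ) / (e (q t) - e z)).im) (𝓝[>] 0) (𝓝 1) := by
    have h1 := (Complex.continuous_im.tendsto _).comp (hsl.mul_const (Complex.I / a))
    rw [mul_div_cancel₀ _ ha, Complex.I_im] at h1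
    refine h1.congr' ?_
    filter_upwards [hsrc, hq] with t h2 h3
    simp only [Function.comp_apply, slope_def_field]
    rw [he, extChartAt_to_inv, ← he, e.left_inv h2, h3]
    congr 1
    rw [show (φ z - t * (a * Complex.I) - φ z) / (e (q t) - e z) * (Complex.I / a)
      = (t / (e (q t) - e z)) * (a / a) * (-(Complex.I * Complex.I)) by ring, div_self ha,
      Complex.I_mul_I]
    simp
  have hcontra : (1 : ℝ) ≤ 0 := by
    refine le_of_tendsto hlim ?_
    filter_upwards [hne, self_mem_nhdsWithin] with t h1 h2
    have h2 : (0 : ℝ) < t := h2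
    have h3 : 0 ≤ (e (q t)).im := h1.1
    rw [Complex.div_im]
    simp only [Complex.ofReal_im, zero_mul, zero_div, zero_sub, Complex.ofReal_re, Complex.sub_im,
      him, sub_zero]
    have := Complex.normSq_nonneg (e (q t) - e z)
    have : 0 ≤ t * (e (q t)).im / Complex.normSq (e (q t) - e z) := by positivity
    linarith
  linarith

lemma IsDiskBiholomorphism.isProperToDisk [CompactSpace S] {φ : S → ℂ}
    (hφ : IsDiskBiholomorphism φ) : IsProperToDisk φ where
  holomorphic := hφ.holomorphic.isChartHolomorphic
  norm_le := hφ.norm_le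
  norm_boundary _ hz := hφ.norm_eq_one_of_mem_boundary hz
  nonconst := by
    rintro ⟨c, hc⟩
    have h : ∀ w ∈ Metric.closedBall (0 : ℂ) 1, w = c := by
      intro w hw
      rw [← hφ.range_eq] at hw
      obtain ⟨z, rfl⟩ := hw
      exact hc z
    have h0 := h 0 (by simp)
    have h1 := h 1 (by simp)
    exact zero_ne_one (h0.trans h1.symm)

lemma IsProperToDisk.norm_lt_one_of_mem_interior [PreconnectedSpace S] {g : S → ℂ}
    (hg : IsProperToDisk g) {z : S} (hz : z ∈ halfPlaneR.interior S) : ‖g z‖ < 1 := by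
  refine (hg.norm_le z).lt_of_ne fun h1 => ?_
  obtain ⟨G, hG, hGg, -⟩ := hg.exists_local_extension z
  have him := (mem_interior_iff_im_pos z).1 hz
  have hH : ∀ᶠ y in 𝓝 (extChartAt halfPlaneR z z), 0 < y.im :=
    (isOpen_lt continuous_const Complex.continuous_im).mem_nhds him
  refine hg.extension_not_const hGg (Complex.eventually_eq_of_isLocalMax_norm
    (hG.eventually_analyticAt.mono fun y hy => hy.differentiableAt) ?_)
  filter_upwards [hGg, hH] with y h2 h3
  simp only [Function.comp_apply]
  rw [extension_apply_self hGg, h1, ← h2 h3.le]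
  exact hg.norm_le _

lemma dense_interior_surface : Dense (halfPlaneR.interior S) := by
  intro z
  rw [mem_closure_iff_frequently]
  intro hnot
  rw [eventually_nhds_iff_extChartAt] at hnot
  obtain ⟨r, hr, hrt⟩ := Metric.eventually_nhds_iff_ball.1
    (hnot.and (eventually_mem_target_extChartAt z))
  obtain ⟨y, hy, hy'⟩ := closure_nonempty_iff.1 ⟨_, mem_closure_ball_inter_upperHalf
    (Metric.mem_ball_self hr) (extChartAt_im_nonneg z)⟩
  have hy' : 0 < y.im := hy'
  exact (hrt y hy).1 hy'.le ((mem_interior_iff_extChartAt ((hrt y hy).2 hy'.le)).2 hy')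

lemma IsDiskBiholomorphism.exists_preimage [CompactSpace S] {φ : S → ℂ}
    (hφ : IsDiskBiholomorphism φ) {w : ℂ} (hw : w ∈ Metric.ball 0 1) :
    ∃ z ∈ halfPlaneR.interior S, φ z = w := by
  obtain ⟨z, rfl⟩ : w ∈ range φ := by
    rw [hφ.range_eq]
    exact Metric.ball_subset_closedBall hw
  refine ⟨z, mem_interior_of_notMem_boundary fun hz => ?_, rfl⟩
  rw [mem_ball_zero_iff, hφ.norm_eq_one_of_mem_boundary hz] at hw
  exact lt_irrefl _ hw

/-- The transition between two disk biholomorphisms is holomorphic on the open disk. -/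
lemma IsDiskBiholomorphism.differentiableOn_transition [CompactSpace S] [ConnectedSpace S]
    {φ ψ : S → ℂ} (hφ : IsDiskBiholomorphism φ) (hψ : IsDiskBiholomorphism ψ) {F : ℂ → ℂ}
    (hF : ∀ z, F (φ z) = ψ z) : DifferentiableOn ℂ F (Metric.ball 0 1) := by
  intro w hw
  obtain ⟨z, hz, rfl⟩ := hφ.exists_preimage hw
  have hg := hφ.isProperToDisk
  obtain ⟨G, hG, hGg, -⟩ := hg.exists_local_extension z
  obtain ⟨G', hG', hGg', -⟩ := hψ.isProperToDisk.exists_local_extension z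
  have him := (mem_interior_iff_im_pos z).1 hz
  have hd := hg.deriv_ne_zero_of_injective hφ.injective hG hGg
  set x := extChartAt halfPlaneR z z with hx
  have hH : ∀ᶠ y in 𝓝 x, 0 < y.im :=
    (isOpen_lt continuous_const Complex.continuous_im).mem_nhds him
  have hGx : G x = φ z := extension_apply_self hGg
  have hs := hG.hasStrictDerivAt
  have hinv := hs.to_localInverse hd
  have hright := hs.eventually_right_inverse hd
  have hlx : hs.localInverse G (deriv G x) x hd (G x) = x :=
    (hs.hasStrictFDerivAt_equiv hd).localInverse_apply_image
  have htend : Tendsto (hs.localInverse G (deriv G x) x hd) (𝓝 (G x)) (𝓝 x) := by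
    have := hinv.hasDerivAt.continuousAt.tendsto
    rwa [hlx] at this
  rw [hGx] at *
  -- Locally `F` is the chart expression of `ψ` after the local inverse of that of `φ`.
  have hFeq : F =ᶠ[𝓝 (φ z)] fun v => G' (hs.localInverse G (deriv G x) x hd v) := by
    filter_upwards [hright, htend.eventually hGg, htend.eventually hGg', htend.eventually hH]
      with v h1 h2 h3 h4
    rw [← h3 h4.le, ← hF, h2 h4.le, h1]
  refine (DifferentiableAt.congr_of_eventuallyEq ?_ hFeq).differentiableWithinAt
  refine DifferentiableAt.comp (φ z) (g := G') ?_ hinv.hasDerivAt.differentiableAt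
  rw [hlx]
  exact hG'.differentiableAt

/-- Two disk biholomorphisms differ by a Möbius transformation. -/
lemma IsDiskBiholomorphism.exists_mobius [CompactSpace S] [ConnectedSpace S]
    {φ ψ : S → ℂ} (hφ : IsDiskBiholomorphism φ) (hψ : IsDiskBiholomorphism ψ) :
    ∃ m, IsDiskMobius m ∧ ∀ z, ψ z = m (φ z) := by
  have hφi := Function.leftInverse_invFun hφ.injective
  have hψi := Function.leftInverse_invFun hψ.injective
  set F : ℂ → ℂ := ψ ∘ Function.invFun φ
  set G : ℂ → ℂ := φ ∘ Function.invFun ψ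
  have hF : ∀ z, F (φ z) = ψ z := fun z => congrArg ψ (hφi z)
  have hG : ∀ z, G (ψ z) = φ z := fun z => congrArg φ (hψi z)
  have hmaps : ∀ {φ ψ : S → ℂ}, IsDiskBiholomorphism φ → IsDiskBiholomorphism ψ → ∀ {F : ℂ → ℂ},
      (∀ z, F (φ z) = ψ z) → MapsTo F (Metric.ball 0 1) (Metric.ball 0 1) := by
    intro φ ψ hφ hψ F hF w hw
    obtain ⟨z, hz, rfl⟩ := hφ.exists_preimage hw
    rw [hF, mem_ball_zero_iff]
    exact hψ.isProperToDisk.norm_lt_one_of_mem_interior hz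
  obtain ⟨c, a, hc, ha, hm⟩ := exists_mobius_of_inverse_selfmaps
    (hφ.differentiableOn_transition hψ hF) (hψ.differentiableOn_transition hφ hG)
    (hmaps hφ hψ hF) (hmaps hψ hφ hG)
    (fun w hw => by
      obtain ⟨z, -, rfl⟩ := hφ.exists_preimage hw
      rw [hF, hG])
    (fun w hw => by
      obtain ⟨z, -, rfl⟩ := hψ.exists_preimage hw
      rw [hG, hF])
  refine ⟨fun z => c * (z - a) / (1 - (starRingEnd ℂ) a * z), ⟨c, a, hc, ha, fun _ => rfl⟩,
    fun z => ?_⟩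
  have hcφ := hφ.holomorphic.contMDiff_one.continuous
  have hcψ := hψ.holomorphic.contMDiff_one.continuous
  -- With the denominator cleared the Möbius identity is a closed condition, so it extends from the
  -- dense interior to the boundary.
  have hclosed : IsClosed {z | ψ z * (1 - (starRingEnd ℂ) a * φ z) = c * (φ z - a)} :=
    isClosed_eq (by fun_prop) (by fun_prop)
  have hsub : halfPlaneR.interior S ⊆ {z | ψ z * (1 - (starRingEnd ℂ) a * φ z) = c * (φ z - a)} := by
    intro p hp
    have hpb : φ p ∈ Metric.ball (0 : ℂ) 1 := by
      simpa using hφ.isProperToDisk.norm_lt_one_of_mem_interior hp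
    have := hm _ hpb
    rw [hF] at this
    change _ = _
    rw [this, div_mul_cancel₀ _ (one_sub_conj_mul_ne_zero ha (hφ.norm_le p))]
  have hz : z ∈ {z | ψ z * (1 - (starRingEnd ℂ) a * φ z) = c * (φ z - a)} :=
    closure_minimal hsub hclosed (dense_interior_surface z)
  exact eq_div_of_mul_eq (one_sub_conj_mul_ne_zero ha (hφ.norm_le z)) hz

end Surface

section Surface

variable {S : Type*} [TopologicalSpace S] [ChartedSpace ClosedHalfPlane S]

/-! ### Holomorphic curves in the unit ball with boundary on the Bishop disk -/

lemma IsJHolomorphic.clm_comp {V W : Type*} [NormedAddCommGroup V] [NormedSpace ℂ V]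
    [NormedAddCommGroup W] [NormedSpace ℂ W] (T : V →L[ℂ] W) {u : S → V}
    (hu : IsJHolomorphic 𝓘(ℝ, V) (standardJ V) u) :
    IsJHolomorphic 𝓘(ℝ, W) (standardJ W) (fun z => T (u z)) where
  contMDiff_one := (T.restrictScalars ℝ).contDiff.contMDiff.comp hu.contMDiff_one
  smooth_interior z hz :=
    (T.restrictScalars ℝ).contDiff.contMDiff.contMDiffAt.comp z (hu.smooth_interior z hz)
  comm z v := by
    have h1 := (hu.contMDiff_one.mdifferentiableAt one_ne_zero (x := z)).hasMFDerivAt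
    have h2 : HasMFDerivAt 𝓘(ℝ, V) 𝓘(ℝ, W) T (u z) (T.restrictScalars ℝ) :=
      (T.restrictScalars ℝ).hasFDerivAt.hasMFDerivAt
    have h3 : mfderiv halfPlaneR 𝓘(ℝ, W) (fun z => T (u z)) z
        = (T.restrictScalars ℝ).comp (mfderiv halfPlaneR 𝓘(ℝ, V) u z) := (h2.comp z h1).mfderiv
    rw [h3]
    let D : ℂ →L[ℝ] V := mfderiv halfPlaneR 𝓘(ℝ, V) u z
    have h4 : D (Complex.I • (show ℂ from v)) = Complex.I • D v := hu.comm z v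
    change T (D (Complex.I • (show ℂ from v))) = Complex.I • T (D v)
    rw [h4, map_smul]

/-- A surface has more than one point. -/
lemma exists_ne_point (z : S) : ∃ p : S, p ≠ z := by
  obtain ⟨r, hr, hrt⟩ := exists_ball_target z
  set e := extChartAt halfPlaneR z
  have hy : e z + (r / 2 : ℝ) * Complex.I ∈ Metric.ball (e z) r := by
    rw [Metric.mem_ball, dist_eq_norm, add_sub_cancel_left, norm_mul, Complex.norm_I, mul_one,
      Complex.norm_real, Real.norm_eq_abs, abs_of_pos (by positivity)]
    linarith
  have ht := hrt _ hy (by have := extChartAt_im_nonneg z; simp; positivity)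
  refine ⟨e.symm (e z + (r / 2 : ℝ) * Complex.I), fun h => ?_⟩
  have h2 := e.right_inv ht
  rw [h] at h2
  have : ((r / 2 : ℝ) : ℂ) * Complex.I = 0 := by linear_combination -h2
  simp [hr.ne'] at this

variable [IsManifold halfPlaneC ∞ S]

/-- A nonconstant curve in the unit ball with boundary on the Bishop disk is a proper map to a
disk followed by a member of the Bishop family. -/
lemma exists_eq_bishopDisk [CompactSpace S] [ConnectedSpace S] {u : S → ℂ × ℂ}
    (hu : IsJHolomorphic 𝓘(ℝ, ℂ × ℂ) (standardJ (ℂ × ℂ)) u) (hle : ∀ z, hFun (u z) ≤ 1 / 2)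
    (hb : ∀ z ∈ halfPlaneR.boundary S, u z ∈ bishopN₀) (hne : ¬ ∃ c, ∀ z, u z = c) :
    ∃ s : ℝ, 0 ≤ s ∧ s < 1 ∧ ∃ g : S → ℂ, IsProperToDisk g ∧
      IsJHolomorphic 𝓘(ℝ, ℂ) (standardJ ℂ) g ∧ ∀ z, u z = bishopDisk s (g z) := by
  have h1J : IsJHolomorphic 𝓘(ℝ, ℂ) (standardJ ℂ) (fun z => (u z).1) :=
    hu.clm_comp (ContinuousLinearMap.fst ℂ ℂ ℂ)
  have h2J : IsJHolomorphic 𝓘(ℝ, ℂ) (standardJ ℂ) (fun z => (u z).2) :=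
    hu.clm_comp (ContinuousLinearMap.snd ℂ ℂ ℂ)
  have hb2 : ∀ z ∈ halfPlaneR.boundary S, ‖(u z).1‖ ≤ 1 ∧
      (u z).2 = (Real.sqrt (1 - ‖(u z).1‖ ^ 2) : ℂ) := by
    intro z hz
    obtain ⟨y, hy, hyu⟩ := hb z hz
    rw [← hyu]
    exact ⟨by simpa using hy, rfl⟩
  have h2c : ∀ z z', (u z).2 = (u z').2 := h2J.isChartHolomorphic.eq_of_im_boundary_eq_zero
    (fun z hz => by rw [(hb2 z hz).2, Complex.ofReal_im])
  -- Without boundary the criterion of real boundary values holds vacuously for both coordinates,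
  -- and the curve would be constant.
  obtain ⟨z₁, hz₁⟩ : (halfPlaneR.boundary S).Nonempty := by
    by_contra hemp
    rw [not_nonempty_iff_eq_empty] at hemp
    have h1c := h1J.isChartHolomorphic.eq_of_im_boundary_eq_zero (by simp [hemp])
    obtain ⟨z⟩ := (inferInstance : Nonempty S)
    exact hne ⟨u z, fun p => Prod.ext (h1c p z) (h2c p z)⟩
  set s := Real.sqrt (1 - ‖(u z₁).1‖ ^ 2) with hs
  have hs0 : 0 ≤ s := Real.sqrt_nonneg _
  have hu2 : ∀ z, (u z).2 = s := fun z => by rw [h2c z z₁, (hb2 z₁ hz₁).2]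
  have hle' : ∀ z, ‖(u z).1‖ ^ 2 ≤ 1 - s ^ 2 := by
    intro z
    have := hle z
    rw [hFun, hu2, Complex.norm_real, Real.norm_eq_abs, sq_abs] at this
    linarith
  have hbd : ∀ z ∈ halfPlaneR.boundary S, ‖(u z).1‖ ^ 2 = 1 - s ^ 2 := by
    intro z hz
    obtain ⟨h1, h2⟩ := hb2 z hz
    rw [hu2, Complex.ofReal_inj] at h2
    rw [h2, Real.sq_sqrt (by nlinarith [norm_nonneg (u z).1])]
    ring
  -- Otherwise the ball condition leaves only the point `(0, s)`.
  have hs1 : s ^ 2 < 1 := by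
    by_contra! hge
    refine hne ⟨(0, s), fun z => Prod.ext ?_ (hu2 z)⟩
    have := hle' z
    exact norm_eq_zero.1 (pow_eq_zero_iff two_ne_zero |>.1
      (le_antisymm (by linarith) (sq_nonneg ‖(u z).1‖)))
  set ρ := Real.sqrt (1 - s ^ 2) with hρ
  have hρ0 : 0 < ρ := Real.sqrt_pos.2 (by linarith)
  have hρ2 : ρ ^ 2 = 1 - s ^ 2 := Real.sq_sqrt (by linarith)
  have hρc : (ρ : ℂ) ≠ 0 := by exact_mod_cast hρ0.ne'
  have hgJ : IsJHolomorphic 𝓘(ℝ, ℂ) (standardJ ℂ) (fun z => (ρ : ℂ)⁻¹ * (u z).1) :=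
    h1J.clm_comp ((ρ : ℂ)⁻¹ • ContinuousLinearMap.id ℂ ℂ)
  have hn : ∀ z, ‖(ρ : ℂ)⁻¹ * (u z).1‖ = ρ⁻¹ * ‖(u z).1‖ := by
    intro z
    rw [norm_mul, norm_inv, Complex.norm_real, Real.norm_eq_abs, abs_of_pos hρ0]
  have huz : ∀ z, u z = bishopDisk s ((ρ : ℂ)⁻¹ * (u z).1) := by
    intro z
    refine Prod.ext ?_ (hu2 z)
    change (u z).1 = (ρ : ℂ) * ((ρ : ℂ)⁻¹ * (u z).1)
    rw [mul_inv_cancel_left₀ hρc]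
  refine ⟨s, hs0, by nlinarith, _, ⟨hgJ.isChartHolomorphic, ?_, ?_, ?_⟩, hgJ, huz⟩
  · intro z
    rw [hn, inv_mul_le_iff₀ hρ0, mul_one]
    exact le_of_sq_le_sq (by rw [hρ2]; exact hle' z) hρ0.le
  · intro z hz
    have : ‖(u z).1‖ = ρ := by
      rw [hρ, ← hbd z hz, Real.sqrt_sq (norm_nonneg _)]
    rw [hn, this, inv_mul_cancel₀ hρ0.ne']
  · rintro ⟨c, hc⟩
    refine hne ⟨bishopDisk s c, fun z => ?_⟩
    rw [huz z, ← hc z]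

/-- Twice the left side is `(1 - s²)|w|² + s²`, and `1 - s²` is positive. -/
lemma hFun_bishopDisk {s : ℝ} (hs0 : 0 ≤ s) (hs : s < 1) (w : ℂ) :
    hFun (bishopDisk s w) ≤ 1 / 2 ↔ ‖w‖ ≤ 1 := by
  have h1 : 0 < 1 - s ^ 2 := by nlinarith
  rw [hFun, bishopDisk]
  simp only [norm_mul, Complex.norm_real, Real.norm_eq_abs, mul_pow, sq_abs]
  rw [Real.sq_sqrt h1.le]
  have h2 : ‖w‖ ≤ 1 ↔ ‖w‖ ^ 2 ≤ 1 := by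
    rw [sq_le_one_iff₀ (norm_nonneg w)]
  rw [h2]
  constructor <;> intro h <;> nlinarith

/-- The image of a proper map to the disk under a member of the Bishop family. -/
lemma IsProperToDisk.range_bishopDisk [CompactSpace S] [ConnectedSpace S] {g : S → ℂ}
    (hg : IsProperToDisk g) {s : ℝ} (hs0 : 0 ≤ s) (hs : s < 1) :
    range (fun z => bishopDisk s (g z)) = {p | hFun p ≤ 1 / 2 ∧ p.2 = s} := by
  ext p
  constructor
  · rintro ⟨z, rfl⟩
    exact ⟨(hFun_bishopDisk hs0 hs _).2 (hg.norm_le z), rfl⟩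
  · rintro ⟨h1, h2⟩
    have hρ : ((Real.sqrt (1 - s ^ 2) : ℝ) : ℂ) ≠ 0 := by
      have : 0 < Real.sqrt (1 - s ^ 2) := Real.sqrt_pos.2 (by nlinarith)
      exact_mod_cast this.ne'
    have hp : p = bishopDisk s ((Real.sqrt (1 - s ^ 2) : ℂ)⁻¹ * p.1) :=
      Prod.ext (by simp only [bishopDisk]; rw [mul_inv_cancel_left₀ hρ]) h2
    have hw : (Real.sqrt (1 - s ^ 2) : ℂ)⁻¹ * p.1 ∈ range g := by
      rw [hg.range_eq, mem_closedBall_zero_iff, ← hFun_bishopDisk hs0 hs, ← hp]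
      exact h1
    obtain ⟨z, hz⟩ := hw
    exact ⟨z, by rw [hp, ← hz]⟩

end Surface

/-! ### Plurisubharmonic functions along holomorphic curves -/

section PSH

variable {E : Type*} [NormedAddCommGroup E] [NormedSpace ℝ E]
  {H : Type*} [TopologicalSpace H] {I : ModelWithCorners ℝ E H}
  {M : Type*} [TopologicalSpace M] [ChartedSpace H M]

lemma dOneForm_zero_left (α : ∀ p : M, TangentSpace I p →L[ℝ] ℝ) (p : M) (w : TangentSpace I p) :
    dOneForm I α p 0 w = 0 := by
  have h : ∀ (D : E →L[ℝ] E →L[ℝ] ℝ) (w : E), D 0 w - D w 0 = 0 := fun D w => by simp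
  exact h (fderivWithin ℝ (chartOneForm I α p) (range I) (extChartAt I p p)) w

variable [I.Boundaryless]

/-- At a point where the form is not differentiable, `fderiv` takes the value `0` and `dd^J f` would
vanish, contrary to strict positivity. The inequality thus carries the regularity that later
computations need. In dimension zero differentiability is automatic. -/
lemma IsPSHAt.differentiableAt_chartOneForm {J : EndField I M} {f : M → ℝ} {p : M}
    (h : IsPSHAt I J f p) :
    DifferentiableAt ℝ (chartOneForm I (dJ I J f) p) (extChartAt I p p) := by
  rcases subsingleton_or_nontrivial E with hE | hE
  · exact (hasFDerivAt_of_subsingleton _ _).differentiableAt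
  · obtain ⟨v, hv⟩ := exists_ne (0 : E)
    by_contra hnd
    have h1 := h v hv
    unfold dOneForm at h1
    rw [I.range_eq_univ, fderivWithin_univ, fderiv_zero_of_not_differentiableAt hnd] at h1
    change (0 : ℝ) < 0 - 0 at h1
    simp at h1

variable [IsManifold I ∞ M]

/-- The Laplacian of `f` along a `J`-holomorphic curve is `dd^J f` on the complex tangent line. -/
lemma planeLaplacian_comp_eq {J : EndField I M} {f : M → ℝ} (hf : ContMDiff I 𝓘(ℝ, ℝ) ∞ f)
    {c : ℂ → M} {x : ℂ} (hc : ContMDiffAt 𝓘(ℝ, ℂ) I ∞ c x)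
    (hJ : ∀ᶠ y in 𝓝 x, ∀ v : ℂ, mfderiv 𝓘(ℝ, ℂ) I c y (Complex.I * v : ℂ)
      = J (c y) (mfderiv 𝓘(ℝ, ℂ) I c y v))
    (hd : DifferentiableAt ℝ (chartOneForm I (dJ I J f) (c x)) (extChartAt I (c x) (c x))) :
    planeLaplacian (f ∘ c) x = dOneForm I (dJ I J f) (c x) (mfderiv 𝓘(ℝ, ℂ) I c x (1 : ℂ))
      (J (c x) (mfderiv 𝓘(ℝ, ℂ) I c x (1 : ℂ))) := by
  have two_le' : (2 : ℕ∞ω) ≤ ∞ := WithTop.coe_le_coe.2 (le_top : (2 : ℕ∞) ≤ ⊤)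
  have two_le : (1 + 1 : ℕ∞ω) ≤ ∞ := by rwa [one_add_one_eq_two]
  set p := c x with hp
  set φ := extChartAt I p with hφ
  set g : ℂ → ℝ := f ∘ c with hg
  set h : ℂ → E := φ ∘ c with hh
  set A := chartOneForm I (dJ I J f) p with hA
  have hgs : ContDiffAt ℝ ∞ g x := (hf.contMDiffAt.comp x hc).contDiffAt
  have hhs : ContDiffAt ℝ ∞ h x := by
    have h1 : ContMDiffAt I 𝓘(ℝ, E) ∞ φ (c x) := contMDiffAt_extChartAt
    exact (h1.comp x hc).contDiffAt
  have hev : ∀ᶠ y in 𝓝 x, MDifferentiableAt 𝓘(ℝ, ℂ) I c y := by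
    have : ContMDiffAt 𝓘(ℝ, ℂ) I 1 c x := hc.of_le (by simp)
    have h2 := (contMDiffAt_iff_contMDiffAt_nhds (by simp)).1 this
    filter_upwards [h2] with y hy
    exact hy.mdifferentiableAt one_ne_zero
  have hsrc : ∀ᶠ y in 𝓝 x, c y ∈ φ.source :=
    hc.continuousAt.preimage_mem_nhds (extChartAt_source_mem_nhds (I := I) p)
  -- the first order identity `A(h y)(Dh(y) v) = -Dg(y)(iv)`
  have key : ∀ᶠ y in 𝓝 x, ∀ v : ℂ,
      A (h y) (fderiv ℝ h y v) = -(fderiv ℝ g y (Complex.I * v)) := by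
    filter_upwards [hev, hJ, hsrc, hev.eventually_nhds, hsrc.eventually_nhds]
      with y hcy hJy hsy hcy' hsy' v
    have hinv : φ.symm (h y) = c y := φ.left_inv hsy
    have hyt : h y ∈ φ.target := φ.map_source hsy
    have hsymm : MDifferentiableAt 𝓘(ℝ, E) I φ.symm (h y) := by
      have := mdifferentiableWithinAt_extChartAt_symm (I := I) hyt
      rwa [I.range_eq_univ, mdifferentiableWithinAt_univ] at this
    have hφd : MDifferentiableAt I 𝓘(ℝ, E) φ (c y) :=
      mdifferentiableAt_extChartAt (by rwa [hφ, extChartAt_source] at hsy)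
    have hhd : HasMFDerivAt 𝓘(ℝ, ℂ) 𝓘(ℝ, E) h y (fderiv ℝ h y) := by
      have := (hφd.comp y hcy).hasMFDerivAt
      rwa [mfderiv_eq_fderiv] at this
    have hcd : mfderiv 𝓘(ℝ, ℂ) I c y = (mfderiv 𝓘(ℝ, E) I φ.symm (h y)).comp (fderiv ℝ h y) := by
      have h1 := hsymm.hasMFDerivAt.comp y hhd
      have h2 : c =ᶠ[𝓝 y] φ.symm ∘ h := by
        filter_upwards [hsy'] with w hw
        exact (φ.left_inv hw).symm
      exact (h1.congr_of_eventuallyEq h2).mfderiv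
    have hgd : fderiv ℝ g y = (mfderiv I 𝓘(ℝ, ℝ) f (c y)).comp (mfderiv 𝓘(ℝ, ℂ) I c y) := by
      rw [← mfderiv_eq_fderiv]
      exact mfderiv_comp y (hf.mdifferentiableAt (by simp)) hcy
    have hcdv : mfderiv 𝓘(ℝ, E) I φ.symm (h y) (fderiv ℝ h y v) = mfderiv 𝓘(ℝ, ℂ) I c y v := by
      rw [hcd]; rfl
    have hw : mfderivWithin 𝓘(ℝ, E) I φ.symm (range I) (h y) = mfderiv 𝓘(ℝ, E) I φ.symm (h y) := by
      rw [I.range_eq_univ, mfderivWithin_univ]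
    have hAdef : A (h y) (fderiv ℝ h y v) = -(show E →L[ℝ] ℝ from mfderiv I 𝓘(ℝ, ℝ) f (φ.symm (h y)))
        ((show E →L[ℝ] E from J (φ.symm (h y)))
          (mfderivWithin 𝓘(ℝ, E) I φ.symm (range I) (h y) (fderiv ℝ h y v))) := rfl
    rw [hAdef, hw, hcdv, hinv, hgd]
    congr 1
    change _ = mfderiv I 𝓘(ℝ, ℝ) f (c y) (mfderiv 𝓘(ℝ, ℂ) I c y (Complex.I * v : ℂ))
    rw [hJy v]
    rfl
  -- its derivative
  have hh1 : HasFDerivAt h (fderiv ℝ h x) x := (hhs.differentiableAt (by simp)).hasFDerivAt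
  have hh2 : HasFDerivAt (fderiv ℝ h) (fderiv ℝ (fderiv ℝ h) x) x :=
    ((hhs.fderiv_right (m := 1) two_le).differentiableAt (by simp)).hasFDerivAt
  have hg2 : HasFDerivAt (fderiv ℝ g) (fderiv ℝ (fderiv ℝ g) x) x :=
    ((hgs.fderiv_right (m := 1) two_le).differentiableAt (by simp)).hasFDerivAt
  have hhx : h x = φ p := rfl
  have hA1 : HasFDerivAt A (fderiv ℝ A (φ p)) (h x) := hd.hasFDerivAt
  have key2 : ∀ v w : ℂ, A (φ p) (fderiv ℝ (fderiv ℝ h) x v w)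
      + fderiv ℝ A (φ p) (fderiv ℝ h x v) (fderiv ℝ h x w)
      = -(fderiv ℝ (fderiv ℝ g) x v (Complex.I * w)) := by
    intro v w
    have e1 : HasFDerivAt (fun y => A (h y)) ((fderiv ℝ A (φ p)).comp (fderiv ℝ h x)) x :=
      hA1.comp x hh1
    have e2 : HasFDerivAt (fun y => fderiv ℝ h y w)
        ((ContinuousLinearMap.apply ℝ E w).comp (fderiv ℝ (fderiv ℝ h) x)) x :=
      (ContinuousLinearMap.apply ℝ E w).hasFDerivAt.comp x hh2
    have e3 := e1.clm_apply e2
    have e4 : HasFDerivAt (fun y => -(fderiv ℝ g y (Complex.I * w)))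
        (-((ContinuousLinearMap.apply ℝ ℝ (Complex.I * w)).comp (fderiv ℝ (fderiv ℝ g) x))) x :=
      ((ContinuousLinearMap.apply ℝ ℝ (Complex.I * w)).hasFDerivAt.comp x hg2).neg
    have e5 : (fun y => A (h y) (fderiv ℝ h y w)) =ᶠ[𝓝 x]
        fun y => -(fderiv ℝ g y (Complex.I * w)) := by
      filter_upwards [key] with y hy
      exact hy w
    have e6 := e3.unique (e4.congr_of_eventuallyEq e5)
    exact DFunLike.congr_fun e6 v
  have hsymm : fderiv ℝ (fderiv ℝ h) x 1 Complex.I = fderiv ℝ (fderiv ℝ h) x Complex.I 1 :=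
    (hhs.isSymmSndFDerivAt (by simpa using two_le')) 1 Complex.I
  -- At `x` the tangent space of `M` is identified with `E` by the chart at `p = c x` itself, so the
  -- two derivatives coincide; at other points a change of chart would intervene.
  have hdc : ∀ v : ℂ, mfderiv 𝓘(ℝ, ℂ) I c x v = fderiv ℝ h x v := by
    let D : ℂ →L[ℝ] E := mfderiv 𝓘(ℝ, ℂ) I c x
    have h1 : HasFDerivWithinAt h D (range 𝓘(ℝ, ℂ)) x := hev.self_of_nhds.hasMFDerivAt.2
    rw [modelWithCornersSelf_coe, range_id, hasFDerivWithinAt_univ] at h1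
    intro v
    exact DFunLike.congr_fun h1.fderiv.symm v
  have hI : J p (mfderiv 𝓘(ℝ, ℂ) I c x (1 : ℂ)) = fderiv ℝ h x Complex.I := by
    have := hJ.self_of_nhds 1
    rw [mul_one, hdc Complex.I] at this
    exact this.symm
  rw [hI, hdc 1]
  -- In the difference of the cases `(1, i)` and `(i, 1)` the second derivatives of `h` cancel by
  -- symmetry. What remains is `dA` on one side and the Laplacian on the other.
  have k1 := key2 1 Complex.I
  have k2 := key2 Complex.I 1
  rw [Complex.I_mul_I, map_neg] at k1
  rw [mul_one] at k2
  rw [hsymm] at k1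
  change _ = fderivWithin ℝ A (range I) (φ p) (fderiv ℝ h x 1) (fderiv ℝ h x Complex.I)
    - fderivWithin ℝ A (range I) (φ p) (fderiv ℝ h x Complex.I) (fderiv ℝ h x 1)
  rw [I.range_eq_univ, fderivWithin_univ]
  unfold planeLaplacian
  linarith

end PSH

section Surface

variable {S : Type*} [TopologicalSpace S] [ChartedSpace ClosedHalfPlane S]

lemma target_extChartAt_mem_nhds {z : S} {y : ℂ} (hy : y ∈ (extChartAt halfPlaneR z).target)
    (him : 0 < y.im) : (extChartAt halfPlaneR z).target ∈ 𝓝 y := by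
  have h1 := extChartAt_target_mem_nhdsWithin_of_mem (I := halfPlaneR) hy
  rwa [range_halfPlaneR, nhdsWithin_eq_nhds.2] at h1
  exact mem_of_superset ((isOpen_lt continuous_const Complex.continuous_im).mem_nhds him)
    fun v (hv : 0 < v.im) => hv.le

variable [IsManifold halfPlaneC ∞ S]

/-- The inverse of a chart has complex linear derivative at interior points. -/
lemma exists_hasMFDerivAt_extChartAt_symm {z : S} {y : ℂ}
    (hy : y ∈ (extChartAt halfPlaneR z).target) (him : 0 < y.im) :
    ∃ L : ℂ →L[ℂ] ℂ, HasMFDerivAt 𝓘(ℝ, ℂ) halfPlaneR (extChartAt halfPlaneR z).symm y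
      (L.restrictScalars ℝ) := by
  have h1 : MDifferentiableWithinAt 𝓘(ℂ, ℂ) halfPlaneC (extChartAt halfPlaneC z).symm
      (range halfPlaneC) y := mdifferentiableWithinAt_extChartAt_symm hy
  have h2 : MDifferentiableAt 𝓘(ℂ, ℂ) halfPlaneC (extChartAt halfPlaneC z).symm y :=
    h1.mdifferentiableAt (mem_of_superset (target_extChartAt_mem_nhds hy him)
      (extChartAt_target_subset_range (I := halfPlaneR) z))
  let L : ℂ →L[ℂ] ℂ := mfderiv 𝓘(ℂ, ℂ) halfPlaneC (extChartAt halfPlaneC z).symm y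
  have h3 : HasFDerivWithinAt (writtenInExtChartAt 𝓘(ℂ, ℂ) halfPlaneC y
    (extChartAt halfPlaneC z).symm) L (range 𝓘(ℂ, ℂ)) y := h2.hasMFDerivAt.2
  exact ⟨L, h2.continuousAt, h3.restrictScalars ℝ⟩

variable {E : Type*} [NormedAddCommGroup E] [NormedSpace ℝ E]
  {H : Type*} [TopologicalSpace H] {I : ModelWithCorners ℝ E H}
  {M : Type*} [TopologicalSpace M] [ChartedSpace H M]

lemma IsJHolomorphic.contMDiffAt_comp_extChartAt_symm {J : EndField I M} {u : S → M}
    (hu : IsJHolomorphic I J u) {z : S} {y : ℂ}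
    (hy : y ∈ (extChartAt halfPlaneR z).target) (him : 0 < y.im) :
    ContMDiffAt 𝓘(ℝ, ℂ) I ∞ (u ∘ (extChartAt halfPlaneR z).symm) y := by
  have := isManifold_halfPlaneR (S := S)
  have h1 : ContMDiffAt 𝓘(ℝ, ℂ) halfPlaneR ∞ (extChartAt halfPlaneR z).symm y :=
    (contMDiffOn_extChartAt_symm z).contMDiffAt (target_extChartAt_mem_nhds hy him)
  exact (hu.smooth_interior _ ((mem_interior_iff_extChartAt hy).2 him)).comp y h1

lemma IsJHolomorphic.mfderiv_comp_extChartAt_symm {J : EndField I M} {u : S → M}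
    (hu : IsJHolomorphic I J u) {z : S} {y : ℂ}
    (hy : y ∈ (extChartAt halfPlaneR z).target) (him : 0 < y.im) (v : ℂ) :
    mfderiv 𝓘(ℝ, ℂ) I (u ∘ (extChartAt halfPlaneR z).symm) y (Complex.I * v : ℂ)
      = J ((u ∘ (extChartAt halfPlaneR z).symm) y)
        (mfderiv 𝓘(ℝ, ℂ) I (u ∘ (extChartAt halfPlaneR z).symm) y v) := by
  obtain ⟨L, hL⟩ := exists_hasMFDerivAt_extChartAt_symm hy him
  have h1 := (hu.contMDiff_one.mdifferentiableAt one_ne_zero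
    (x := (extChartAt halfPlaneR z).symm y)).hasMFDerivAt
  rw [(h1.comp y hL).mfderiv]
  change mfderiv halfPlaneR I u _ (L (Complex.I * v)) = J _ (mfderiv halfPlaneR I u _ (L v))
  have h2 : L (Complex.I * v) = Complex.I * L v := by
    rw [← smul_eq_mul, map_smul, smul_eq_mul]
  rw [h2]
  exact hu.comm _ (L v)

variable [IsManifold I ∞ M]

/-- If a `J`-holomorphic curve has vanishing derivative in the interior, it is constant. -/
lemma IsJHolomorphic.eq_of_mfderiv_eq_zero [PreconnectedSpace S] {J : EndField I M} {u : S → M}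
    (hu : IsJHolomorphic I J u)
    (h0 : ∀ z : S, ∀ y ∈ (extChartAt halfPlaneR z).target, 0 < y.im →
      mfderiv 𝓘(ℝ, ℂ) I (u ∘ (extChartAt halfPlaneR z).symm) y = 0) (z z' : S) : u z = u z' := by
  refine forall_eq_of_eventually_eq (fun z => ?_) z z'
  have hcont := hu.contMDiff_one.continuous
  set e := extChartAt halfPlaneR z with he
  set φ := extChartAt I (u z) with hφ
  have hsrc : ∀ᶠ y in 𝓝 (e z), 0 ≤ y.im → u (e.symm y) ∈ φ.source :=
    (eventually_nhds_iff_extChartAt z (P := fun p => u p ∈ φ.source)).1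
      (hcont.continuousAt.preimage_mem_nhds (extChartAt_source_mem_nhds (I := I) (u z)))
  obtain ⟨r, hr, hrt⟩ := Metric.eventually_nhds_iff_ball.1
    (hsrc.and (eventually_mem_target_extChartAt z))
  set f : ℂ → E := φ ∘ (u ∘ e.symm) with hf
  have hfd : ∀ y ∈ Metric.ball (e z) r ∩ {y : ℂ | 0 < y.im}, HasFDerivAt f (0 : ℂ →L[ℝ] E) y := by
    rintro y ⟨hy, him⟩
    have him : 0 < y.im := him
    have hφd : MDifferentiableAt I 𝓘(ℝ, E) φ ((u ∘ e.symm) y) := by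
      refine mdifferentiableAt_extChartAt ?_
      have := (hrt y hy).1 him.le
      rwa [hφ, extChartAt_source] at this
    have hc := (hu.contMDiffAt_comp_extChartAt_symm ((hrt y hy).2 him.le) him).mdifferentiableAt
      (by simp)
    have h1 := hφd.hasMFDerivAt.comp y hc.hasMFDerivAt
    rw [h0 z y ((hrt y hy).2 him.le) him, ContinuousLinearMap.comp_zero] at h1
    exact h1.hasFDerivAt
  have hconv : Convex ℝ (Metric.ball (e z) r ∩ {y : ℂ | 0 < y.im}) :=
    (convex_ball _ r).inter (convex_halfSpace_im_gt 0)
  obtain ⟨d, hd⟩ := (isOpen_ball_inter_upperHalf (e z) r).exists_is_const_of_fderiv_eq_zero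
    (𝕜 := ℝ) hconv.isPreconnected
    (fun y hy => (hfd y hy).differentiableAt.differentiableWithinAt) (fun y hy => (hfd y hy).fderiv)
  have hall : ∀ y ∈ Metric.ball (e z) r, 0 ≤ y.im → f y = d := fun y hy him =>
    eq_of_eqOn_ball_inter_upperHalf (fun y hy him => by
        have h1 := continuousWithinAt_comp_extChartAt_symm hcont ((hrt y hy).2 him)
        exact (continuousAt_extChartAt' (by
          have := (hrt y hy).1 him
          rwa [hφ] at this)).comp_continuousWithinAt h1)
      (fun y hy him => hd y ⟨hy, him⟩) hy him
  rw [eventually_nhds_iff_extChartAt]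
  filter_upwards [Metric.ball_mem_nhds (e z) hr] with y hy him
  refine φ.injOn ((hrt y hy).1 him) (mem_extChartAt_source (u z)) ?_
  have h1 := hall y hy him
  have h2 := hall (e z) (Metric.mem_ball_self hr) (extChartAt_im_nonneg z)
  rw [hf] at h1 h2
  simp only [Function.comp_apply] at h1 h2
  rw [he, extChartAt_to_inv] at h2
  exact h1.trans h2.symm

variable [I.Boundaryless]

lemma IsJHolomorphic.planeLaplacian_eq {J : EndField I M} {u : S → M}
    (hu : IsJHolomorphic I J u) {f : M → ℝ} (hf : ContMDiff I 𝓘(ℝ, ℝ) ∞ f) {z : S} {y : ℂ}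
    (hy : y ∈ (extChartAt halfPlaneR z).target) (him : 0 < y.im)
    (hpsh : IsPSHAt I J f (u ((extChartAt halfPlaneR z).symm y))) :
    planeLaplacian (f ∘ u ∘ (extChartAt halfPlaneR z).symm) y
      = dOneForm I (dJ I J f) (u ((extChartAt halfPlaneR z).symm y))
        (mfderiv 𝓘(ℝ, ℂ) I (u ∘ (extChartAt halfPlaneR z).symm) y (1 : ℂ))
        (J (u ((extChartAt halfPlaneR z).symm y))
          (mfderiv 𝓘(ℝ, ℂ) I (u ∘ (extChartAt halfPlaneR z).symm) y (1 : ℂ))) := by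
  refine planeLaplacian_comp_eq hf (hu.contMDiffAt_comp_extChartAt_symm hy him) ?_
    hpsh.differentiableAt_chartOneForm
  filter_upwards [target_extChartAt_mem_nhds hy him,
    (isOpen_lt continuous_const Complex.continuous_im).mem_nhds him] with w hw hw' v
  exact hu.mfderiv_comp_extChartAt_symm hw hw' v

lemma IsJHolomorphic.planeLaplacian_nonneg {J : EndField I M} {u : S → M}
    (hu : IsJHolomorphic I J u) {f : M → ℝ} (hf : ContMDiff I 𝓘(ℝ, ℝ) ∞ f) {z : S} {y : ℂ}
    (hy : y ∈ (extChartAt halfPlaneR z).target) (him : 0 < y.im)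
    (hpsh : IsPSHAt I J f (u ((extChartAt halfPlaneR z).symm y))) :
    0 ≤ planeLaplacian (f ∘ u ∘ (extChartAt halfPlaneR z).symm) y := by
  rw [hu.planeLaplacian_eq hf hy him hpsh]
  by_cases h0 : mfderiv 𝓘(ℝ, ℂ) I (u ∘ (extChartAt halfPlaneR z).symm) y (1 : ℂ) = 0
  · rw [h0, dOneForm_zero_left]
  · exact (hpsh _ h0).le

/-- Strict positivity of `dd^J f` kills the derivative in the direction `1`, and `J`-linearity kills
it in the direction `i`. -/
lemma IsJHolomorphic.mfderiv_eq_zero_of_planeLaplacian_eq_zero {J : EndField I M} {u : S → M}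
    (hu : IsJHolomorphic I J u) {f : M → ℝ} (hf : ContMDiff I 𝓘(ℝ, ℝ) ∞ f) {z : S} {y : ℂ}
    (hy : y ∈ (extChartAt halfPlaneR z).target) (him : 0 < y.im)
    (hpsh : IsPSHAt I J f (u ((extChartAt halfPlaneR z).symm y)))
    (h0 : planeLaplacian (f ∘ u ∘ (extChartAt halfPlaneR z).symm) y = 0) :
    mfderiv 𝓘(ℝ, ℂ) I (u ∘ (extChartAt halfPlaneR z).symm) y = 0 := by
  rw [hu.planeLaplacian_eq hf hy him hpsh] at h0
  have h1 : mfderiv 𝓘(ℝ, ℂ) I (u ∘ (extChartAt halfPlaneR z).symm) y (1 : ℂ) = 0 := by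
    by_contra hne
    exact (hpsh _ hne).ne' h0
  have h2 := hu.mfderiv_comp_extChartAt_symm hy him 1
  rw [h1, mul_one] at h2
  let D : ℂ →L[ℝ] E := mfderiv 𝓘(ℝ, ℂ) I (u ∘ (extChartAt halfPlaneR z).symm) y
  have h1 : D 1 = 0 := h1
  have h2 : D Complex.I = 0 :=
    h2.trans (map_zero (J ((u ∘ (extChartAt halfPlaneR z).symm) y) : E →L[ℝ] E))
  have h3 : D = 0 := by
    ext v
    have hv : v = v.re • (1 : ℂ) + v.im • Complex.I := by simp
    rw [hv, map_add, map_smul, map_smul, h1, h2]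
    simp
  exact h3

/-- A `J`-holomorphic curve along which a nonnegative plurisubharmonic function vanishes on the
boundary is constant. -/
lemma IsJHolomorphic.eq_of_isPSHAt [CompactSpace S] [ConnectedSpace S] {J : EndField I M}
    {u : S → M} (hu : IsJHolomorphic I J u) {f : M → ℝ} (hf : ContMDiff I 𝓘(ℝ, ℝ) ∞ f)
    (hpsh : ∀ z, IsPSHAt I J f (u z)) (h0 : ∀ x, 0 ≤ f x)
    (hb : ∀ z ∈ halfPlaneR.boundary S, f (u z) = 0) (z z' : S) : u z = u z' := by
  have hcont : Continuous fun z => f (u z) := hf.continuous.comp hu.contMDiff_one.continuous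
  obtain ⟨z₀, -, hmax⟩ := isCompact_univ.exists_isMaxOn (univ_nonempty (α := S)) hcont.continuousOn
  have hmax : ∀ z, f (u z) ≤ f (u z₀) := fun z => hmax (mem_univ z)
  have hconst : ∀ z, f (u z) = f (u z₀) := by
    -- A positive maximum is attained only away from the boundary. There the strong maximum
    -- principle makes the maximum set open, hence the whole surface.
    rcases (h0 (u z₀)).eq_or_lt with hM | hM
    · exact fun z => le_antisymm (hmax z) (hM ▸ h0 _)
    have hclosed : IsClosed {z | f (u z) = f (u z₀)} := isClosed_eq hcont continuous_const
    have hopen : IsOpen {z | f (u z) = f (u z₀)} := by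
      rw [isOpen_iff_mem_nhds]
      intro z hz
      have hz : f (u z) = f (u z₀) := hz
      have hint : z ∈ halfPlaneR.interior S := mem_interior_of_notMem_boundary fun h => by
        rw [hb z h] at hz
        exact hM.ne hz
      have him := (mem_interior_iff_im_pos z).1 hint
      obtain ⟨r, hr, hrt⟩ := Metric.eventually_nhds_iff_ball.1
        ((eventually_mem_target_extChartAt z).and
          ((isOpen_lt continuous_const Complex.continuous_im).mem_nhds him))
      have htar : ∀ y ∈ Metric.ball (extChartAt halfPlaneR z z) r,
          y ∈ (extChartAt halfPlaneR z).target ∧ 0 < y.im := fun y hy =>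
        ⟨(hrt y hy).1 (show 0 < y.im from (hrt y hy).2).le, (hrt y hy).2⟩
      have := eventually_eq_of_planeLaplacian_nonneg
        (g := f ∘ u ∘ (extChartAt halfPlaneR z).symm) (M := f (u z₀)) hr
        (fun y hy => by
          have h1 := hu.contMDiffAt_comp_extChartAt_symm (htar y hy).1 (htar y hy).2
          have h2 := (hf.contMDiffAt.comp y h1).contDiffAt
          exact h2.of_le (WithTop.coe_le_coe.2 (le_top : (2 : ℕ∞) ≤ ⊤)))
        (fun y hy => hu.planeLaplacian_nonneg hf (htar y hy).1 (htar y hy).2 (hpsh _))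
        (fun y _ => hmax _)
        (by simp only [Function.comp_apply]; rw [extChartAt_to_inv, hz])
      change ∀ᶠ p in 𝓝 z, f (u p) = f (u z₀)
      rw [eventually_nhds_iff_extChartAt]
      filter_upwards [this] with y hy _
      exact hy
    have huniv := IsClopen.eq_univ ⟨hclosed, hopen⟩ ⟨z₀, rfl⟩
    exact fun z => (huniv ▸ mem_univ z : z ∈ {z | f (u z) = f (u z₀)})
  -- Being constant along the curve, `f` has zero Laplacian there, which forces the derivative of
  -- the curve to vanish.
  refine hu.eq_of_mfderiv_eq_zero (fun z y hy him => ?_) z z'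
  refine hu.mfderiv_eq_zero_of_planeLaplacian_eq_zero hf hy him (hpsh _) ?_
  have h1 : f ∘ u ∘ (extChartAt halfPlaneR z).symm = fun _ => f (u z₀) := by
    funext y
    exact hconst _
  rw [h1, planeLaplacian]
  simp

end Surface

/-! ### Plurisubharmonicity of the model function -/

/-- The derivative of `hFun` as a bilinear form: the Euclidean inner product of `ℂ²`. -/
noncomputable def euclideanForm : (ℂ × ℂ) →L[ℝ] (ℂ × ℂ) →L[ℝ] ℝ :=
  (innerSL ℝ).bilinearComp (ContinuousLinearMap.fst ℝ ℂ ℂ) (ContinuousLinearMap.fst ℝ ℂ ℂ)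
    + (innerSL ℝ).bilinearComp (ContinuousLinearMap.snd ℝ ℂ ℂ) (ContinuousLinearMap.snd ℝ ℂ ℂ)

lemma euclideanForm_apply (v w : ℂ × ℂ) :
    euclideanForm v w = inner ℝ v.1 w.1 + inner ℝ v.2 w.2 := rfl

lemma hasFDerivAt_hFun (a : ℂ × ℂ) : HasFDerivAt hFun (euclideanForm a) a := by
  have h1 := (hasFDerivAt_fst (𝕜 := ℝ) (p := a)).norm_sq
  have h2 := (hasFDerivAt_snd (𝕜 := ℝ) (p := a)).norm_sq
  have h3 := (h1.add h2).const_mul (1 / 2 : ℝ)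
  have h4 : hFun = fun p : ℂ × ℂ => (1 / 2 : ℝ) * (‖p.1‖ ^ 2 + ‖p.2‖ ^ 2) := by
    funext p
    rw [hFun]
    ring
  rw [h4]
  refine h3.congr_fderiv ?_
  ext v <;> simp [euclideanForm_apply] <;> ring

/-- The form `d^i hFun`, which depends linearly on the base point. -/
noncomputable def dIForm : (ℂ × ℂ) →L[ℝ] (ℂ × ℂ) →L[ℝ] ℝ :=
  -(euclideanForm.bilinearComp (ContinuousLinearMap.id ℝ _) (mulI (ℂ × ℂ)))

lemma dIForm_apply (v w : ℂ × ℂ) : dIForm v w = -euclideanForm v (mulI (ℂ × ℂ) w) := rfl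

/-- `dIForm` is linear in the base point and so is its own derivative; the left side is therefore
`dd^i hFun (v, iv)`. -/
lemma dIForm_antisymm (v : ℂ × ℂ) :
    dIForm v (mulI (ℂ × ℂ) v) - dIForm (mulI (ℂ × ℂ) v) v = 2 * (‖v.1‖ ^ 2 + ‖v.2‖ ^ 2) := by
  have hm : ∀ w : ℂ × ℂ, mulI (ℂ × ℂ) w = Complex.I • w := fun w => rfl
  have h2 : mulI (ℂ × ℂ) (mulI (ℂ × ℂ) v) = -v := by
    rw [hm, hm, smul_smul, Complex.I_mul_I, neg_one_smul]
  rw [dIForm_apply, dIForm_apply, h2, map_neg, euclideanForm_apply, euclideanForm_apply, hm]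
  simp only [Prod.smul_fst, Prod.smul_snd, real_inner_self_eq_norm_sq, norm_smul, Complex.norm_I,
    one_mul, neg_neg]
  ring

section Product

variable {E : Type*} [NormedAddCommGroup E] [NormedSpace ℝ E]
  {H : Type*} [TopologicalSpace H] {I : ModelWithCorners ℝ E H}
  {M : Type*} [TopologicalSpace M] [ChartedSpace H M]

/-- The almost complex structure `i ⊕ J` on `ℂ² × M`. -/
noncomputable def sumJ (J : EndField I M) : EndField ((𝓘(ℝ, ℂ × ℂ)).prod I) ((ℂ × ℂ) × M) :=
  fun p => (mulI (ℂ × ℂ)).prodMap (J p.2)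

/-- The function `hFun + f` on `ℂ² × M`. -/
noncomputable def sumF (f : M → ℝ) (p : (ℂ × ℂ) × M) : ℝ := hFun p.1 + f p.2

lemma hasMFDerivAt_sumF {f : M → ℝ} (a : ℂ × ℂ) {q : M} (hf : MDifferentiableAt I 𝓘(ℝ, ℝ) f q) :
    HasMFDerivAt ((𝓘(ℝ, ℂ × ℂ)).prod I) 𝓘(ℝ, ℝ) (sumF f) (a, q)
      ((euclideanForm a).comp (ContinuousLinearMap.fst ℝ (ℂ × ℂ) E)
        + (show E →L[ℝ] ℝ from mfderiv I 𝓘(ℝ, ℝ) f q).comp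
          (ContinuousLinearMap.snd ℝ (ℂ × ℂ) E)) := by
  have h1 : HasMFDerivAt 𝓘(ℝ, ℂ × ℂ) 𝓘(ℝ, ℝ) hFun a (euclideanForm a) :=
    (hasFDerivAt_hFun a).hasMFDerivAt
  have h2 := h1.comp (I := (𝓘(ℝ, ℂ × ℂ)).prod I) (f := Prod.fst) (a, q) (hasMFDerivAt_fst _)
  have h3 := hf.hasMFDerivAt.comp (I := (𝓘(ℝ, ℂ × ℂ)).prod I) (f := Prod.snd) (a, q)
    (hasMFDerivAt_snd _)
  exact h2.add h3

variable [I.Boundaryless] [IsManifold I ∞ M]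

/-- The preferred chart of the product is the identity times the chart of `M`. In it each summand of
the form depends only on its own base point and vector, so `dd^J` has no mixed terms. -/
lemma chartOneForm_sumF {J : EndField I M} {f : M → ℝ} (hf : ContMDiff I 𝓘(ℝ, ℝ) ∞ f)
    (z : ℂ × ℂ) (x : M) (a : ℂ × ℂ) {b : E} (hb : b ∈ (extChartAt I x).target) :
    chartOneForm ((𝓘(ℝ, ℂ × ℂ)).prod I) (dJ _ (sumJ J) (sumF f)) (z, x) (a, b)
      = (dIForm a).comp (ContinuousLinearMap.fst ℝ (ℂ × ℂ) E)
        + (chartOneForm I (dJ I J f) x b).comp (ContinuousLinearMap.snd ℝ (ℂ × ℂ) E) := by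
  set q := (extChartAt I x).symm b with hq
  have hsymm : ((extChartAt ((𝓘(ℝ, ℂ × ℂ)).prod I) ((z, x) : (ℂ × ℂ) × M)).symm :
      (ℂ × ℂ) × E → (ℂ × ℂ) × M) = fun p => (p.1, (extChartAt I x).symm p.2) := by
    rw [extChartAt_prod]
    rfl
  have hd : MDifferentiableAt 𝓘(ℝ, E) I (extChartAt I x).symm b := by
    have := mdifferentiableWithinAt_extChartAt_symm (I := I) hb
    rwa [I.range_eq_univ, mdifferentiableWithinAt_univ] at this
  let Dφ : E →L[ℝ] E := mfderiv 𝓘(ℝ, E) I (extChartAt I x).symm b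
  have hD : HasMFDerivAt 𝓘(ℝ, (ℂ × ℂ) × E) ((𝓘(ℝ, ℂ × ℂ)).prod I)
      (fun p : (ℂ × ℂ) × E => (p.1, (extChartAt I x).symm p.2)) (a, b)
      ((ContinuousLinearMap.fst ℝ (ℂ × ℂ) E).prod
        (Dφ.comp (ContinuousLinearMap.snd ℝ (ℂ × ℂ) E))) := by
    have h1 : HasMFDerivAt 𝓘(ℝ, (ℂ × ℂ) × E) 𝓘(ℝ, ℂ × ℂ) Prod.fst (a, b)
        (ContinuousLinearMap.fst ℝ (ℂ × ℂ) E) := hasFDerivAt_fst.hasMFDerivAt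
    have h2 : HasMFDerivAt 𝓘(ℝ, (ℂ × ℂ) × E) 𝓘(ℝ, E) Prod.snd (a, b)
        (ContinuousLinearMap.snd ℝ (ℂ × ℂ) E) := hasFDerivAt_snd.hasMFDerivAt
    exact h1.prodMk (hd.hasMFDerivAt.comp (a, b) h2)
  let df : E →L[ℝ] ℝ := mfderiv I 𝓘(ℝ, ℝ) f q
  let Jq : E →L[ℝ] E := J q
  have hF := (hasMFDerivAt_sumF a
    (hf.mdifferentiableAt (by simp) : MDifferentiableAt I 𝓘(ℝ, ℝ) f q)).mfderiv
  have hL : ∀ v : E, chartOneForm I (dJ I J f) x b v = -(df (Jq (Dφ v))) := by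
    intro v
    have h1 : mfderivWithin 𝓘(ℝ, E) I (extChartAt I x).symm (range I) b = Dφ := by
      rw [I.range_eq_univ, mfderivWithin_univ]
    have h2 : chartOneForm I (dJ I J f) x b v = -(df (Jq
      (mfderivWithin 𝓘(ℝ, E) I (extChartAt I x).symm (range I) b v))) := rfl
    rw [h2, h1]
    rfl
  have hT : chartOneForm ((𝓘(ℝ, ℂ × ℂ)).prod I) (dJ _ (sumJ J) (sumF f)) (z, x) (a, b)
      = -((show (ℂ × ℂ) × E →L[ℝ] ℝ from
          mfderiv ((𝓘(ℝ, ℂ × ℂ)).prod I) 𝓘(ℝ, ℝ) (sumF f) (a, q)).comp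
        (((mulI (ℂ × ℂ)).prodMap Jq).comp ((ContinuousLinearMap.fst ℝ (ℂ × ℂ) E).prod
          (Dφ.comp (ContinuousLinearMap.snd ℝ (ℂ × ℂ) E))))) := by
    unfold chartOneForm
    rw [((𝓘(ℝ, ℂ × ℂ)).prod I).range_eq_univ, mfderivWithin_univ, hsymm, hD.mfderiv]
    rfl
  rw [hT, hF]
  refine ContinuousLinearMap.ext fun w => ?_
  change -(euclideanForm a (mulI (ℂ × ℂ) w.1) + df (Jq (Dφ w.2)))
    = dIForm a w.1 + chartOneForm I (dJ I J f) x b w.2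
  rw [hL, dIForm_apply]
  ring

/-- The form `dd^J` of `hFun + f` is the sum of those of the summands. -/
lemma dOneForm_sumF {J : EndField I M} {f : M → ℝ} (hf : ContMDiff I 𝓘(ℝ, ℝ) ∞ f)
    (z : ℂ × ℂ) (x : M)
    (hd : DifferentiableAt ℝ (chartOneForm I (dJ I J f) x) (extChartAt I x x))
    (v : ℂ × ℂ) (w : E) :
    dOneForm ((𝓘(ℝ, ℂ × ℂ)).prod I) (dJ _ (sumJ J) (sumF f)) (z, x) ((v, w) : (ℂ × ℂ) × E)
        (sumJ J (z, x) ((v, w) : (ℂ × ℂ) × E))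
      = 2 * (‖v.1‖ ^ 2 + ‖v.2‖ ^ 2) + dOneForm I (dJ I J f) x w (J x w) := by
  set A := chartOneForm I (dJ I J f) x with hA
  set b := extChartAt I x x with hb
  have hpt : extChartAt ((𝓘(ℝ, ℂ × ℂ)).prod I) ((z, x) : (ℂ × ℂ) × M) (z, x) = (z, b) := by
    rw [extChartAt_prod]
    rfl
  have htar : ∀ᶠ p : (ℂ × ℂ) × E in 𝓝 (z, b), p.2 ∈ (extChartAt I x).target :=
    continuous_snd.continuousAt.preimage_mem_nhds (extChartAt_target_mem_nhds (I := I) x)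
  set T := chartOneForm ((𝓘(ℝ, ℂ × ℂ)).prod I) (dJ _ (sumJ J) (sumF f)) (z, x) with hT
  have hTe : T =ᶠ[𝓝 (z, b)] fun p => (dIForm p.1).comp (ContinuousLinearMap.fst ℝ (ℂ × ℂ) E)
      + (A p.2).comp (ContinuousLinearMap.snd ℝ (ℂ × ℂ) E) := by
    filter_upwards [htar] with p hp
    exact chartOneForm_sumF hf z x p.1 hp
  have hA1 : HasFDerivAt (fun p : (ℂ × ℂ) × E => A p.2)
      ((fderiv ℝ A b).comp (ContinuousLinearMap.snd ℝ (ℂ × ℂ) E)) (z, b) := by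
    have h0 : HasFDerivAt A (fderiv ℝ A b) ((z, b) : (ℂ × ℂ) × E).2 := hd.hasFDerivAt
    exact h0.comp (z, b) (hasFDerivAt_snd (𝕜 := ℝ) (E := ℂ × ℂ) (F := E))
  have hI1 : HasFDerivAt (fun p : (ℂ × ℂ) × E => dIForm p.1)
      (dIForm.comp (ContinuousLinearMap.fst ℝ (ℂ × ℂ) E)) (z, b) :=
    dIForm.hasFDerivAt.comp (z, b) hasFDerivAt_fst
  have hTd : DifferentiableAt ℝ T (z, b) := by
    refine DifferentiableAt.congr_of_eventuallyEq ?_ hTe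
    exact (hI1.differentiableAt.clm_comp (differentiableAt_const _)).add
      (hA1.differentiableAt.clm_comp (differentiableAt_const _))
  have hval : ∀ p q : (ℂ × ℂ) × E, fderiv ℝ T (z, b) p q
      = dIForm p.1 q.1 + fderiv ℝ A b p.2 q.2 := by
    intro p q
    have h1 : HasFDerivAt (fun y => T y q)
        ((ContinuousLinearMap.apply ℝ ℝ q).comp (fderiv ℝ T (z, b))) (z, b) :=
      (ContinuousLinearMap.apply ℝ ℝ q).hasFDerivAt.comp (z, b) hTd.hasFDerivAt
    have h2 : HasFDerivAt (fun y : (ℂ × ℂ) × E => dIForm y.1 q.1 + A y.2 q.2)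
        ((ContinuousLinearMap.apply ℝ ℝ q.1).comp
            (dIForm.comp (ContinuousLinearMap.fst ℝ (ℂ × ℂ) E))
          + (ContinuousLinearMap.apply ℝ ℝ q.2).comp
            ((fderiv ℝ A b).comp (ContinuousLinearMap.snd ℝ (ℂ × ℂ) E))) (z, b) :=
      ((ContinuousLinearMap.apply ℝ ℝ q.1).hasFDerivAt.comp (z, b) hI1).add
        ((ContinuousLinearMap.apply ℝ ℝ q.2).hasFDerivAt.comp (z, b) hA1)
    have h3 : (fun y => T y q) =ᶠ[𝓝 (z, b)] fun y => dIForm y.1 q.1 + A y.2 q.2 := by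
      filter_upwards [hTe] with y hy
      rw [hy]
      rfl
    exact DFunLike.congr_fun (h1.unique (h2.congr_of_eventuallyEq h3)) p
  let Jx : E →L[ℝ] E := J x
  change fderivWithin ℝ T (range ((𝓘(ℝ, ℂ × ℂ)).prod I)) (extChartAt ((𝓘(ℝ, ℂ × ℂ)).prod I)
      ((z, x) : (ℂ × ℂ) × M) (z, x)) (v, w) (mulI (ℂ × ℂ) v, Jx w)
    - fderivWithin ℝ T (range ((𝓘(ℝ, ℂ × ℂ)).prod I)) (extChartAt ((𝓘(ℝ, ℂ × ℂ)).prod I)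
      ((z, x) : (ℂ × ℂ) × M) (z, x)) (mulI (ℂ × ℂ) v, Jx w) (v, w)
    = _ + (fderivWithin ℝ A (range I) b w (Jx w) - fderivWithin ℝ A (range I) b (Jx w) w)
  rw [((𝓘(ℝ, ℂ × ℂ)).prod I).range_eq_univ, I.range_eq_univ, fderivWithin_univ, fderivWithin_univ,
    hpt, hval, hval, ← dIForm_antisymm]
  ring

lemma isPSHAt_sumF {J : EndField I M} {f : M → ℝ} (hf : ContMDiff I 𝓘(ℝ, ℝ) ∞ f)
    {x : M} (h : IsPSHAt I J f x) (z : ℂ × ℂ) :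
    IsPSHAt ((𝓘(ℝ, ℂ × ℂ)).prod I) (sumJ J) (sumF f) (z, x) := by
  rintro ⟨v, w⟩ hne
  have h1 := dOneForm_sumF hf z x h.differentiableAt_chartOneForm v w
  refine lt_of_lt_of_eq ?_ h1.symm
  by_cases hw : w = 0
  · have hv : v ≠ 0 := by
      rintro rfl
      exact hne (Prod.ext rfl hw)
    have h2 : 0 < ‖v.1‖ ^ 2 + ‖v.2‖ ^ 2 := by
      by_cases hv1 : v.1 = 0
      · have hv2 : v.2 ≠ 0 := fun hv2 => hv (Prod.ext hv1 hv2)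
        have := norm_pos_iff.2 hv2
        positivity
      · have := norm_pos_iff.2 hv1
        positivity
    have h3 : dOneForm I (dJ I J f) x w (J x w) = 0 := by
      rw [hw]
      exact dOneForm_zero_left (I := I) (dJ I J f) x _
    rw [h3]
    linarith
  · have h2 := h w hw
    have h3 : 0 ≤ ‖v.1‖ ^ 2 + ‖v.2‖ ^ 2 := by positivity
    linarith

/-- Test on the vectors `(0, w)`. The differentiability required by the splitting is recovered by
restricting the product form to the slice through `z`. -/
lemma isPSHAt_of_isPSHAt_sumF {J : EndField I M} {f : M → ℝ} (hf : ContMDiff I 𝓘(ℝ, ℝ) ∞ f)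
    {x : M} {z : ℂ × ℂ} (h : IsPSHAt ((𝓘(ℝ, ℂ × ℂ)).prod I) (sumJ J) (sumF f) (z, x)) :
    IsPSHAt I J f x := by
  have hd : DifferentiableAt ℝ (chartOneForm I (dJ I J f) x) (extChartAt I x x) := by
    have h1 := h.differentiableAt_chartOneForm
    have hpt : extChartAt ((𝓘(ℝ, ℂ × ℂ)).prod I) ((z, x) : (ℂ × ℂ) × M) (z, x)
        = (z, extChartAt I x x) := by
      rw [extChartAt_prod]
      rfl
    rw [hpt] at h1
    have h2 : DifferentiableAt ℝ (fun b : E => (z, b)) (extChartAt I x x) := by fun_prop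
    have h3 := (DifferentiableAt.comp (extChartAt I x x) h1 h2).clm_comp
      (differentiableAt_const (ContinuousLinearMap.inr ℝ (ℂ × ℂ) E))
    refine h3.congr_of_eventuallyEq ?_
    filter_upwards [extChartAt_target_mem_nhds (I := I) x] with b hb
    rw [Function.comp_apply, chartOneForm_sumF hf z x z hb]
    ext w
    simp
  intro w hw
  have h1 := dOneForm_sumF hf z x hd 0 w
  have h2 := h ((0, w) : (ℂ × ℂ) × E) (fun h0 => hw (congrArg Prod.snd h0))
  have h3 := lt_of_lt_of_eq h2 h1
  simpa using h3

end Product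

section Projections

variable {E : Type*} [NormedAddCommGroup E] [NormedSpace ℝ E]
  {H : Type*} [TopologicalSpace H] {I : ModelWithCorners ℝ E H}
  {M : Type*} [TopologicalSpace M] [ChartedSpace H M]
  {S : Type*} [TopologicalSpace S] [ChartedSpace ClosedHalfPlane S]

/-! ### Holomorphic curves in a product -/

lemma IsJHolomorphic.fst {J : EndField I M} {u : S → (ℂ × ℂ) × M}
    (hu : IsJHolomorphic ((𝓘(ℝ, ℂ × ℂ)).prod I) (sumJ J) u) :
    IsJHolomorphic 𝓘(ℝ, ℂ × ℂ) (standardJ (ℂ × ℂ)) (fun z => (u z).1) where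
  contMDiff_one := contMDiff_fst.comp hu.contMDiff_one
  smooth_interior z hz := contMDiffAt_fst.comp z (hu.smooth_interior z hz)
  comm z v := by
    have h1 := (hu.contMDiff_one.mdifferentiableAt one_ne_zero (x := z)).hasMFDerivAt
    let D : ℂ →L[ℝ] (ℂ × ℂ) × E := mfderiv halfPlaneR ((𝓘(ℝ, ℂ × ℂ)).prod I) u z
    have h3 : mfderiv halfPlaneR 𝓘(ℝ, ℂ × ℂ) (fun z => (u z).1) z
        = (ContinuousLinearMap.fst ℝ (ℂ × ℂ) E).comp D :=
      ((hasMFDerivAt_fst (u z)).comp z h1).mfderiv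
    rw [h3]
    exact congrArg Prod.fst (hu.comm z v)

lemma IsJHolomorphic.snd {J : EndField I M} {u : S → (ℂ × ℂ) × M}
    (hu : IsJHolomorphic ((𝓘(ℝ, ℂ × ℂ)).prod I) (sumJ J) u) :
    IsJHolomorphic I J (fun z => (u z).2) where
  contMDiff_one := contMDiff_snd.comp hu.contMDiff_one
  smooth_interior z hz := contMDiffAt_snd.comp z (hu.smooth_interior z hz)
  comm z v := by
    have h1 := (hu.contMDiff_one.mdifferentiableAt one_ne_zero (x := z)).hasMFDerivAt
    let D : ℂ →L[ℝ] (ℂ × ℂ) × E := mfderiv halfPlaneR ((𝓘(ℝ, ℂ × ℂ)).prod I) u z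
    have h3 : mfderiv halfPlaneR I (fun z => (u z).2) z
        = (ContinuousLinearMap.snd ℝ (ℂ × ℂ) E).comp D :=
      ((hasMFDerivAt_snd (u z)).comp z h1).mfderiv
    rw [h3]
    exact congrArg Prod.snd (hu.comm z v)

end Projections

/-! ### Holomorphic curves in the four dimensional model -/

section Surface

variable {S : Type*} [TopologicalSpace S] [CompactSpace S] [ConnectedSpace S]
  [ChartedSpace ClosedHalfPlane S] [IsManifold halfPlaneC ∞ S]

lemma IsProperToDisk.boundary_nonempty {g : S → ℂ} (hg : IsProperToDisk g) :
    (halfPlaneR.boundary S).Nonempty := by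
  by_contra hemp
  rw [not_nonempty_iff_eq_empty] at hemp
  obtain ⟨z⟩ := (inferInstance : Nonempty S)
  exact hg.nonconst ⟨g z, fun p =>
    hg.holomorphic.eq_of_im_boundary_eq_zero (by simp [hemp]) p z⟩

/-- Holomorphic curves in the four dimensional model. -/
lemma eq_bishopDisk_of_modelU4 [T2Space S] {δ : ℝ} (hδ : δ < 1) {u : S → ℂ × ℂ}
    (hu : IsJHolomorphic 𝓘(ℝ, ℂ × ℂ) (standardJ (ℂ × ℂ)) u) (hU : ∀ z, u z ∈ modelU4 δ)
    (hb : ∀ z ∈ halfPlaneR.boundary S, u z ∈ bishopN₀) :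
    ((∃ c, ∀ z, u z = c) ∨ ∃ s ∈ Ioo (1 - δ) 1, range u = slice4 δ s) ∧
    ((∃ z₀ ∈ halfPlaneR.boundary S, ∀ z, u z = u z₀ → z = z₀) →
      (∃ φ : S → ℂ, IsDiskBiholomorphism φ) ∧
      ∃ s ∈ Ioo (1 - δ) 1, ∀ φ : S → ℂ, IsDiskBiholomorphism φ →
        ∃ m : ℂ → ℂ, IsDiskMobius m ∧ ∀ z, u z = bishopDisk s (m (φ z))) := by
  have key : (¬ ∃ c, ∀ z, u z = c) → ∃ s ∈ Ioo (1 - δ) 1, ∃ g : S → ℂ, IsProperToDisk g ∧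
      IsJHolomorphic 𝓘(ℝ, ℂ) (standardJ ℂ) g ∧ ∀ z, u z = bishopDisk s (g z) := by
    intro hne
    obtain ⟨s, -, hs, g, hg, hgJ, hug⟩ := exists_eq_bishopDisk hu (fun z => (hU z).2) hb hne
    obtain ⟨z⟩ := (inferInstance : Nonempty S)
    have h := (hU z).1
    rw [hug z] at h
    exact ⟨s, ⟨h, hs⟩, g, hg, hgJ, hug⟩
  refine ⟨?_, ?_⟩
  · refine or_iff_not_imp_left.2 fun hne => ?_
    obtain ⟨s, hs, g, hg, -, hug⟩ := key hne
    refine ⟨s, hs, ?_⟩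
    rw [funext hug, hg.range_bishopDisk (by linarith [hs.1]) hs.2]
    ext p
    refine ⟨fun h => ⟨⟨?_, h.1⟩, h.2⟩, fun h => ⟨h.1.2, h.2⟩⟩
    rw [h.2]
    exact hs.1
  · rintro ⟨z₀, hz₀, hinj⟩
    -- A constant curve is not injective at `z₀`, because the surface has a second point.
    obtain ⟨s, hs, g, hg, hgJ, hug⟩ := key fun ⟨c, hc⟩ => by
      obtain ⟨p, hp⟩ := exists_ne_point z₀
      exact hp (hinj p ((hc p).trans (hc z₀).symm))
    have hφ := hg.isDiskBiholomorphism hgJ hz₀ fun p hp => hinj p (by rw [hug, hug, hp])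
    refine ⟨⟨g, hφ⟩, s, hs, fun φ hφ' => ?_⟩
    obtain ⟨m, hm, hgm⟩ := hφ'.exists_mobius hφ
    exact ⟨m, hm, fun z => by rw [hug, hgm]⟩

end Surface

/-! ### Admissible `δ` and holomorphic curves in the higher dimensional model -/

section HighDim

variable {n : ℕ} {L : Type*} [TopologicalSpace L] [ChartedSpace (EuclideanSpace ℝ (Fin n)) L]
  [IsManifold 𝓘(ℝ, EuclideanSpace ℝ (Fin n)) ∞ L]
  {J : EndField (cotangentModel n) (Cotangent n L)} {fL : Cotangent n L → ℝ}

lemma IsCotangentData.isPSHAt_totalF (h : IsCotangentData J fL) {p : (ℂ × ℂ) × Cotangent n L}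
    (hp : IsPSHAt (cotangentModel n) J fL p.2) :
    IsPSHAt (totalModel n) (totalJ J) (totalF fL) p :=
  isPSHAt_sumF h.smooth hp p.1

lemma IsCotangentData.isPSHAt_of_totalF (h : IsCotangentData J fL)
    {p : (ℂ × ℂ) × Cotangent n L} (hp : IsPSHAt (totalModel n) (totalJ J) (totalF fL) p) :
    IsPSHAt (cotangentModel n) J fL p.2 :=
  isPSHAt_of_isPSHAt_sumF h.smooth (z := p.1) hp

/-- The model function is plurisubharmonic on small model neighborhoods. -/
lemma IsCotangentData.exists_isPSHAt (h : IsCotangentData J fL) {δ₁ : ℝ} (hδ₁ : δ₁ ∈ Ioo (0 : ℝ) 1)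
    (hc : IsCompact (modelU fL δ₁)) :
    ∃ δ₀ ∈ Ioo (0 : ℝ) 1, ∀ δ ∈ Ioo 0 δ₀,
      ∀ p ∈ modelU fL δ, IsPSHAt (totalModel n) (totalJ J) (totalF fL) p := by
  obtain ⟨V, hV, hLV, hVpsh⟩ := eventually_nhdsSet_iff_exists.1 h.psh_near
  have hK : IsCompact (modelU fL δ₁ ∩ (Prod.snd ⁻¹' V)ᶜ) :=
    hc.inter_right (hV.preimage continuous_snd).isClosed_compl
  -- Off the neighborhood `V` of the zero section `f_L` is positive, and compactness gives it a
  -- positive minimum there; if nothing lies off `V`, any positive number does.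
  obtain ⟨m, hm0, hm⟩ : ∃ m > 0, ∀ p ∈ modelU fL δ₁ ∩ (Prod.snd ⁻¹' V)ᶜ, m ≤ fL p.2 := by
    rcases (modelU fL δ₁ ∩ (Prod.snd ⁻¹' V)ᶜ).eq_empty_or_nonempty with he | he
    · exact ⟨1, one_pos, by simp [he]⟩
    obtain ⟨p₀, hp₀, hmin⟩ := hK.exists_isMinOn he
      (h.smooth.continuous.comp continuous_snd).continuousOn
    refine ⟨fL p₀.2, (h.nonneg _).lt_of_ne' fun h0 => ?_, fun p hp => hmin hp⟩
    exact hp₀.2 (hLV ((h.zero_iff _).1 h0))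
  -- On `U_δ` one has `f_L ≤ (1 - (1 - δ)²) / 2 ≤ δ`. For `δ < m` this forces the `T*L` component
  -- into `V`.
  refine ⟨min δ₁ m, ⟨lt_min hδ₁.1 hm0, (min_le_left _ _).trans_lt hδ₁.2⟩, fun δ hδ p hp => ?_⟩
  have hδ1 : δ < δ₁ := hδ.2.trans_le (min_le_left _ _)
  have hδm : δ < m := hδ.2.trans_le (min_le_right _ _)
  have hp1 : 1 - δ ≤ p.1.2.re := hp.1
  refine h.isPSHAt_totalF (hVpsh _ ?_)
  by_contra hpV
  have h1 := hm p ⟨⟨by linarith, hp.2⟩, hpV⟩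
  have h2 : (‖p.1.1‖ ^ 2 + ‖p.1.2‖ ^ 2) / 2 + fL p.2 ≤ 1 / 2 := hp.2
  have h3 := Complex.re_le_norm p.1.2
  have h4 := hδ₁.2
  nlinarith [sq_nonneg ‖p.1.1‖, sq_nonneg δ]

variable {S : Type*} [TopologicalSpace S] [T2Space S] [CompactSpace S] [ConnectedSpace S]
  [ChartedSpace ClosedHalfPlane S] [IsManifold halfPlaneC ∞ S]

/-- Holomorphic curves in the higher dimensional model. -/
lemma IsCotangentData.eq_bishopDisk_of_modelU (h : IsCotangentData J fL) {δ : ℝ} (hδ : δ < 1)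
    (hpsh : ∀ p ∈ modelU fL δ, IsPSHAt (totalModel n) (totalJ J) (totalF fL) p)
    {u : S → (ℂ × ℂ) × Cotangent n L} (hu : IsJHolomorphic (totalModel n) (totalJ J) u)
    (hU : ∀ z, u z ∈ modelU fL δ) (hb : ∀ z ∈ halfPlaneR.boundary S, u z ∈ modelN) :
    ((∃ c, ∀ z, u z = c) ∨ ∃ s ∈ Ico (1 - δ) 1, ∃ q₀ : L, range u = slice fL δ s q₀) ∧
    ((∃ z₀ ∈ halfPlaneR.boundary S, ∀ z, u z = u z₀ → z = z₀) →
      (∃ φ : S → ℂ, IsDiskBiholomorphism φ) ∧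
      ∃ s ∈ Ico (1 - δ) 1, ∃ q₀ : L, ∀ φ : S → ℂ, IsDiskBiholomorphism φ →
        ∃ m : ℂ → ℂ, IsDiskMobius m ∧ ∀ z, u z = (bishopDisk s (m (φ z)), zeroSec q₀)) := by
  have hu1 : IsJHolomorphic 𝓘(ℝ, ℂ × ℂ) (standardJ (ℂ × ℂ)) (fun z => (u z).1) :=
    IsJHolomorphic.fst (J := J) hu
  have hu2 : IsJHolomorphic (cotangentModel n) J (fun z => (u z).2) :=
    IsJHolomorphic.snd (J := J) hu
  have hconst : ∀ z z', (u z).2 = (u z').2 := hu2.eq_of_isPSHAt h.smooth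
    (fun z => h.isPSHAt_of_totalF (hpsh _ (hU z))) h.nonneg
    fun z hz => (h.zero_iff _).2 (hb z hz).2
  have hle : ∀ z, hFun (u z).1 ≤ 1 / 2 := by
    intro z
    have h1 : hFun (u z).1 + fL (u z).2 ≤ 1 / 2 := (hU z).2
    linarith [h.nonneg (u z).2]
  have key : (¬ ∃ c, ∀ z, u z = c) → ∃ s ∈ Ico (1 - δ) 1, ∃ q₀ : L, ∃ g : S → ℂ,
      IsProperToDisk g ∧ IsJHolomorphic 𝓘(ℝ, ℂ) (standardJ ℂ) g ∧
      ∀ z, u z = (bishopDisk s (g z), zeroSec q₀) := by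
    intro hne
    obtain ⟨z⟩ := (inferInstance : Nonempty S)
    obtain ⟨s, -, hs, g, hg, hgJ, hug⟩ := exists_eq_bishopDisk hu1 hle (fun z hz => (hb z hz).1)
      fun ⟨c, hc⟩ => hne ⟨(c, (u z).2), fun p => Prod.ext (hc p) (hconst p z)⟩
    -- Only boundary points are known to lie over the zero section, so the constant `T*L` component
    -- is identified at one of them.
    obtain ⟨z₁, hz₁⟩ := hg.boundary_nonempty
    obtain ⟨q₀, hq₀⟩ := (hb z₁ hz₁).2
    have hz := (hU z).1
    rw [hug z] at hz
    exact ⟨s, ⟨hz, hs⟩, q₀, g, hg, hgJ, fun p => Prod.ext (hug p) ((hconst p z₁).trans hq₀.symm)⟩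
  refine ⟨?_, ?_⟩
  · refine or_iff_not_imp_left.2 fun hne => ?_
    obtain ⟨s, hs, q₀, g, hg, -, hug⟩ := key hne
    refine ⟨s, hs, q₀, ?_⟩
    have hrange := hg.range_bishopDisk (by linarith [hs.1]) hs.2
    have h0 : fL (zeroSec q₀) = 0 := (h.zero_iff _).2 ⟨q₀, rfl⟩
    ext p
    constructor
    · rintro ⟨z, rfl⟩
      refine ⟨hU z, ?_⟩
      rw [hug z]
      exact ⟨rfl, rfl⟩
    · rintro ⟨⟨-, hp⟩, hps, hpq⟩
      rw [totalF, hpq, h0, add_zero] at hp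
      have hmem : p.1 ∈ range fun z => bishopDisk s (g z) := by
        rw [hrange]
        exact ⟨hp, hps⟩
      obtain ⟨z, hz⟩ := hmem
      exact ⟨z, (hug z).trans (Prod.ext hz hpq.symm)⟩
  · rintro ⟨z₀, hz₀, hinj⟩
    obtain ⟨s, hs, q₀, g, hg, hgJ, hug⟩ := key fun ⟨c, hc⟩ => by
      obtain ⟨p, hp⟩ := exists_ne_point z₀
      exact hp (hinj p ((hc p).trans (hc z₀).symm))
    have hφ := hg.isDiskBiholomorphism hgJ hz₀ fun p hp => hinj p (by rw [hug, hug, hp])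
    refine ⟨⟨g, hφ⟩, s, hs, q₀, fun φ hφ' => ?_⟩
    obtain ⟨m, hm, hgm⟩ := hφ'.exists_mobius hφ
    exact ⟨m, hm, fun z => by rw [hug, hgm]⟩

end HighDim

theorem mainTheorem8 :
    -- dimension four
    (∀ (δ : ℝ), 0 < δ → δ < 1 →
      ∀ (S : Type*) [TopologicalSpace S] [T2Space S] [CompactSpace S] [ConnectedSpace S]
        [ChartedSpace ClosedHalfPlane S] [IsManifold halfPlaneC ∞ S] (u : S → ℂ × ℂ),
        IsJHolomorphic 𝓘(ℝ, ℂ × ℂ) (standardJ (ℂ × ℂ)) u →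
        (∀ z, u z ∈ modelU4 δ) →
        (∀ z ∈ halfPlaneR.boundary S, u z ∈ bishopN₀) →
        ((∃ c, ∀ z, u z = c) ∨ ∃ s ∈ Ioo (1 - δ) 1, range u = slice4 δ s) ∧
        ((∃ z₀ ∈ halfPlaneR.boundary S, ∀ z, u z = u z₀ → z = z₀) →
          (∃ φ : S → ℂ, IsDiskBiholomorphism φ) ∧
          ∃ s ∈ Ioo (1 - δ) 1, ∀ φ : S → ℂ, IsDiskBiholomorphism φ →
            ∃ m : ℂ → ℂ, IsDiskMobius m ∧ ∀ z, u z = bishopDisk s (m (φ z)))) ∧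
    -- higher dimensions
    (∀ (n : ℕ) (L : Type*) [TopologicalSpace L] [T2Space L] [CompactSpace L]
      [ChartedSpace (EuclideanSpace ℝ (Fin n)) L]
      [IsManifold 𝓘(ℝ, EuclideanSpace ℝ (Fin n)) ∞ L]
      (J : EndField (cotangentModel n) (Cotangent n L)) (fL : Cotangent n L → ℝ),
      IsCotangentData J fL →
      -- small `δ` are admissible
      ((∃ δ₁ ∈ Ioo (0 : ℝ) 1, IsCompact (modelU fL δ₁)) →
        ∃ δ₀ ∈ Ioo (0 : ℝ) 1, ∀ δ ∈ Ioo 0 δ₀,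
          ∀ p ∈ modelU fL δ, IsPSHAt (totalModel n) (totalJ J) (totalF fL) p) ∧
      -- holomorphic curves in the model neighborhood for admissible `δ`
      (∀ (δ : ℝ), 0 < δ → δ < 1 →
        (∀ p ∈ modelU fL δ, IsPSHAt (totalModel n) (totalJ J) (totalF fL) p) →
        ∀ (S : Type*) [TopologicalSpace S] [T2Space S] [CompactSpace S] [ConnectedSpace S]
          [ChartedSpace ClosedHalfPlane S] [IsManifold halfPlaneC ∞ S]
          (u : S → (ℂ × ℂ) × Cotangent n L),
          IsJHolomorphic (totalModel n) (totalJ J) u →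
          (∀ z, u z ∈ modelU fL δ) →
          (∀ z ∈ halfPlaneR.boundary S, u z ∈ modelN) →
          ((∃ c, ∀ z, u z = c) ∨
            ∃ s ∈ Ico (1 - δ) 1, ∃ q₀ : L, range u = slice fL δ s q₀) ∧
          ((∃ z₀ ∈ halfPlaneR.boundary S, ∀ z, u z = u z₀ → z = z₀) →
            (∃ φ : S → ℂ, IsDiskBiholomorphism φ) ∧
            ∃ s ∈ Ico (1 - δ) 1, ∃ q₀ : L, ∀ φ : S → ℂ, IsDiskBiholomorphism φ →
              ∃ m : ℂ → ℂ, IsDiskMobius m ∧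
                ∀ z, u z = (bishopDisk s (m (φ z)), zeroSec q₀)))) := by
  refine ⟨?_, ?_⟩
  · intro δ _ hδ S _ _ _ _ _ _ u hu hU hb
    exact eq_bishopDisk_of_modelU4 hδ hu hU hb
  · intro n L _ _ _ _ _ J fL h
    refine ⟨fun ⟨δ₁, hδ₁, hc⟩ => h.exists_isPSHAt hδ₁ hc, ?_⟩
    intro δ _ hδ hpsh S _ _ _ _ _ _ u hu hU hb
    exact h.eq_bishopDisk_of_modelU hδ hpsh hu hU hb
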